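/- **Setting.** Let $V$ be a $d$-dimensional real inner product space and $E\subset V$ a closed set containing $d+1$ affinely independent points. Let $E_\Delta=E\cup\{\Delta\}$ be the Alexandrov extension of $E$ ($\Delta$ isolated if $E$ is compact) with its Borel $\sigma$-algebra. Let $(\Omega,\mathcal A)$ be a measurable space with a filtration $\mathcal F=(\mathcal F_t)_{t\ge0}$, let $X=(X_t)_{t\ge 0}$ be an $\mathcal F$-adapted $E_\Delta$-valued process such that $X_s=\Delta$ implies $X_t=\Delta$ for $t>s$, and let $\mathbb P^{(r,x)}$, $r\ge0$, $x\in E_\Delta$, be probability measures on $(\Omega,\mathcal A)$ with $\mathbb P^{(r,x)}(X_0=x)=1$, such that $x\mapsto\mathbb P^{(s,x)}(X_t\in B)$ is measurable for all $s,t\geq 0$ and measurable $B$. Put $P_{s,s+t}(x,B)=\mathbb P^{(s,x)}(X_t\in B)$ and $P_{s,t}f(x)=\int f(y)\,P_{s,t}(x,dy)$. Suppose that $(X,\mathcal F,\{\mathbb P^{(r,x)}\})$ is a time-inhomogeneous Markov process, i.e. for all bounded measurable $f:E_\Delta\to\mathbb R$, all $r,s,t\ge0$ and $x\in E_\Delta$,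 $$\mathbb E^{(r,x)}[f(X_{s+t})\mid\mathcal F_s]=P_{r+s,r+s+t}f(X_s)\quad \mathbb P^{(r,x)}\text{-a.s.}$$ Let $\langle u,x\rangle=\langle a,x\rangle+i\langle b,x\rangle$ for $u=a+ib\in V+iV$ and $x\in V$. Let $\mathcal U$ be the set of all $u\in V+iV$ for which $x\mapsto e^{\langle u,x\rangle}$ is bounded on $E$, and for $k\in\mathbb N$ let $\mathcal U_k$ be the set of those $u$ with $\sup_{x\in E}|e^{\langle u,x\rangle}|\le k$. For $u\in\mathcal U$ let $f_u(x)=e^{\langle u,x\rangle}$ for $x\in E$ and $f_u(\Delta)=0$. Suppose that $\{P_{s,t}\}$ is *continuously affine*: there are functions $\Phi_{s,t}:\mathcal U\to\mathbb C$ and $\psi_{s,t}:\mathcal U\to V+iV$, $0\le s\le t$, with $$P_{s,t}f_u(x)=\Phi_{s,t}(u)\,e^{\langle\psi_{s,t}(u),x\rangle}\qquad(0\le s\le t,\ u\in\mathcal U,\ x\in E),$$ and, with $\mathcal Q_k=\{(t,T,u):0\le t\le T,\ u\in\mathcal U_k,\ \Phi_{v,T}(u)\ne0\text{ for }t\le v\le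 T\}$ and $\mathcal Q=\bigcup_k\mathcal Q_k$, there is a function $\phi$ on $\mathcal Q$ with $e^{\phi_{t,T}(u)}=\Phi_{t,T}(u)$, such that $\psi_{0,0}(0)=0$, $\phi_{0,0}(0)=0$, for every $k$ the maps $\psi$ and $\phi$ are continuous on $\mathcal Q_k$, and for every $k$ and $x\in E$ the maps $\Phi$ and $(t,T,u)\mapsto P_{t,T}f_u(x)$ are continuous on $\{(t,T,u):0\le t\le T,\ u\in\mathcal U_k\}$. **The càdlàg version.** Let $\tilde\Omega$ be the set of all $\omega$ such that the left (for $t>0$) and right limits of $X(\omega)$ at $t$ through rational times different from $t$ exist in $E_\Delta$ for every $t\ge0$. For $\omega\in\tilde\Omega$ let $\tilde X_t(\omega)=\lim_{q\downarrow t,\,q\in\mathbb Q,\,q>t}X_q(\omega)$, and for $\omega\notin\tilde\Omega$ let $\tilde X_t(\omega)=\Delta$. Let $T_\Delta=\inf\{t>0:\tilde X_{t-}=\Delta\text{ or }\tilde X_t=\Delta\}$, and let $\bar X_t=\tilde X_t$ for $t<T_\Delta$, $\bar X_t=\Delta$ for $t\ge T_\Delta$, and $\bar X_\infty=\Delta$.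 Let $\bar{\mathcal A}$ and $\bar{\mathcal F}_t$ be the intersections over all $(r,x)$ of the $\mathbb P^{(r,x)}$-completions $\mathcal A^{(r,x)}$ of $\mathcal A$ and $\mathcal F^{(r,x)}_t$ of $\mathcal F_t$, where $\mathcal F^{(r,x)}_t$ consists of all sets that differ from a set in $\mathcal F_t$ by a subset of a $\mathbb P^{(r,x)}$-null set. The measures $\mathbb P^{(r,x)}$ are extended to $\bar{\mathcal A}$. **Theorem.** The process $(\bar X,\bar{\mathcal F},\{\mathbb P^{(r,x)}\})$ on $(\Omega,\bar{\mathcal A})$ is a càdlàg strong Markov process and a modification of $X$. That is, all paths of $\bar X$ are càdlàg in $E_\Delta$; $\bar X$ is $\bar{\mathcal F}$-adapted; $\mathbb P^{(r,x)}(\bar X_t=X_t)=1$ for all $r,t\geq 0$ and $x\in E_\Delta$; $\mathbb P^{(r,x)}$-almost surely, $\bar X_s=\Delta$ implies $\bar X_t=\Delta$ for all $t>s$; and for every $\bar{\mathcal F}$-stopping time $\tau:\Omega\to[0,\infty]$, every bounded measurable $f:E_\Delta\to\mathbb R$ with $f(\Delta)=0$, all $r,s\ge0$ and $x\in E_\Delta$,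 $$\mathbb E^{(r,x)}[f(\bar X_{\tau+s})\mid\bar{\mathcal F}_\tau]=\mathbb E^{(r+\tau,\bar X_\tau)}[f(\bar X_s)]=P_{r+\tau,r+\tau+s}f(\bar X_\tau),$$ where the first equality holds $\mathbb P^{(r,x)}$-a.s. and the second one everywhere, the last two expressions are read as $0$ on $\{\tau=\infty\}$, $f(\bar X_{\tau+s})$ is $\mathbb P^{(r,x)}$-integrable, and the right-hand side is $\bar{\mathcal F}_\tau$-measurable. -/

import Mathlib

open MeasureTheory Filter Topology Set
open scoped NNReal ENNReal

noncomputable section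

namespace AffineProcess

/-! ### The state space with cemetery

For `E ⊆ V`, the space `E_Δ` is the Alexandrov extension `OnePoint E`, and the cemetery `Δ` is
`OnePoint.infty`. Its Borel `σ`-algebra is `σ(𝓑(E), {Δ})`. -/

instance instMeasurableSpaceOnePoint {S : Type*} [TopologicalSpace S] :
    MeasurableSpace (OnePoint S) := borel (OnePoint S)

instance instBorelSpaceOnePoint {S : Type*} [TopologicalSpace S] : BorelSpace (OnePoint S) := ⟨rfl⟩

/-! ### Time-inhomogeneous Markov processes -/

section Markov

variable {S Ω : Type*} [TopologicalSpace S] {mΩ : MeasurableSpace Ω}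

/-- `P_{s,t}(x, ·)` for `s ≤ t`: the law of `X_{t-s}` under `ℙ^(s,x)`. -/
def transition (X : ℝ≥0 → Ω → OnePoint S) (Pr : ℝ≥0 → OnePoint S → Measure Ω)
    (s t : ℝ≥0) (x : OnePoint S) : Measure (OnePoint S) :=
  (Pr s x).map (X (t - s))

/-- `(X, 𝓕, {ℙ^(r,x)})` is a time-inhomogeneous Markov process on `Ω` with state space `S_Δ`:
`ℙ^(r,x)` is the law of the process which is started in `x` at time `r`, and `X_t` is its state
after `t` further units of time. -/
structure IsMarkovProcess (F : Filtration ℝ≥0 mΩ) (X : ℝ≥0 → Ω → OnePoint S)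
    (Pr : ℝ≥0 → OnePoint S → Measure Ω) : Prop where
  adapted : ∀ t, Measurable[F t] (X t)
  absorbing : ∀ ω s t, s < t → X s ω = OnePoint.infty → X t ω = OnePoint.infty
  isProbabilityMeasure : ∀ r x, IsProbabilityMeasure (Pr r x)
  start : ∀ r x, Pr r x {ω | X 0 ω = x} = 1
  measurable_law : ∀ s t, ∀ B : Set (OnePoint S), MeasurableSet B →
    Measurable fun x => Pr s x (X t ⁻¹' B)
  markov : ∀ f : OnePoint S → ℝ, Measurable f → (∃ C : ℝ, ∀ y, |f y| ≤ C) → ∀ r x s t,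
    (Pr r x)[fun ω => f (X (s + t) ω) | F s]
      =ᵐ[Pr r x] fun ω => ∫ y, f y ∂(transition X Pr (r + s) (r + s + t) (X s ω))

end Markov

/-! ### Continuously affine transition functions

An element `a + i b` of the complexification `V + i V` is represented by the pair `(a, b)`. -/

section Affine

variable {V : Type*} [NormedAddCommGroup V] [InnerProductSpace ℝ V]

/-- The complex number `⟨u, x⟩` for `u ∈ V + i V`, `x ∈ V` (bilinear in `u` and `x`). -/
def pairing (u : V × V) (x : V) : ℂ :=
  ((inner ℝ u.1 x : ℝ) : ℂ) + ((inner ℝ u.2 x : ℝ) : ℂ) * Complex.I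

/-- `f_u(x) = exp ⟨u, x⟩` for `x ∈ E`, and `f_u(Δ) = 0`. -/
def expFun (E : Set V) (u : V × V) : OnePoint E → ℂ
  | OnePoint.infty => 0
  | OnePoint.some x => Complex.exp (pairing u (x : V))

/-- The set `𝓤` of all `u ∈ V + i V` for which `x ↦ exp ⟨u, x⟩` is bounded on `E`. -/
def setU (E : Set V) : Set (V × V) :=
  {u | ∃ C : ℝ, ∀ x ∈ E, ‖Complex.exp (pairing u x)‖ ≤ C}

/-- The set `𝓤_k` of all `u` with `|exp ⟨u, x⟩| ≤ k` on `E`. -/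
def setUk (E : Set V) (k : ℕ) : Set (V × V) :=
  {u | ∀ x ∈ E, ‖Complex.exp (pairing u x)‖ ≤ k}

/-- `{(t, T, u) : 0 ≤ t ≤ T, u ∈ 𝓤_k}`. -/
def setDk (E : Set V) (k : ℕ) : Set (ℝ≥0 × ℝ≥0 × V × V) :=
  {p | p.1 ≤ p.2.1 ∧ p.2.2 ∈ setUk E k}

/-- `𝓠_k = {(t, T, u) : 0 ≤ t ≤ T, u ∈ 𝓤_k, Φ_{v,T}(u) ≠ 0 for t ≤ v ≤ T}`. -/
def setQk (E : Set V) (Φ : ℝ≥0 → ℝ≥0 → V × V → ℂ) (k : ℕ) : Set (ℝ≥0 × ℝ≥0 × V × V) :=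
  {p | p ∈ setDk E k ∧ ∀ v, p.1 ≤ v → v ≤ p.2.1 → Φ v p.2.1 p.2.2 ≠ 0}

/-- `P` is affine with the functions `Φ`, `ψ`:
`P_{s,t} f_u(x) = Φ_{s,t}(u) exp ⟨ψ_{s,t}(u), x⟩` for `s ≤ t`, `u ∈ 𝓤`, `x ∈ E`. -/
def IsAffineWith (E : Set V) (P : ℝ≥0 → ℝ≥0 → OnePoint E → Measure (OnePoint E))
    (Φ : ℝ≥0 → ℝ≥0 → V × V → ℂ) (ψ : ℝ≥0 → ℝ≥0 → V × V → V × V) : Prop :=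
  ∀ s t, s ≤ t → ∀ u ∈ setU E, ∀ x : E,
    ∫ y, expFun E u y ∂(P s t (x : OnePoint E)) =
      Φ s t u * Complex.exp (pairing (ψ s t u) (x : V))

/-- `P` is a continuously affine transition function; here `φ` is the logarithm of `Φ` on
`𝓠 = ⋃ k, 𝓠_k` normalized by `φ_{0,0}(0) = 0`. -/
def IsContinuouslyAffine (E : Set V)
    (P : ℝ≥0 → ℝ≥0 → OnePoint E → Measure (OnePoint E)) : Prop :=
  ∃ (Φ : ℝ≥0 → ℝ≥0 → V × V → ℂ) (ψ : ℝ≥0 → ℝ≥0 → V × V → V × V) (φ : ℝ≥0 → ℝ≥0 → V × V → ℂ),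
    IsAffineWith E P Φ ψ ∧
    ψ 0 0 0 = 0 ∧
    φ 0 0 0 = 0 ∧
    (∀ k, ∀ p ∈ setQk E Φ k, Complex.exp (φ p.1 p.2.1 p.2.2) = Φ p.1 p.2.1 p.2.2) ∧
    (∀ k, ContinuousOn (fun p : ℝ≥0 × ℝ≥0 × V × V => ψ p.1 p.2.1 p.2.2) (setQk E Φ k)) ∧
    (∀ k, ContinuousOn (fun p : ℝ≥0 × ℝ≥0 × V × V => φ p.1 p.2.1 p.2.2) (setQk E Φ k)) ∧
    (∀ k, ContinuousOn (fun p : ℝ≥0 × ℝ≥0 × V × V => Φ p.1 p.2.1 p.2.2) (setDk E k)) ∧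
    (∀ (x : E) k, ContinuousOn
      (fun p : ℝ≥0 × ℝ≥0 × V × V =>
        ∫ y, expFun E p.2.2 y ∂(P p.1 p.2.1 (x : OnePoint E))) (setDk E k))

end Affine

/-! ### The càdlàg version -/

section Version

variable {S Ω : Type*} [TopologicalSpace S]

/-- The path `y` is right continuous and has left limits. -/
def IsCadlag (y : ℝ≥0 → OnePoint S) : Prop :=
  ∀ t, ContinuousWithinAt y (Ici t) t ∧ ∃ l, Tendsto y (𝓝[<] t) (𝓝 l)

/-- The rational times. -/
def ratTimes : Set ℝ≥0 := range ((↑) : ℚ≥0 → ℝ≥0)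

/-- The set `Ω̃` of all `ω` such that at each time `t` the left and right limits of `X(ω)` through
the rationals exist in `S_Δ` (nothing is required of the left limit at `t = 0`). -/
def regularSet (X : ℝ≥0 → Ω → OnePoint S) : Set Ω :=
  {ω | ∀ t : ℝ≥0,
    (∃ l, Tendsto (fun q => X q ω) (𝓝[ratTimes ∩ Ioi t] t) (𝓝 l)) ∧
    (∃ l, Tendsto (fun q => X q ω) (𝓝[ratTimes ∩ Iio t] t) (𝓝 l))}

open Classical in
/-- `X̃_t(ω)`: the right limit of `X(ω)` at `t` through the rationals if `ω ∈ Ω̃`, and `Δ` if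
`ω ∉ Ω̃`. -/
def tildeX (X : ℝ≥0 → Ω → OnePoint S) (t : ℝ≥0) (ω : Ω) : OnePoint S :=
  if ω ∈ regularSet X then limUnder (𝓝[ratTimes ∩ Ioi t] t) (fun q => X q ω) else OnePoint.infty

/-- `T_Δ = inf {t > 0 : X̃_{t-} = Δ or X̃_t = Δ}`, with values in `[0, ∞]`. -/
def explosionTime (X : ℝ≥0 → Ω → OnePoint S) (ω : Ω) : ℝ≥0∞ :=
  sInf {a | ∃ t : ℝ≥0, a = t ∧ 0 < t ∧
    (Tendsto (fun s => tildeX X s ω) (𝓝[<] t) (𝓝 OnePoint.infty) ∨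
      tildeX X t ω = OnePoint.infty)}

open Classical in
/-- `X̄ = X̃` on `[0, T_Δ)` and `X̄ = Δ` on `[T_Δ, ∞)`. -/
def barX (X : ℝ≥0 → Ω → OnePoint S) (t : ℝ≥0) (ω : Ω) : OnePoint S :=
  if (t : ℝ≥0∞) < explosionTime X ω then tildeX X t ω else OnePoint.infty

/-- The value of a process at a `[0, ∞]`-valued time, with the convention `Y_∞ = Δ`. -/
def valueAt (Y : ℝ≥0 → Ω → OnePoint S) (ω : Ω) : WithTop ℝ≥0 → OnePoint S
  | ⊤ => OnePoint.infty
  | (t : ℝ≥0) => Y t ω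

end Version

/-! ### Completions

`eventuallyMeasurableSpace m (ae μ)` is the `σ`-algebra of all sets which differ from a set in `m`
by a `μ`-null set. -/

section Completion

variable {S Ω : Type*} {mΩ : MeasurableSpace Ω}

/-- `𝓐̄`: the intersection over all `(r, x)` of the completions of the `σ`-algebra of `Ω` with
respect to `ℙ^(r,x)`. -/
def barA (Pr : ℝ≥0 → OnePoint S → Measure Ω) : MeasurableSpace Ω :=
  ⨅ (r : ℝ≥0) (x : OnePoint S), eventuallyMeasurableSpace mΩ (ae (Pr r x))

/-- `𝓕̄_t`: the intersection over all `(r, x)` of the completions of `𝓕_t` with respect to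
`ℙ^(r,x)`. -/
def barF (F : Filtration ℝ≥0 mΩ) (Pr : ℝ≥0 → OnePoint S → Measure Ω) :
    Filtration ℝ≥0 (barA Pr) where
  seq t := ⨅ (r : ℝ≥0) (x : OnePoint S), eventuallyMeasurableSpace (F t) (ae (Pr r x))
  mono' s t hst := iInf_mono fun r => iInf_mono fun x => by
    rintro A ⟨B, hB, hAB⟩
    exact ⟨B, F.mono hst B hB, hAB⟩
  le' t := iInf_mono fun r => iInf_mono fun x => by
    rintro A ⟨B, hB, hAB⟩
    exact ⟨B, F.le t B hB, hAB⟩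

theorem barA_le (Pr : ℝ≥0 → OnePoint S → Measure Ω) (r : ℝ≥0) (x : OnePoint S) :
    barA Pr ≤ eventuallyMeasurableSpace mΩ (ae (Pr r x)) :=
  iInf_le_of_le r (iInf_le _ x)

/-- The extension of `ℙ^(r,x)` to `𝓐̄`: the restriction of its completion. -/
def barPr (Pr : ℝ≥0 → OnePoint S → Measure Ω) (r : ℝ≥0) (x : OnePoint S) :
    @Measure Ω (barA Pr) :=
  @Measure.trim Ω (barA Pr) (eventuallyMeasurableSpace mΩ (ae (Pr r x)))
    (Pr r x).completion (barA_le Pr r x)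

theorem barPr_apply (Pr : ℝ≥0 → OnePoint S → Measure Ω) (r : ℝ≥0) (x : OnePoint S) {A : Set Ω}
    (hA : MeasurableSet[barA Pr] A) : barPr Pr r x A = Pr r x A :=
  trim_measurableSet_eq (barA_le Pr r x) hA

end Completion

/-! ### The two expressions on the right-hand side of the strong Markov property

Both are set to be `0` for `τ = ∞`, according to `X̄_∞ = Δ` and `f(Δ) = 0`. -/

section StrongMarkov

variable {S Ω : Type*} [TopologicalSpace S] {mΩ : MeasurableSpace Ω}

/-- `P_{r+τ,r+τ+s} f(y)`. -/
def transitionAt (P : ℝ≥0 → ℝ≥0 → OnePoint S → Measure (OnePoint S)) (f : OnePoint S → ℝ)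
    (r s : ℝ≥0) (y : OnePoint S) : WithTop ℝ≥0 → ℝ
  | ⊤ => 0
  | (t : ℝ≥0) => ∫ z, f z ∂(P (r + t) (r + t + s) y)

/-- `𝔼^(r+τ,y)[f(Y_s)]`. -/
def expectationAt (Pr : ℝ≥0 → OnePoint S → Measure Ω) (Y : ℝ≥0 → Ω → OnePoint S)
    (f : OnePoint S → ℝ) (r s : ℝ≥0) (y : OnePoint S) : WithTop ℝ≥0 → ℝ
  | ⊤ => 0
  | (t : ℝ≥0) => ∫ ω, f (Y s ω) ∂(Pr (r + t) y)

end StrongMarkov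

end AffineProcess

end

open AffineProcess

noncomputable section
namespace AffineProcess

open ProbabilityTheory

/-! ### One-sided limits along the rational times -/

section RationalTimes

/-! The probabilistic part needs only three analytic facts about the transition function. (a)
Continuity on the diagonal: for f continuous on the compact space E_Δ, P_{s,t}f(y) tends to f(x) as
(s,t,y) → (t₀,t₀,x) with s ≤ t, also for x = Δ (`isContinuousOnDiagonal`). (b) Escape: for T
slightly above t, the mass that P_{s,T}(y,·) gives to a bounded set tends to 0 as (s,y) → (t,Δ)
(`vanishesAtCemetery`). (c) For fixed d and y, the map (t,z) ↦ P_{t,d}f_{iy}(z) is continuous on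
[0,d) × E except at one time t at most (`exists_tendsto_integral_expFun`).

Regular paths. The processes q ↦ P_{r+q,r+T}f(X_q) are bounded martingales up to T, so by Doob's
upcrossing inequality they have one-sided limits along the rationals. By (a), for T close to t such
a limit nearly equals f at every cluster point of X_q; a countable separating family of f leaves
only one cluster point, and X itself has one-sided limits. Testing the right limit against
𝓕_t-measurable functions identifies it with X_t almost surely. If the path comes close to Δ, then by
(b) the nonnegative martingale q ↦ P_{r+q,r+T}(X_q,K) comes close to 0, and by a maximal inequality
it ends in 0. Hence X stays in Δ after the explosion time, and killing the regularized path there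
changes it only on a null set.

Strong Markov property. The random time is approximated from above by dyadic times, where the simple
Markov property applies. The kernels need not be Feller, but for the test functions f_{iy} fact (c)
suffices: the exceptional time is deterministic, and the event that the random time equals it is
again covered by the simple Markov property. The f_{iy} and the total mass determine a measure on
E_Δ, which gives the statement at a fixed later time; a second dyadic approximation and right
continuity give it at τ + s.

The analytic core is `exists_bound_of_measureReal_ballSet`: a starting point x from which a bounded
set is reached quickly with probability at least m is itself bounded. First, a real exponential
decaying in all directions seen by 𝓤 bounds the projection px of x to the span of the real parts of
𝓤. The modulus of P f_{iy}(x) depends on x only through px, so compactness bounds it below and makes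
it uniformly continuous in y. A law charging a bounded set whose characteristic function has almost
constant modulus near 0 has a characteristic function that varies slowly everywhere, so its phase
makes a bounded number of turns. But the phase is Im φ + ⟨Im ψ, x⟩ with Im ψ(iy) close to y, and
along y = sx/‖x‖, 0 ≤ s ≤ 1, it grows at least like ‖x‖/2. -/

theorem exists_ratTimes_between {a b : ℝ≥0} (h : a < b) : ∃ q ∈ ratTimes, a < q ∧ q < b := by
  obtain ⟨q, h1, h2⟩ := exists_rat_btwn (NNReal.coe_lt_coe.2 h)
  have hq : (0 : ℚ) ≤ q := by
    have : (0 : ℝ) ≤ q := a.2.trans h1.le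
    exact_mod_cast this
  lift q to ℚ≥0 using hq
  refine ⟨q, ⟨q, rfl⟩, ?_, ?_⟩
  · rw [← NNReal.coe_lt_coe]; exact_mod_cast h1
  · rw [← NNReal.coe_lt_coe]; exact_mod_cast h2

theorem countable_ratTimes : ratTimes.Countable := countable_range _

theorem eventually_ratTimes_right {t : ℝ≥0} {p : ℝ≥0 → Prop} :
    (∀ᶠ q in 𝓝[ratTimes ∩ Ioi t] t, p q) ↔ ∃ b, t < b ∧ ∀ q ∈ ratTimes, t < q → q < b → p q := by
  rw [inter_comm, nhdsWithin_inter', ((nhdsGT_basis t).inf_principal ratTimes).eventually_iff]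
  simp only [mem_inter_iff, mem_Ioo]
  exact exists_congr fun b => and_congr_right fun _ =>
    ⟨fun h q hq h1 h2 => h ⟨⟨h1, h2⟩, hq⟩, fun h q hq => h q hq.2 hq.1.1 hq.1.2⟩

theorem eventually_ratTimes_left {t : ℝ≥0} (ht : 0 < t) {p : ℝ≥0 → Prop} :
    (∀ᶠ q in 𝓝[ratTimes ∩ Iio t] t, p q) ↔ ∃ a, a < t ∧ ∀ q ∈ ratTimes, a < q → q < t → p q := by
  rw [inter_comm, nhdsWithin_inter',
    ((nhdsLT_basis_of_exists_lt ⟨0, ht⟩).inf_principal ratTimes).eventually_iff]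
  simp only [mem_inter_iff, mem_Ioo]
  exact exists_congr fun b => and_congr_right fun _ =>
    ⟨fun h q hq h1 h2 => h ⟨⟨h1, h2⟩, hq⟩, fun h q hq => h q hq.2 hq.1.1 hq.1.2⟩

instance neBot_ratTimes_right (t : ℝ≥0) : (𝓝[ratTimes ∩ Ioi t] t).NeBot := by
  refine neBot_iff.2 fun h => ?_
  have : ∀ᶠ q in 𝓝[ratTimes ∩ Ioi t] t, False := by rw [h]; simp
  obtain ⟨b, hb, hq⟩ := eventually_ratTimes_right.1 this
  obtain ⟨q, hqr, h1, h2⟩ := exists_ratTimes_between hb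
  exact hq q hqr h1 h2

theorem neBot_ratTimes_left {t : ℝ≥0} (ht : 0 < t) : (𝓝[ratTimes ∩ Iio t] t).NeBot := by
  refine neBot_iff.2 fun h => ?_
  have : ∀ᶠ q in 𝓝[ratTimes ∩ Iio t] t, False := by rw [h]; simp
  obtain ⟨b, hb, hq⟩ := (eventually_ratTimes_left ht).1 this
  obtain ⟨q, hqr, h1, h2⟩ := exists_ratTimes_between hb
  exact hq q hqr h1 h2

variable {Y : Type*} [TopologicalSpace Y] [RegularSpace Y] {x y : ℝ≥0 → Y} {t : ℝ≥0} {l : Y}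

/-- Right limits through the rationals of `x` converge from the right to the right limits of `x`. -/
theorem tendsto_right_of_ratTimes
    (hy : ∀ s, Tendsto x (𝓝[ratTimes ∩ Ioi s] s) (𝓝 (y s)))
    (hl : Tendsto x (𝓝[ratTimes ∩ Ioi t] t) (𝓝 l)) : Tendsto y (𝓝[>] t) (𝓝 l) := by
  -- Closed neighbourhoods of `l` are used because `y s` is only a limit of values of `x` in `C`.
  refine (closed_nhds_basis l).tendsto_right_iff.2 fun C hC => ?_
  obtain ⟨b, hb, h⟩ := eventually_ratTimes_right.1 (hl hC.1)
  filter_upwards [Ioo_mem_nhdsGT hb] with s hs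
  refine hC.2.mem_of_tendsto (hy s) (eventually_ratTimes_right.2 ⟨b, hs.2, fun q hq h1 h2 => ?_⟩)
  exact h q hq (hs.1.trans h1) h2

/-- Right limits through the rationals of `x` converge from the left to the left limits of `x`. -/
theorem tendsto_left_of_ratTimes
    (hy : ∀ s, Tendsto x (𝓝[ratTimes ∩ Ioi s] s) (𝓝 (y s)))
    (hl : Tendsto x (𝓝[ratTimes ∩ Iio t] t) (𝓝 l)) : Tendsto y (𝓝[<] t) (𝓝 l) := by
  rcases eq_zero_or_pos t with rfl | ht
  · simp
  refine (closed_nhds_basis l).tendsto_right_iff.2 fun C hC => ?_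
  obtain ⟨b, hb, h⟩ := (eventually_ratTimes_left ht).1 (hl hC.1)
  filter_upwards [Ioo_mem_nhdsLT hb] with s hs
  refine hC.2.mem_of_tendsto (hy s) (eventually_ratTimes_right.2 ⟨t, hs.2, fun q hq h1 h2 => ?_⟩)
  exact h q hq (hs.1.trans h1) h2

end RationalTimes

/-! ### Path properties of the regularized and of the killed process -/

section Paths

variable {S Ω : Type*} [TopologicalSpace S] {X : ℝ≥0 → Ω → OnePoint S} {ω : Ω}

theorem tendsto_tildeX (hω : ω ∈ regularSet X) (t : ℝ≥0) :
    Tendsto (fun q => X q ω) (𝓝[ratTimes ∩ Ioi t] t) (𝓝 (tildeX X t ω)) := by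
  rw [tildeX, if_pos hω]
  exact tendsto_nhds_limUnder (hω t).1

theorem isCadlag_tildeX [T2Space (OnePoint S)] (ω : Ω) : IsCadlag fun t => tildeX X t ω := by
  intro t
  by_cases hω : ω ∈ regularSet X
  · refine ⟨continuousWithinAt_Ioi_iff_Ici.1
      (tendsto_right_of_ratTimes (tendsto_tildeX hω) (tendsto_tildeX hω t)), ?_⟩
    obtain ⟨l, hl⟩ := (hω t).2
    exact ⟨l, tendsto_left_of_ratTimes (tendsto_tildeX hω) hl⟩
  · have : (fun t => tildeX X t ω) = fun _ => OnePoint.infty := by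
      funext t; rw [tildeX, if_neg hω]
    rw [this]
    exact ⟨continuousWithinAt_const, _, tendsto_const_nhds⟩

theorem barX_of_lt {t : ℝ≥0} (h : (t : ℝ≥0∞) < explosionTime X ω) :
    barX X t ω = tildeX X t ω := if_pos h

theorem barX_of_le {t : ℝ≥0} (h : explosionTime X ω ≤ t) :
    barX X t ω = OnePoint.infty := if_neg h.not_gt

theorem isCadlag_barX [T2Space (OnePoint S)] (ω : Ω) : IsCadlag fun t => barX X t ω := by
  intro t
  constructor
  · by_cases h : (t : ℝ≥0∞) < explosionTime X ω
    · refine (isCadlag_tildeX (X := X) ω t).1.congr_of_eventuallyEq ?_ (barX_of_lt h)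
      have : ∀ᶠ s : ℝ≥0 in 𝓝[≥] t, (s : ℝ≥0∞) < explosionTime X ω :=
        mem_nhdsWithin_of_mem_nhds
          ((ENNReal.continuous_coe.tendsto t).eventually (gt_mem_nhds h))
      exact this.mono fun s hs => barX_of_lt hs
    · rw [not_lt] at h
      refine continuousWithinAt_const.congr (fun s hs => barX_of_le ?_) (barX_of_le h)
      exact h.trans (ENNReal.coe_le_coe.2 hs)
  · by_cases h : (t : ℝ≥0∞) ≤ explosionTime X ω
    · obtain ⟨l, hl⟩ := (isCadlag_tildeX (X := X) ω t).2
      refine ⟨l, hl.congr' ?_⟩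
      filter_upwards [self_mem_nhdsWithin] with s hs
      exact (barX_of_lt ((ENNReal.coe_lt_coe.2 hs).trans_le h)).symm
    · rw [not_le] at h
      refine ⟨OnePoint.infty, tendsto_const_nhds.congr' ?_⟩
      have : ∀ᶠ s : ℝ≥0 in 𝓝[<] t, explosionTime X ω < s :=
        mem_nhdsWithin_of_mem_nhds
          ((ENNReal.continuous_coe.tendsto t).eventually (lt_mem_nhds h))
      exact this.mono fun s hs => (barX_of_le hs.le).symm

/-- Before each time after the explosion time, the path comes arbitrarily close to the cemetery
through rational times. -/
theorem exists_tendsto_infty_of_explosionTime_lt [T2Space (OnePoint S)]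
    (hω : ω ∈ regularSet X) {T : ℝ≥0} (hT : explosionTime X ω < T) :
    ∃ t < T, ∃ D : Set ℝ≥0, (𝓝[ratTimes ∩ D] t).NeBot ∧
      Tendsto (fun q => X q ω) (𝓝[ratTimes ∩ D] t) (𝓝 OnePoint.infty) := by
  obtain ⟨a, ⟨t, rfl, ht0, h⟩, haT⟩ := sInf_lt_iff.1 hT
  refine ⟨t, ENNReal.coe_lt_coe.1 haT, ?_⟩
  rcases h with h | h
  · have := neBot_ratTimes_left ht0
    have h1 : (𝓝[<] t).NeBot := nhdsLT_neBot_of_exists_lt ⟨0, ht0⟩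
    obtain ⟨l, hl⟩ := (hω t).2
    have : l = OnePoint.infty :=
      tendsto_nhds_unique (tendsto_left_of_ratTimes (tendsto_tildeX hω) hl) h
    exact ⟨Iio t, inferInstance, this ▸ hl⟩
  · exact ⟨Ioi t, inferInstance, h ▸ tendsto_tildeX hω t⟩

end Paths

/-! ### Transition kernels and the martingales which they define -/

section MarkovBasics

variable {S Ω : Type*} [TopologicalSpace S] {mΩ : MeasurableSpace Ω} {F : Filtration ℝ≥0 mΩ}
  {X : ℝ≥0 → Ω → OnePoint S} {Pr : ℝ≥0 → OnePoint S → Measure Ω}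

theorem transition_of_le {s t : ℝ≥0} (h : t ≤ s) (x : OnePoint S) :
    transition X Pr s t x = (Pr s x).map (X 0) := by
  rw [transition, tsub_eq_zero_of_le h]

/-- The process `q ↦ P_{r+q,r+T} f(X_q)`, which is a martingale under `ℙ^(r,x)` up to time `T`. -/
def transitionMartingale (X : ℝ≥0 → Ω → OnePoint S) (Pr : ℝ≥0 → OnePoint S → Measure Ω)
    (f : OnePoint S → ℝ) (r T q : ℝ≥0) (ω : Ω) : ℝ :=
  ∫ y, f y ∂(transition X Pr (r + q) (r + T) (X q ω))

namespace IsMarkovProcess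

variable (hX : IsMarkovProcess F X Pr)
include hX

theorem measurable (t : ℝ≥0) : Measurable (X t) := (hX.adapted t).mono (F.le t) le_rfl

theorem isProbabilityMeasure_transition (s t : ℝ≥0) (x : OnePoint S) :
    IsProbabilityMeasure (transition X Pr s t x) :=
  have := hX.isProbabilityMeasure s x
  Measure.isProbabilityMeasure_map (hX.measurable _).aemeasurable

theorem measurable_transition (s t : ℝ≥0) : Measurable fun x => transition X Pr s t x := by
  refine Measure.measurable_of_measurable_coe _ fun B hB => ?_
  simp only [transition, Measure.map_apply (hX.measurable _) hB]
  exact hX.measurable_law s (t - s) B hB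

theorem ae_start [T1Space (OnePoint S)] (r : ℝ≥0) (x : OnePoint S) :
    ∀ᵐ ω ∂(Pr r x), X 0 ω = x := by
  have := hX.isProbabilityMeasure r x
  have h : MeasurableSet {ω | X 0 ω = x} := hX.measurable 0 (measurableSet_singleton x)
  exact (prob_compl_eq_zero_iff h).2 (hX.start r x)

theorem measurable_integral_transition {f : OnePoint S → ℝ} (hf : Measurable f) (s t : ℝ≥0) :
    Measurable fun x => ∫ y, f y ∂(transition X Pr s t x) :=
  haveI : IsMarkovKernel (⟨_, hX.measurable_transition s t⟩ : Kernel (OnePoint S) (OnePoint S)) :=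
    ⟨fun x => hX.isProbabilityMeasure_transition s t x⟩
  (StronglyMeasurable.integral_kernel
    (κ := (⟨_, hX.measurable_transition s t⟩ : Kernel (OnePoint S) (OnePoint S)))
    hf.stronglyMeasurable).measurable

theorem norm_integral_transition_le {G : Type*} [NormedAddCommGroup G] [NormedSpace ℝ G]
    {f : OnePoint S → G} {C : ℝ} (hC : ∀ y, ‖f y‖ ≤ C) (s t : ℝ≥0)
    (x : OnePoint S) : ‖∫ y, f y ∂(transition X Pr s t x)‖ ≤ C := by
  have := hX.isProbabilityMeasure_transition s t x
  simpa using norm_integral_le_of_norm_le_const (μ := transition X Pr s t x) (ae_of_all _ hC)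

variable {f : OnePoint S → ℝ} (hf : Measurable f) {C : ℝ} (hC : ∀ y, |f y| ≤ C)
include hf hC

theorem condExp_eq_transitionMartingale (r : ℝ≥0) (x : OnePoint S) {q T : ℝ≥0} (h : q ≤ T) :
    (Pr r x)[fun ω => f (X T ω) | F q] =ᵐ[Pr r x] transitionMartingale X Pr f r T q := by
  have := hX.markov f hf ⟨C, hC⟩ r x q (T - q)
  rw [add_tsub_cancel_of_le h, add_assoc, add_tsub_cancel_of_le h] at this
  exact this

omit hC in
theorem measurable_transitionMartingale (r T q : ℝ≥0) :
    Measurable[F q] (transitionMartingale X Pr f r T q) :=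
  (hX.measurable_integral_transition hf _ _).comp (hX.adapted q)

omit hf in
theorem abs_transitionMartingale_le (r T q : ℝ≥0) (ω : Ω) :
    |transitionMartingale X Pr f r T q ω| ≤ C :=
  hX.norm_integral_transition_le (f := f) (fun y => hC y) _ _ _

theorem integrable_transitionMartingale (r T q : ℝ≥0) (x : OnePoint S) :
    Integrable (transitionMartingale X Pr f r T q) (Pr r x) :=
  have := hX.isProbabilityMeasure r x
  .of_bound ((hX.measurable_transitionMartingale hf r T q).mono (F.le q) le_rfl).aestronglyMeasurable
    C (ae_of_all _ fun ω => hX.abs_transitionMartingale_le hC r T q ω)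

theorem condExp_transitionMartingale (r : ℝ≥0) (x : OnePoint S) {p q T : ℝ≥0} (hpq : p ≤ q)
    (h : q ≤ T) : (Pr r x)[transitionMartingale X Pr f r T q | F p] =ᵐ[Pr r x]
      transitionMartingale X Pr f r T p := by
  have := hX.isProbabilityMeasure r x
  have h1 := condExp_congr_ae (m := F p) (hX.condExp_eq_transitionMartingale hf hC r x h)
  have h2 := condExp_condExp_of_le (μ := Pr r x) (f := fun ω => f (X T ω)) (F.mono hpq) (F.le q)
  exact h1.symm.trans (h2.trans (hX.condExp_eq_transitionMartingale hf hC r x (hpq.trans h)))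

theorem setIntegral_transitionMartingale (r : ℝ≥0) (x : OnePoint S) {q T : ℝ≥0} (h : q ≤ T)
    {A : Set Ω} (hA : MeasurableSet[F q] A) :
    ∫ ω in A, transitionMartingale X Pr f r T q ω ∂(Pr r x) = ∫ ω in A, f (X T ω) ∂(Pr r x) := by
  have := hX.isProbabilityMeasure r x
  rw [← setIntegral_condExp (F.le q) (f := fun ω => f (X T ω)) _ hA]
  · exact integral_congr_ae (ae_restrict_of_ae
      (hX.condExp_eq_transitionMartingale hf hC r x h).symm)
  · exact .of_bound (hf.comp (hX.measurable T)).aestronglyMeasurable C (ae_of_all _ fun _ => hC _)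

/-- The transition martingale along a deterministic sequence of times, stopped at time `T`. -/
theorem martingale_transitionMartingale (r T : ℝ≥0) (x : OnePoint S) {u : ℕ → ℝ≥0}
    (hu : Monotone u) :
    Martingale (fun i => transitionMartingale X Pr f r T (min (u i) T))
      (⟨fun i => F (min (u i) T), fun _ _ hij => F.mono (min_le_min_right T (hu hij)),
        fun _ => F.le _⟩ : Filtration ℕ mΩ) (Pr r x) :=
  ⟨fun _ => (hX.measurable_transitionMartingale hf r T _).stronglyMeasurable, fun _ _ hij =>
    hX.condExp_transitionMartingale hf hC r x (min_le_min_right T (hu hij)) (min_le_right _ _)⟩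

end IsMarkovProcess

end MarkovBasics

/-! ### Upcrossings along the rationals and along nested grids -/

section Upcrossings

/-- Before time `e`, the function `m` has `n` upcrossings of `[a, b]` along `D`. -/
def HasUpcrossings (m : ℝ≥0 → ℝ) (a b : ℝ) (D : Set ℝ≥0) : ℕ → ℝ≥0 → Prop
  | 0, _ => True
  | n + 1, e => ∃ p ∈ D, ∃ q ∈ D, p < q ∧ q < e ∧ m p < a ∧ b < m q ∧ HasUpcrossings m a b D n p

variable {m : ℝ≥0 → ℝ} {a b : ℝ} {D D' : Set ℝ≥0}

theorem HasUpcrossings.mono_time {n : ℕ} {e e' : ℝ≥0} (h : HasUpcrossings m a b D n e)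
    (he : e ≤ e') : HasUpcrossings m a b D n e' := by
  cases n with
  | zero => trivial
  | succ n =>
    obtain ⟨p, hp, q, hq, hpq, hqe, h⟩ := h
    exact ⟨p, hp, q, hq, hpq, hqe.trans_le he, h⟩

theorem HasUpcrossings.mono_set (hD : D ⊆ D') {n : ℕ} {e : ℝ≥0}
    (h : HasUpcrossings m a b D n e) : HasUpcrossings m a b D' n e := by
  induction n generalizing e with
  | zero => trivial
  | succ n ih =>
    obtain ⟨p, hp, q, hq, hpq, hqe, h1, h2, h⟩ := h
    exact ⟨p, hD hp, q, hD hq, hpq, hqe, h1, h2, ih h⟩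

/-- A function with boundedly many upcrossings of each rational interval has one-sided limits. -/
theorem exists_limits_of_upcrossings {C : ℝ} (hm : ∀ q, |m q| ≤ C) {T : ℝ≥0}
    (h : ∀ a b : ℚ, a < b → ∃ n, ¬ HasUpcrossings m a b (ratTimes ∩ Iio T) n T)
    {t : ℝ≥0} (ht : t < T) :
    (∃ l, Tendsto m (𝓝[ratTimes ∩ Ioi t] t) (𝓝 l)) ∧
    (∃ l, Tendsto m (𝓝[ratTimes ∩ Iio t] t) (𝓝 l)) := by
  have hb : ∀ l : Filter ℝ≥0, l.IsBoundedUnder (· ≤ ·) m ∧ l.IsBoundedUnder (· ≥ ·) m := fun l =>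
    ⟨isBoundedUnder_of ⟨C, fun q => (abs_le.1 (hm q)).2⟩,
      isBoundedUnder_of ⟨-C, fun q => (abs_le.1 (hm q)).1⟩⟩
  have hdense : Dense (range ((↑) : ℚ → ℝ)) := Rat.denseRange_cast
  constructor
  · refine tendsto_of_no_upcrossings hdense ?_ (hb _).1 (hb _).2
    rintro _ ⟨a, rfl⟩ _ ⟨b, rfl⟩ hab ⟨ha, hb⟩
    obtain ⟨n, hn⟩ := h a b (by exact_mod_cast hab)
    have step : ∀ (p : ℝ≥0 → Prop), (∃ᶠ q in 𝓝[ratTimes ∩ Ioi t] t, p q) → ∀ e, t < e →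
        ∃ q ∈ ratTimes, t < q ∧ q < e ∧ p q := by
      intro p hp e he
      by_contra hcon
      push Not at hcon
      exact hp (eventually_ratTimes_right.2 ⟨e, he, hcon⟩)
    have key : ∀ n e, t < e → e ≤ T → HasUpcrossings m a b (ratTimes ∩ Iio T) n e := by
      intro n
      induction n with
      | zero => intros; trivial
      | succ n ih =>
        intro e he heT
        obtain ⟨q, hq, htq, hqe, hq'⟩ := step _ hb e he
        obtain ⟨p, hp, htp, hpq, hp'⟩ := step _ ha q htq
        exact ⟨p, ⟨hp, (hpq.trans hqe).trans_le heT⟩, q, ⟨hq, hqe.trans_le heT⟩, hpq, hqe, hp', hq',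
          ih p htp ((hpq.trans hqe).le.trans heT)⟩
    exact hn (key n T ht le_rfl)
  · rcases eq_zero_or_pos t with rfl | ht0
    · simp
    refine tendsto_of_no_upcrossings hdense ?_ (hb _).1 (hb _).2
    rintro _ ⟨a, rfl⟩ _ ⟨b, rfl⟩ hab ⟨ha, hb⟩
    obtain ⟨n, hn⟩ := h a b (by exact_mod_cast hab)
    have step : ∀ (p : ℝ≥0 → Prop), (∃ᶠ q in 𝓝[ratTimes ∩ Iio t] t, p q) → ∀ e, e < t →
        ∃ q ∈ ratTimes, e < q ∧ q < t ∧ p q := by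
      intro p hp e he
      by_contra hcon
      push Not at hcon
      exact hp ((eventually_ratTimes_left ht0).2 ⟨e, he, hcon⟩)
    have key : ∀ n, ∃ e < t, HasUpcrossings m a b (ratTimes ∩ Iio T) n e := by
      intro n
      induction n with
      | zero => exact ⟨0, ht0, trivial⟩
      | succ n ih =>
        obtain ⟨e, he, hne⟩ := ih
        obtain ⟨p, hp, hep, hpt, hp'⟩ := step _ ha e he
        obtain ⟨q, hq, hpq, hqt, hq'⟩ := step _ hb p hpt
        obtain ⟨e', he', he't⟩ := exists_between hqt
        exact ⟨e', he't, p, ⟨hp, hpt.trans ht⟩, q, ⟨hq, hqt.trans ht⟩, hpq, he', hp', hq',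
          hne.mono_time hep.le⟩
    obtain ⟨e, he, hne⟩ := key n
    exact hn (hne.mono_time (he.trans ht).le)

/-- The times `i / k!`, `i ∈ ℕ`. -/
def gridTimes (k : ℕ) : Set ℝ≥0 := range fun i : ℕ => (i : ℝ≥0) / (k.factorial : ℝ≥0)

/-- Factorial denominators make the grids nested, so that a bound which is uniform over the grids
passes to all rational times by monotone union. -/
theorem gridTimes_mono : Monotone gridTimes := by
  rintro k l hkl _ ⟨i, rfl⟩
  obtain ⟨c, hc⟩ := Nat.factorial_dvd_factorial hkl
  refine ⟨i * c, ?_⟩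
  have h1 : (k.factorial : ℝ≥0) ≠ 0 := by exact_mod_cast k.factorial_ne_zero
  have h2 : (c : ℝ≥0) ≠ 0 := by
    rintro h
    have : c = 0 := by exact_mod_cast h
    exact l.factorial_ne_zero (by rw [hc, this, mul_zero])
  simp only [hc, Nat.cast_mul]
  field_simp

theorem exists_mem_gridTimes {q : ℝ≥0} (hq : q ∈ ratTimes) : ∃ k, q ∈ gridTimes k := by
  obtain ⟨q, rfl⟩ := hq
  refine ⟨q.den, q.num * (q.den - 1).factorial, ?_⟩
  have h1 : (q.den : ℝ≥0) ≠ 0 := by exact_mod_cast q.den_ne_zero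
  have h2 : ((q.den - 1).factorial : ℝ≥0) ≠ 0 := by exact_mod_cast Nat.factorial_ne_zero _
  rw [← Nat.mul_factorial_pred q.den_ne_zero, NNRat.cast_def]
  push_cast
  field_simp

theorem HasUpcrossings.exists_grid {T e : ℝ≥0} {n : ℕ}
    (h : HasUpcrossings m a b (ratTimes ∩ Iio T) n e) :
    ∃ k, HasUpcrossings m a b (gridTimes k ∩ Iio T) n e := by
  induction n generalizing e with
  | zero => exact ⟨0, trivial⟩
  | succ n ih =>
    obtain ⟨p, hp, q, hq, hpq, hqe, h1, h2, h⟩ := h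
    obtain ⟨k₁, hk₁⟩ := ih h
    obtain ⟨k₂, hk₂⟩ := exists_mem_gridTimes hp.1
    obtain ⟨k₃, hk₃⟩ := exists_mem_gridTimes hq.1
    let k := max k₁ (max k₂ k₃)
    have h1k : k₁ ≤ k := le_max_left _ _
    have h2k : k₂ ≤ k := (le_max_left _ _).trans (le_max_right _ _)
    have h3k : k₃ ≤ k := (le_max_right _ _).trans (le_max_right _ _)
    exact ⟨k, p, ⟨gridTimes_mono h2k hk₂, hp.2⟩, q, ⟨gridTimes_mono h3k hk₃, hq.2⟩, hpq, hqe, h1, h2,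
      hk₁.mono_set (inter_subset_inter_left _ (gridTimes_mono h1k))⟩

theorem HasUpcrossings.le_upcrossingsBefore {Ω : Type*} {M : ℝ≥0 → Ω → ℝ} {ω : Ω} (hab : a < b)
    {k : ℕ} {T : ℝ≥0} {n i : ℕ}
    (h : HasUpcrossings (fun q => M q ω) a b (gridTimes k ∩ Iio T) n (i / (k.factorial : ℝ≥0))) :
    n ≤ upcrossingsBefore a b (fun (j : ℕ) ω => M (min ((j : ℝ≥0) / (k.factorial : ℝ≥0)) T) ω) i ω
    := by
  have hk : (0 : ℝ≥0) < k.factorial := by exact_mod_cast k.factorial_pos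
  induction n generalizing i with
  | zero => exact Nat.zero_le _
  | succ n ih =>
    obtain ⟨_, ⟨⟨j, rfl⟩, hpT⟩, _, ⟨⟨l, rfl⟩, hqT⟩, hpq, hqe, h1, h2, h⟩ := h
    have hjl : j < l := by exact_mod_cast (div_lt_div_iff_of_pos_right hk).1 hpq
    have hli : l < i := by exact_mod_cast (div_lt_div_iff_of_pos_right hk).1 hqe
    refine Nat.succ_le_of_lt ((ih h).trans_lt (lt_of_lt_of_le
      (upcrossingsBefore_lt_of_exists_upcrossing (N₁ := j) (N₂ := l) hab le_rfl ?_ hjl.le ?_)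
      (upcrossingsBefore_mono hab hli ω)))
    · rw [min_eq_left (le_of_lt (mem_Iio.1 hpT))]; exact h1
    · rw [min_eq_left (le_of_lt (mem_Iio.1 hqT))]; exact h2

end Upcrossings

/-! ### One-sided limits of the transition martingales -/

section Regularization

variable {S Ω : Type*} [TopologicalSpace S] {mΩ : MeasurableSpace Ω} {F : Filtration ℝ≥0 mΩ}
  {X : ℝ≥0 → Ω → OnePoint S} {Pr : ℝ≥0 → OnePoint S → Measure Ω}
  (hX : IsMarkovProcess F X Pr) {f : OnePoint S → ℝ} (hf : Measurable f) {C : ℝ}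
  (hC : ∀ y, |f y| ≤ C)
include hX hf hC

/-- Doob's upcrossing inequality for the discrete martingale on the grid, combined with Markov's
inequality. The bound depends neither on the grid nor on n. -/
theorem IsMarkovProcess.measure_hasUpcrossings_grid_le (r : ℝ≥0) (x : OnePoint S) (T : ℝ≥0)
    {a b : ℝ} (hab : a < b) (k n : ℕ) :
    ENNReal.ofReal n * Pr r x {ω | HasUpcrossings (fun q => transitionMartingale X Pr f r T q ω)
      a b (gridTimes k ∩ Iio T) n T} ≤ ENNReal.ofReal ((C + |a|) / (b - a)) := by
  have := hX.isProbabilityMeasure r x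
  have hk : (0 : ℝ≥0) < k.factorial := by exact_mod_cast k.factorial_pos
  have hu : Monotone fun i : ℕ => (i : ℝ≥0) / (k.factorial : ℝ≥0) := fun i j hij => by
    have : (i : ℝ≥0) ≤ j := by exact_mod_cast hij
    dsimp only
    gcongr
  have hM := hX.martingale_transitionMartingale hf hC r T x hu
  obtain ⟨N, hN⟩ := exists_nat_ge (T * k.factorial)
  set U := upcrossingsBefore a b
    (fun i : ℕ => transitionMartingale X Pr f r T (min ((i : ℝ≥0) / (k.factorial : ℝ≥0)) T)) N with hU
  have hint := hM.submartingale.1.integrable_upcrossingsBefore (μ := Pr r x) (N := N) hab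
  have h1 := hM.submartingale.mul_integral_upcrossingsBefore_le_integral_pos_part a b N
  have h2 : (Pr r x)[fun ω => (transitionMartingale X Pr f r T
      (min ((N : ℝ≥0) / (k.factorial : ℝ≥0)) T) ω - a)⁺] ≤ C + |a| := by
    have h3 : ∀ ω, ‖(transitionMartingale X Pr f r T
      (min ((N : ℝ≥0) / (k.factorial : ℝ≥0)) T) ω - a)⁺‖ ≤ C + |a| := by
      intro ω
      have h4 := hX.abs_transitionMartingale_le hC r T (min ((N : ℝ≥0) / (k.factorial : ℝ≥0)) T) ω
      rw [Real.norm_of_nonneg (posPart_nonneg _)]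
      exact (max_le (le_abs_self _) (abs_nonneg _)).trans ((abs_sub _ _).trans (by gcongr))
    exact (le_abs_self _).trans ((norm_integral_le_of_norm_le_const (ae_of_all _ h3)).trans_eq
      (by simp))
  have h5 : ∫ ω, (U ω : ℝ) ∂(Pr r x) ≤ (C + |a|) / (b - a) := by
    rw [le_div_iff₀ (sub_pos.2 hab), mul_comm]
    exact h1.trans h2
  calc ENNReal.ofReal n * Pr r x {ω | HasUpcrossings _ a b (gridTimes k ∩ Iio T) n T}
      ≤ ENNReal.ofReal n * Pr r x {ω | ENNReal.ofReal n ≤ ENNReal.ofReal (U ω)} := by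
        gcongr with ω
        intro hω
        refine ENNReal.ofReal_le_ofReal (Nat.cast_le.2 ?_)
        refine (hω.mono_time ?_).le_upcrossingsBefore hab
        rwa [le_div_iff₀ hk]
    _ ≤ ∫⁻ ω, ENNReal.ofReal (U ω) ∂(Pr r x) :=
        mul_meas_ge_le_lintegral₀ hint.aestronglyMeasurable.aemeasurable.ennreal_ofReal _
    _ = ENNReal.ofReal (∫ ω, (U ω : ℝ) ∂(Pr r x)) :=
        (ofReal_integral_eq_lintegral_ofReal hint (ae_of_all _ fun _ => Nat.cast_nonneg _)).symm
    _ ≤ _ := ENNReal.ofReal_le_ofReal h5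

theorem IsMarkovProcess.measure_hasUpcrossings_le (r : ℝ≥0) (x : OnePoint S) (T : ℝ≥0)
    {a b : ℝ} (hab : a < b) (n : ℕ) :
    ENNReal.ofReal n * Pr r x {ω | HasUpcrossings (fun q => transitionMartingale X Pr f r T q ω)
      a b (ratTimes ∩ Iio T) n T} ≤ ENNReal.ofReal ((C + |a|) / (b - a)) := by
  have h : {ω | HasUpcrossings (fun q => transitionMartingale X Pr f r T q ω)
      a b (ratTimes ∩ Iio T) n T} ⊆ ⋃ k, {ω | HasUpcrossings
        (fun q => transitionMartingale X Pr f r T q ω) a b (gridTimes k ∩ Iio T) n T} :=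
    fun ω hω => mem_iUnion.2 hω.exists_grid
  have hmono : Monotone fun k => {ω | HasUpcrossings
        (fun q => transitionMartingale X Pr f r T q ω) a b (gridTimes k ∩ Iio T) n T} :=
    fun k l hkl ω hω => hω.mono_set (inter_subset_inter_left _ (gridTimes_mono hkl))
  refine (mul_le_mul_right (measure_mono h) _).trans ?_
  -- Continuity from below holds for arbitrary increasing sets, so these events need not be shown
  -- measurable.
  rw [hmono.measure_iUnion, ENNReal.mul_iSup]
  exact iSup_le fun k => hX.measure_hasUpcrossings_grid_le hf hC r x T hab k n

/-- Almost surely, the transition martingale has one-sided limits through the rationals. -/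
theorem IsMarkovProcess.ae_exists_limits (r : ℝ≥0) (x : OnePoint S) (T : ℝ≥0) :
    ∀ᵐ ω ∂(Pr r x), ∀ t < T,
      (∃ l, Tendsto (fun q => transitionMartingale X Pr f r T q ω) (𝓝[ratTimes ∩ Ioi t] t) (𝓝 l)) ∧
      (∃ l, Tendsto (fun q => transitionMartingale X Pr f r T q ω) (𝓝[ratTimes ∩ Iio t] t) (𝓝 l))
      := by
  have key : ∀ a b : ℚ, a < b → ∀ᵐ ω ∂(Pr r x), ∃ n, ¬ HasUpcrossings
      (fun q => transitionMartingale X Pr f r T q ω) a b (ratTimes ∩ Iio T) n T := by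
    intro a b hab
    rw [ae_iff]
    push Not
    by_contra h0
    have hfin : ∀ n : ℕ, ENNReal.ofReal n * Pr r x {ω | ∀ n, HasUpcrossings
        (fun q => transitionMartingale X Pr f r T q ω) a b (ratTimes ∩ Iio T) n T} ≤
        ENNReal.ofReal ((C + |(a : ℝ)|) / (b - a)) := fun n =>
      le_trans (by gcongr; exact fun h => h _)
        (hX.measure_hasUpcrossings_le hf hC r x T (by exact_mod_cast hab) n)
    obtain ⟨n, hn⟩ := ENNReal.exists_nat_mul_gt h0
      (ENNReal.ofReal_ne_top (r := (C + |(a : ℝ)|) / (b - a)))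
    refine absurd (hfin n) (not_le.2 ?_)
    simpa using hn
  have key' : ∀ᵐ ω ∂(Pr r x), ∀ a b : ℚ, a < b → ∃ n, ¬ HasUpcrossings
      (fun q => transitionMartingale X Pr f r T q ω) a b (ratTimes ∩ Iio T) n T := by
    simp only [ae_all_iff]
    exact key
  filter_upwards [key'] with ω hω t ht
  exact exists_limits_of_upcrossings (fun q => hX.abs_transitionMartingale_le hC r T q ω) hω ht

end Regularization

/-! ### Regularity of the paths and the modification property -/

section Regularity

variable {S Ω : Type*} [TopologicalSpace S] {mΩ : MeasurableSpace Ω} {F : Filtration ℝ≥0 mΩ}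
  {X : ℝ≥0 → Ω → OnePoint S} {Pr : ℝ≥0 → OnePoint S → Measure Ω}

/-- `P_{s,t} f(y) → f(x)` as `(s, t, y) → (t₀, t₀, x)` with `s ≤ t`, for all continuous `f`. -/
def IsContinuousOnDiagonal (X : ℝ≥0 → Ω → OnePoint S) (Pr : ℝ≥0 → OnePoint S → Measure Ω) : Prop :=
  ∀ (f : C(OnePoint S, ℝ)) (t : ℝ≥0) (x : OnePoint S),
    Tendsto (fun p : ℝ≥0 × ℝ≥0 × OnePoint S => ∫ y, f y ∂(transition X Pr p.1 p.2.1 p.2.2))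
      (𝓝[{p | p.1 ≤ p.2.1}] (t, t, x)) (𝓝 (f x))

/-- `P_{s,T}(y, K n) → 0` as `(s, y) → (t, Δ)`, for all `T` in a right neighbourhood of `t`. -/
def VanishesAtCemetery (X : ℝ≥0 → Ω → OnePoint S) (Pr : ℝ≥0 → OnePoint S → Measure Ω)
    (K : ℕ → Set (OnePoint S)) : Prop :=
  ∀ t : ℝ≥0, ∀ᶠ T in 𝓝[>] t, ∀ n, Tendsto (fun p : ℝ≥0 × OnePoint S =>
    ∫ y, (K n).indicator (fun _ => (1 : ℝ)) y ∂(transition X Pr p.1 T p.2))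
      (𝓝 (t, OnePoint.infty)) (𝓝 0)

/-- A compact Hausdorff second countable space is metrizable, and the distances to a dense sequence
separate its points. -/
theorem exists_separating_sequence (Y : Type*) [TopologicalSpace Y] [T2Space Y] [CompactSpace Y]
    [SecondCountableTopology Y] [Nonempty Y] :
    ∃ g : ℕ → C(Y, ℝ), ∀ x y, (∀ n, g n x = g n y) → x = y := by
  let _ := TopologicalSpace.metrizableSpaceMetric Y
  refine ⟨fun n => ⟨fun y => dist y (TopologicalSpace.denseSeq Y n), by fun_prop⟩,
    fun x y h => ?_⟩
  have hd : ∀ z, dist x z = dist y z := by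
    have h1 : Continuous fun z => dist x z := by fun_prop
    have h2 : Continuous fun z => dist y z := by fun_prop
    exact fun z => congrFun
      ((TopologicalSpace.denseRange_denseSeq Y).equalizer h1 h2 (funext fun n => h n)) z
  have := hd y
  rwa [dist_self, dist_eq_zero] at this

theorem exists_bound_continuousMap {Y : Type*} [TopologicalSpace Y] [CompactSpace Y]
    (f : C(Y, ℝ)) : ∃ C : ℝ, ∀ y, |f y| ≤ C := ⟨‖f‖, fun y => f.norm_coe_le_norm y⟩

theorem IsContinuousOnDiagonal.exists_forall_abs_lt (hD : IsContinuousOnDiagonal X Pr)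
    (f : C(OnePoint S, ℝ)) (r t : ℝ≥0) (x : OnePoint S) {ε : ℝ} (hε : 0 < ε) :
    ∃ b, t < b ∧ ∃ V ∈ 𝓝 t, ∃ U ∈ 𝓝 x, ∀ q ∈ V, ∀ T, q ≤ T → t ≤ T → T < b → ∀ z ∈ U,
      |∫ y, f y ∂(transition X Pr (r + q) (r + T) z) - f x| < ε := by
  have h1 : Tendsto (fun p : ℝ≥0 × ℝ≥0 × OnePoint S => (r + p.1, r + p.2.1, p.2.2))
      (𝓝[{p | p.1 ≤ p.2.1}] (t, t, x)) (𝓝[{p | p.1 ≤ p.2.1}] (r + t, r + t, x)) := by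
    refine tendsto_nhdsWithin_iff.2 ⟨?_, ?_⟩
    · refine Tendsto.mono_left ?_ nhdsWithin_le_nhds
      exact (by fun_prop : Continuous fun p : ℝ≥0 × ℝ≥0 × OnePoint S =>
        (r + p.1, r + p.2.1, p.2.2)).tendsto (t, t, x)
    · filter_upwards [self_mem_nhdsWithin] with p hp
      exact add_le_add_right hp r
  have h2 := (Metric.tendsto_nhds.1 ((hD f (r + t) x).comp h1) ε hε)
  rw [eventually_nhdsWithin_iff, nhds_prod_eq, nhds_prod_eq] at h2
  obtain ⟨V, hV, W, hW, h3⟩ := mem_prod_iff.1 h2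
  obtain ⟨V', hV', U, hU, h4⟩ := mem_prod_iff.1 hW
  obtain ⟨b, hb, hbV⟩ := exists_Ico_subset_of_mem_nhds hV' (exists_gt t)
  exact ⟨b, hb, V, hV, U, hU, fun q hq T hqT htT hTb z hz =>
    h3 (show (q, T, z) ∈ V ×ˢ W from ⟨hq, h4 ⟨hbV ⟨htT, hTb⟩, hz⟩⟩) hqT⟩

variable (hX : IsMarkovProcess F X Pr) (hD : IsContinuousOnDiagonal X Pr)
  [T2Space (OnePoint S)]

omit [T2Space (OnePoint S)] in
/-- A path whose transition martingales converge has a limit in the compact space `S_Δ`. -/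
theorem IsContinuousOnDiagonal.exists_limit (hD : IsContinuousOnDiagonal X Pr)
    {g : ℕ → C(OnePoint S, ℝ)}
    (hg : ∀ x y, (∀ n, g n x = g n y) → x = y) (r : ℝ≥0) {t : ℝ≥0} {ω : Ω} {l : Filter ℝ≥0}
    (hl : l ≤ 𝓝 t)
    (h : ∀ n, ∀ T ∈ ratTimes, t < T →
      ∃ c, Tendsto (fun q => transitionMartingale X Pr (g n) r T q ω) l (𝓝 c)) :
    ∃ z, Tendsto (fun q => X q ω) l (𝓝 z) := by
  rcases l.eq_or_neBot with rfl | hne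
  · exact ⟨OnePoint.infty, tendsto_bot⟩
  obtain ⟨x, hx⟩ := exists_clusterPt_of_compactSpace (map (fun q => X q ω) l)
  -- By continuity on the diagonal, the limit of the martingale with horizon `T` close to `t` lies
  -- within ε of `g n` at every cluster point. Two cluster points therefore share all values of `g
  -- n` and coincide.
  have key : ∀ x, MapClusterPt x l (fun q => X q ω) → ∀ n, ∀ ε > 0, ∃ b > t, ∀ T, t < T → T < b →
      ∀ c, Tendsto (fun q => transitionMartingale X Pr (g n) r T q ω) l (𝓝 c) →
      |c - g n x| ≤ ε := by
    intro x hx n ε hε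
    obtain ⟨b, hb, V, hV, U, hU, h1⟩ := hD.exists_forall_abs_lt (g n) r t x hε
    refine ⟨b, hb, fun T hT hTb c hc => ?_⟩
    have h2 : ∃ᶠ q in l, |transitionMartingale X Pr (g n) r T q ω - g n x| ≤ ε := by
      refine ((hx.frequently hU).and_eventually (inter_mem (hl hV) (hl (Iio_mem_nhds hT)))).mono ?_
      rintro q ⟨hq1, hq2, hq3⟩
      exact (h1 q hq2 T (le_of_lt hq3) hT.le hTb _ hq1).le
    exact isClosed_Iic.mem_of_frequently_of_tendsto h2 ((hc.sub_const _).abs)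
  refine ⟨x, tendsto_nhds_of_unique_mapClusterPt fun y hy => hg y x fun n => ?_⟩
  refine eq_of_forall_dist_le fun ε hε => ?_
  obtain ⟨b₁, hb₁, h1⟩ := key x hx n (ε / 2) (half_pos hε)
  obtain ⟨b₂, hb₂, h2⟩ := key y hy n (ε / 2) (half_pos hε)
  obtain ⟨T, hT, htT, hTb⟩ := exists_ratTimes_between (lt_min hb₁ hb₂)
  obtain ⟨c, hc⟩ := h n T hT htT
  have h3 := h1 T htT (hTb.trans_le (min_le_left _ _)) c hc
  have h4 := h2 T htT (hTb.trans_le (min_le_right _ _)) c hc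
  rw [Real.dist_eq]
  rw [abs_le] at *
  constructor <;> linarith [h3.1, h3.2, h4.1, h4.2]

include hX hD

theorem IsMarkovProcess.ae_mem_regularSet [SecondCountableTopology (OnePoint S)] (r : ℝ≥0)
    (x : OnePoint S) : ∀ᵐ ω ∂(Pr r x), ω ∈ regularSet X := by
  obtain ⟨g, hg⟩ := exists_separating_sequence (OnePoint S)
  have h : ∀ᵐ ω ∂(Pr r x), ∀ n, ∀ T ∈ ratTimes, ∀ t < T,
      (∃ l, Tendsto (fun q => transitionMartingale X Pr (g n) r T q ω)
        (𝓝[ratTimes ∩ Ioi t] t) (𝓝 l)) ∧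
      (∃ l, Tendsto (fun q => transitionMartingale X Pr (g n) r T q ω)
        (𝓝[ratTimes ∩ Iio t] t) (𝓝 l)) := by
    refine ae_all_iff.2 fun n => (ae_ball_iff countable_ratTimes).2 fun T _ => ?_
    obtain ⟨C, hC⟩ := exists_bound_continuousMap (g n)
    exact hX.ae_exists_limits (g n).continuous.measurable hC r x T
  filter_upwards [h] with ω hω t
  exact ⟨hD.exists_limit hg r nhdsWithin_le_nhds fun n T hT htT => (hω n T hT t htT).1,
    hD.exists_limit hg r nhdsWithin_le_nhds fun n T hT htT => (hω n T hT t htT).2⟩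

omit hD [T2Space (OnePoint S)] in
theorem IsMarkovProcess.integral_mul_transitionMartingale {f : OnePoint S → ℝ}
    (hf : Measurable f) {C : ℝ} (hC : ∀ y, |f y| ≤ C) (r : ℝ≥0) (x : OnePoint S) {q T : ℝ≥0}
    (h : q ≤ T) {φ : Ω → ℝ} (hφ : Measurable[F q] φ) {C' : ℝ} (hC' : ∀ ω, |φ ω| ≤ C') :
    ∫ ω, φ ω * transitionMartingale X Pr f r T q ω ∂(Pr r x) =
      ∫ ω, φ ω * f (X T ω) ∂(Pr r x) := by
  have := hX.isProbabilityMeasure r x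
  have hi : Integrable (fun ω => f (X T ω)) (Pr r x) :=
    .of_bound (hf.comp (hX.measurable T)).aestronglyMeasurable C (ae_of_all _ fun _ => hC _)
  have hi' : Integrable (φ * fun ω => f (X T ω)) (Pr r x) :=
    hi.bdd_mul ((hφ.mono (F.le q) le_rfl).aestronglyMeasurable) (ae_of_all _ hC')
  rw [← integral_condExp (F.le q) (f := fun ω => φ ω * f (X T ω))]
  refine integral_congr_ae ?_
  filter_upwards [condExp_mul_of_stronglyMeasurable_left (m := F q) hφ.stronglyMeasurable hi' hi,
    hX.condExp_eq_transitionMartingale hf hC r x h] with ω h1 h2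
  rw [← h2]
  exact h1.symm

omit [T2Space (OnePoint S)] in
-- The Markov property gives E[φ h(X_{q_n})] = E[φ P_{r+t,r+q_n}h(X_t)]. As q_n → t, the left side
-- converges along the paths, the right side by continuity on the diagonal.
theorem IsMarkovProcess.integral_mul_eq_of_tendsto (r : ℝ≥0) (x : OnePoint S) (t : ℝ≥0)
    {q : ℕ → ℝ≥0} (hq : ∀ n, t ≤ q n) (hqt : Tendsto q atTop (𝓝 t)) {Y : Ω → OnePoint S}
    (hY : ∀ᵐ ω ∂(Pr r x), Tendsto (fun n => X (q n) ω) atTop (𝓝 (Y ω)))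
    (h : C(OnePoint S, ℝ)) (φ : Ω → ℝ) (hφ : Measurable[F t] φ) (hφb : ∃ C', ∀ ω, |φ ω| ≤ C') :
    ∫ ω, φ ω * h (Y ω) ∂(Pr r x) = ∫ ω, φ ω * h (X t ω) ∂(Pr r x) := by
  have := hX.isProbabilityMeasure r x
  obtain ⟨C', hC'⟩ := hφb
  obtain ⟨C, hC⟩ := exists_bound_continuousMap h
  have hφ' : Measurable φ := hφ.mono (F.le t) le_rfl
  have hb : ∀ (g : Ω → ℝ), (∀ ω, |g ω| ≤ C) → ∀ᵐ ω ∂(Pr r x), ‖φ ω * g ω‖ ≤ C' * C := by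
    intro g hg
    refine ae_of_all _ fun ω => ?_
    rw [norm_mul]
    exact mul_le_mul (hC' ω) (hg ω) (abs_nonneg _) ((abs_nonneg _).trans (hC' ω))
  have h1 : Tendsto (fun n => ∫ ω, φ ω * h (X (q n) ω) ∂(Pr r x)) atTop
      (𝓝 (∫ ω, φ ω * h (Y ω) ∂(Pr r x))) := by
    refine tendsto_integral_of_dominated_convergence (fun _ => C' * C) (fun n =>
      (hφ'.mul (h.continuous.measurable.comp (hX.measurable (q n)))).aestronglyMeasurable)
      (integrable_const _) (fun n => hb _ fun ω => hC _) ?_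
    filter_upwards [hY] with ω hω
    exact ((h.continuous.tendsto _).comp hω).const_mul _
  have hm : ∀ n, Measurable (transitionMartingale X Pr h r (q n) t) := fun n =>
    (hX.measurable_transitionMartingale h.continuous.measurable r (q n) t).mono (F.le t) le_rfl
  have hlim : ∀ ω, Tendsto (fun n => transitionMartingale X Pr h r (q n) t ω) atTop
      (𝓝 (h (X t ω))) := by
    intro ω
    have hp : Tendsto (fun n => (r + t, r + q n, X t ω)) atTop
        (𝓝[{p | p.1 ≤ p.2.1}] (r + t, r + t, X t ω)) := by
      refine tendsto_nhdsWithin_iff.2 ⟨?_, Eventually.of_forall fun n => add_le_add_right (hq n) r⟩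
      exact tendsto_const_nhds.prodMk_nhds
        ((tendsto_const_nhds.add hqt).prodMk_nhds tendsto_const_nhds)
    exact (hD h (r + t) (X t ω)).comp hp
  have h2 : Tendsto (fun n => ∫ ω, φ ω * transitionMartingale X Pr h r (q n) t ω ∂(Pr r x)) atTop
      (𝓝 (∫ ω, φ ω * h (X t ω) ∂(Pr r x))) :=
    tendsto_integral_of_dominated_convergence (fun _ => C' * C) (fun n =>
      (hφ'.mul (hm n)).aestronglyMeasurable)
      (integrable_const _) (fun n => hb _ fun ω => hX.abs_transitionMartingale_le hC r (q n) t ω)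
      (ae_of_all _ fun ω => (hlim ω).const_mul _)
  refine tendsto_nhds_unique h1 (h2.congr fun n => ?_)
  exact hX.integral_mul_transitionMartingale h.continuous.measurable hC r x (hq n) hφ hC'

omit [T2Space (OnePoint S)] in
-- Expand E[(f(Y) - f(X_t))²] and apply `integral_mul_eq_of_tendsto` to the pairs (φ,h) = (f(X_t),
-- f) and (1, f²): all terms become E[f(X_t)²] and cancel.
theorem IsMarkovProcess.ae_eq_of_tendsto (r : ℝ≥0) (x : OnePoint S) (t : ℝ≥0) {q : ℕ → ℝ≥0}
    (hq : ∀ n, t ≤ q n) (hqt : Tendsto q atTop (𝓝 t)) {Y : Ω → OnePoint S}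
    (hY : ∀ᵐ ω ∂(Pr r x), Tendsto (fun n => X (q n) ω) atTop (𝓝 (Y ω)))
    (f : C(OnePoint S, ℝ)) : ∀ᵐ ω ∂(Pr r x), f (Y ω) = f (X t ω) := by
  have := hX.isProbabilityMeasure r x
  have key := hX.integral_mul_eq_of_tendsto hD r x t hq hqt hY
  obtain ⟨C, hC⟩ := exists_bound_continuousMap f
  have hfX : Measurable[F t] fun ω => f (X t ω) := f.continuous.measurable.comp (hX.adapted t)
  have hfXm : AEStronglyMeasurable (fun ω => f (X t ω)) (Pr r x) :=
    (hfX.mono (F.le t) le_rfl).aestronglyMeasurable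
  have hfYm : AEStronglyMeasurable (fun ω => f (Y ω)) (Pr r x) := by
    refine aestronglyMeasurable_of_tendsto_ae atTop (f := fun n ω => f (X (q n) ω)) (fun n =>
      (f.continuous.measurable.comp (hX.measurable (q n))).aestronglyMeasurable) ?_
    filter_upwards [hY] with ω hω
    exact (f.continuous.tendsto _).comp hω
  have iXX : Integrable (fun ω => f (X t ω) * f (X t ω)) (Pr r x) :=
    .of_bound (hfXm.mul hfXm) (C * C) (ae_of_all _ fun ω => by
      rw [norm_mul]; exact mul_self_le_mul_self (abs_nonneg _) (hC _))
  have iXY : Integrable (fun ω => f (X t ω) * f (Y ω)) (Pr r x) :=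
    .of_bound (hfXm.mul hfYm) (C * C) (ae_of_all _ fun ω => by
      rw [norm_mul]
      exact mul_le_mul (hC _) (hC _) (abs_nonneg _) ((abs_nonneg _).trans (hC (X t ω))))
  have iYY : Integrable (fun ω => f (Y ω) * f (Y ω)) (Pr r x) :=
    .of_bound (hfYm.mul hfYm) (C * C) (ae_of_all _ fun ω => by
      rw [norm_mul]; exact mul_self_le_mul_self (abs_nonneg _) (hC _))
  have e1 := key f _ hfX ⟨C, fun ω => hC _⟩
  have e2 := key (f * f) (fun _ => 1) measurable_const ⟨1, by simp⟩
  simp only [ContinuousMap.coe_mul, Pi.mul_apply, one_mul] at e2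
  have iA : Integrable (fun ω => f (X t ω) * f (Y ω) + f (X t ω) * f (Y ω)) (Pr r x) := iXY.add iXY
  have iS : Integrable (fun ω => f (Y ω) * f (Y ω) -
    (f (X t ω) * f (Y ω) + f (X t ω) * f (Y ω))) (Pr r x) := iYY.sub iA
  have e3 : ∫ ω, (f (Y ω) * f (Y ω) - (f (X t ω) * f (Y ω) + f (X t ω) * f (Y ω)) +
      f (X t ω) * f (X t ω)) ∂(Pr r x) = 0 := by
    rw [integral_add iS iXX, integral_sub iYY iA, integral_add iXY iXY, e1, e2]
    ring
  have hnn : ∀ ω, 0 ≤ f (Y ω) * f (Y ω) - (f (X t ω) * f (Y ω) + f (X t ω) * f (Y ω)) +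
      f (X t ω) * f (X t ω) := fun ω => by nlinarith [sq_nonneg (f (Y ω) - f (X t ω))]
  have e4 := (integral_eq_zero_iff_of_nonneg hnn (iS.add iXX)).1 e3
  filter_upwards [e4] with ω hω
  have : (f (Y ω) - f (X t ω)) ^ 2 = 0 := by
    have : f (Y ω) * f (Y ω) - (f (X t ω) * f (Y ω) + f (X t ω) * f (Y ω)) +
      f (X t ω) * f (X t ω) = 0 := hω
    linear_combination this
  exact sub_eq_zero.1 (pow_eq_zero_iff two_ne_zero |>.1 this)

theorem IsMarkovProcess.ae_tildeX_eq [SecondCountableTopology (OnePoint S)] (r : ℝ≥0)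
    (x : OnePoint S) (t : ℝ≥0) : ∀ᵐ ω ∂(Pr r x), tildeX X t ω = X t ω := by
  obtain ⟨g, hg⟩ := exists_separating_sequence (OnePoint S)
  obtain ⟨q, hq⟩ := exists_seq_tendsto (𝓝[ratTimes ∩ Ioi t] t)
  obtain ⟨N, hN⟩ := eventually_atTop.1 (tendsto_nhdsWithin_iff.1 hq).2
  have hq' : Tendsto (fun n => q (n + N)) atTop (𝓝[ratTimes ∩ Ioi t] t) :=
    hq.comp (tendsto_add_atTop_nat N)
  have h : ∀ᵐ ω ∂(Pr r x), ∀ n, g n (tildeX X t ω) = g n (X t ω) := by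
    refine ae_all_iff.2 fun n => hX.ae_eq_of_tendsto hD r x t (q := fun n => q (n + N))
      (fun n => (hN _ (Nat.le_add_left _ _)).2.le) (tendsto_nhdsWithin_iff.1 hq').1 ?_ (g n)
    filter_upwards [hX.ae_mem_regularSet hD r x] with ω hω
    exact (tendsto_tildeX hω t).comp hq'
  filter_upwards [h] with ω hω
  exact hg _ _ hω

end Regularity

/-! ### Absorption in the cemetery after the explosion time -/

section Absorption

variable {S Ω : Type*} [TopologicalSpace S] {mΩ : MeasurableSpace Ω} {F : Filtration ℝ≥0 mΩ}
  {X : ℝ≥0 → Ω → OnePoint S} {Pr : ℝ≥0 → OnePoint S → Measure Ω}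
  (hX : IsMarkovProcess F X Pr)
include hX

section Minimum

variable {f : OnePoint S → ℝ} (hf : Measurable f) {C : ℝ} (hC : ∀ y, |f y| ≤ C)
include hf hC

/-- A maximal inequality. The event splits according to the first time q in `D` at which the
martingale is at most ε; on each piece, which is known at time q, f(X_T) may be replaced by the
martingale at time q. The induction adds the largest time last. -/
theorem IsMarkovProcess.setIntegral_le_of_finset (r : ℝ≥0) (x : OnePoint S) (T : ℝ≥0) {ε : ℝ}
    (D : Finset ℝ≥0) (hDT : ∀ q ∈ D, q ≤ T) :
    ∫ ω in {ω | ∃ q ∈ D, transitionMartingale X Pr f r T q ω ≤ ε}, f (X T ω) ∂(Pr r x) ≤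
      ε * (Pr r x).real {ω | ∃ q ∈ D, transitionMartingale X Pr f r T q ω ≤ ε} := by
  have := hX.isProbabilityMeasure r x
  have hi : Integrable (fun ω => f (X T ω)) (Pr r x) :=
    .of_bound (hf.comp (hX.measurable T)).aestronglyMeasurable C (ae_of_all _ fun _ => hC _)
  have hm : ∀ q, MeasurableSet[F q] {ω | transitionMartingale X Pr f r T q ω ≤ ε} := fun q =>
    hX.measurable_transitionMartingale hf r T q measurableSet_Iic
  have hmD : ∀ (D : Finset ℝ≥0) (q : ℝ≥0), (∀ p ∈ D, p ≤ q) →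
      MeasurableSet[F q] {ω | ∃ q ∈ D, transitionMartingale X Pr f r T q ω ≤ ε} := by
    intro D q hq
    have : {ω | ∃ q ∈ D, transitionMartingale X Pr f r T q ω ≤ ε} =
        ⋃ q ∈ D, {ω | transitionMartingale X Pr f r T q ω ≤ ε} := by ext; simp
    rw [this]
    exact Finset.measurableSet_biUnion D fun p hp => F.mono (hq p hp) _ (hm p)
  induction D using Finset.induction_on_max with
  | empty => simp
  | insert q D hq ih =>
    have hD' := hmD D q fun p hp => (hq p hp).le
    set B := {ω | ∃ q ∈ D, transitionMartingale X Pr f r T q ω ≤ ε} with hB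
    set A := {ω | transitionMartingale X Pr f r T q ω ≤ ε} \ B with hA
    have hAm : MeasurableSet[F q] A := (hm q).diff hD'
    have hU : {ω | ∃ p ∈ insert q D, transitionMartingale X Pr f r T p ω ≤ ε} = B ∪ A := by
      ext ω
      simp [hB, hA, or_comm]
    have hdisj : Disjoint B A := disjoint_sdiff_right
    have hA' : ∫ ω in A, f (X T ω) ∂(Pr r x) ≤ ε * (Pr r x).real A := by
      rw [← hX.setIntegral_transitionMartingale hf hC r x (hDT q (Finset.mem_insert_self _ _)) hAm]
      refine (setIntegral_mono_on (g := fun _ => ε)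
        (hX.integrable_transitionMartingale hf hC r T q x).integrableOn
        (integrable_const _).integrableOn (F.le q _ hAm) (fun ω hω => hω.1)).trans_eq ?_
      simp [mul_comm]
    rw [hU, setIntegral_union hdisj (F.le q _ hAm) hi.integrableOn hi.integrableOn,
      measureReal_union hdisj (F.le q _ hAm), mul_add]
    exact add_le_add (ih fun p hp => hDT p (Finset.mem_insert_of_mem hp)) hA'

/-- A nonnegative transition martingale which comes arbitrarily close to `0` ends up in `0`. -/
theorem IsMarkovProcess.ae_eq_zero_of_small (hf0 : ∀ y, 0 ≤ f y) (r : ℝ≥0) (x : OnePoint S)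
    (T : ℝ≥0) {e : ℕ → ℝ≥0} (he : ∀ n, e n ≤ T) :
    ∀ᵐ ω ∂(Pr r x), (∀ ε > 0, ∃ n, transitionMartingale X Pr f r T (e n) ω ≤ ε) →
      f (X T ω) = 0 := by
  have := hX.isProbabilityMeasure r x
  have hi : Integrable (fun ω => f (X T ω)) (Pr r x) :=
    .of_bound (hf.comp (hX.measurable T)).aestronglyMeasurable C (ae_of_all _ fun _ => hC _)
  have hm : ∀ ε q, MeasurableSet {ω | transitionMartingale X Pr f r T q ω ≤ ε} := fun ε q =>
    F.le q _ (hX.measurable_transitionMartingale hf r T q measurableSet_Iic)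
  have h1 : ∀ ε > 0, ∫ ω in {ω | ∃ n, transitionMartingale X Pr f r T (e n) ω ≤ ε},
      f (X T ω) ∂(Pr r x) ≤ ε := by
    intro ε hε
    have hU : {ω | ∃ n, transitionMartingale X Pr f r T (e n) ω ≤ ε} = ⋃ N : ℕ,
        {ω | ∃ q ∈ (Finset.range N).image e, transitionMartingale X Pr f r T q ω ≤ ε} := by
      ext ω
      simp only [mem_iUnion, Finset.mem_image, Finset.mem_range]
      constructor
      · rintro ⟨n, hn⟩
        exact ⟨n + 1, e n, ⟨n, Nat.lt_succ_self n, rfl⟩, hn⟩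
      · rintro ⟨N, _, ⟨n, _, rfl⟩, hn⟩
        exact ⟨n, hn⟩
    rw [hU]
    refine le_of_tendsto (tendsto_setIntegral_of_monotone (fun N => ?_) ?_ hi.integrableOn)
      (Eventually.of_forall fun N => ?_)
    · have : {ω | ∃ q ∈ (Finset.range N).image e, transitionMartingale X Pr f r T q ω ≤ ε} =
          ⋃ q ∈ (Finset.range N).image e, {ω | transitionMartingale X Pr f r T q ω ≤ ε} := by
        ext; simp
      rw [this]
      exact Finset.measurableSet_biUnion _ fun p hp => hm _ _
    · rintro N N' hN ω ⟨q, hq, h⟩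
      exact ⟨q, Finset.image_subset_image (Finset.range_mono hN) hq, h⟩
    · refine (hX.setIntegral_le_of_finset hf hC r x T _ fun q hq => ?_).trans
        (mul_le_of_le_one_right hε.le measureReal_le_one)
      obtain ⟨n, _, rfl⟩ := Finset.mem_image.1 hq
      exact he n
  set B := ⋂ k : ℕ, {ω | ∃ n, transitionMartingale X Pr f r T (e n) ω ≤ 1 / ((k : ℝ) + 1)} with hB
  have hBm : MeasurableSet B := by
    refine MeasurableSet.iInter fun k => ?_
    rw [ofPred_exists]
    exact MeasurableSet.iUnion fun n => hm _ _
  have h2 : ∫ ω in B, f (X T ω) ∂(Pr r x) = 0 := by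
    refine le_antisymm ?_ (integral_nonneg fun _ => hf0 _)
    refine ge_of_tendsto' tendsto_one_div_add_atTop_nhds_zero_nat fun k => ?_
    refine le_trans ?_ (h1 _ Nat.one_div_pos_of_nat)
    exact setIntegral_mono_set hi.integrableOn (ae_of_all _ fun _ => hf0 _)
      (ae_of_all _ (iInter_subset _ k))
  rw [setIntegral_eq_zero_iff_of_nonneg_ae (ae_of_all _ fun _ => hf0 _) hi.integrableOn] at h2
  rw [EventuallyEq, ae_restrict_iff' hBm] at h2
  filter_upwards [h2] with ω hω h
  exact hω (mem_iInter.2 fun k => h _ Nat.one_div_pos_of_nat)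

end Minimum

variable (hD : IsContinuousOnDiagonal X Pr) [T2Space (OnePoint S)]
  [SecondCountableTopology (OnePoint S)] {K : ℕ → Set (OnePoint S)}
  (hK : ∀ n, MeasurableSet (K n)) (hKU : ∀ y, y ≠ OnePoint.infty → ∃ n, y ∈ K n)
  (hV : VanishesAtCemetery X Pr K)
include hD hK hKU hV

/-- Some time t < T is a limit of rational times along which the path tends to Δ. There the
probability of being in `K n` at a slightly later time tends to 0, and a nonnegative martingale
which comes arbitrarily close to 0 ends in 0. Since the `K n` cover E, the process is then in Δ,
where it stays. -/
theorem IsMarkovProcess.ae_eq_infty_of_explosionTime_lt (r : ℝ≥0) (x : OnePoint S) :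
    ∀ᵐ ω ∂(Pr r x), ∀ T : ℝ≥0, explosionTime X ω < T → X T ω = OnePoint.infty := by
  obtain ⟨e, he⟩ : ∃ e : ℕ → ℝ≥0, ratTimes = range e :=
    countable_ratTimes.exists_eq_range (range_nonempty _)
  have h1 : ∀ᵐ ω ∂(Pr r x), ∀ n, ∀ T ∈ ratTimes, (∀ ε > 0, ∃ i, transitionMartingale X Pr
      ((K n).indicator fun _ => 1) r T (min (e i) T) ω ≤ ε) → X T ω ∉ K n := by
    refine ae_all_iff.2 fun n => (ae_ball_iff countable_ratTimes).2 fun T _ => ?_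
    filter_upwards [hX.ae_eq_zero_of_small (measurable_const.indicator (hK n)) (C := 1)
      (f := (K n).indicator fun _ => 1)
      (fun y => by by_cases h : y ∈ K n <;> simp [h])
      (fun y => indicator_nonneg (fun _ _ => zero_le_one) y) r x T
      (e := fun i => min (e i) T) (fun i => min_le_right _ _)] with ω hω h hmem
    have := hω h
    rw [indicator_of_mem hmem] at this
    exact one_ne_zero this
  filter_upwards [h1, hX.ae_mem_regularSet hD r x] with ω hω hreg T' hT'
  obtain ⟨t, htT, D, hne, hD⟩ := exists_tendsto_infty_of_explosionTime_lt hreg hT'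
  have h2 : ∀ᶠ T in 𝓝[>] t, ∀ n, Tendsto (fun p : ℝ≥0 × OnePoint S =>
      ∫ y, (K n).indicator (fun _ => (1 : ℝ)) y ∂(transition X Pr p.1 (r + T) p.2))
      (𝓝 (r + t, OnePoint.infty)) (𝓝 0) := by
    have : Tendsto (fun T => r + T) (𝓝[>] t) (𝓝[>] (r + t)) := by
      refine tendsto_nhdsWithin_iff.2 ⟨?_, ?_⟩
      · exact ((continuous_const.add continuous_id).tendsto t).mono_left nhdsWithin_le_nhds
      · filter_upwards [self_mem_nhdsWithin] with T hT
        exact add_lt_add_right (mem_Ioi.1 hT) r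
    exact this.eventually (hV (r + t))
  obtain ⟨b, hb, hb'⟩ := (nhdsGT_basis t).eventually_iff.1 h2
  -- The exceptional null set is controlled for rational horizons only; the absorption of X carries
  -- the conclusion from the rational `T` to `T'`.
  obtain ⟨T, hTr, htT1, hT1⟩ := exists_ratTimes_between (lt_min hb htT)
  have h3 := hb' ⟨htT1, hT1.trans_le (min_le_left _ _)⟩
  have h4 : X T ω = OnePoint.infty := by
    by_contra hne'
    obtain ⟨n, hn⟩ := hKU _ hne'
    refine hω n T hTr (fun ε hε => ?_) hn
    have h5 : Tendsto (fun q => transitionMartingale X Pr ((K n).indicator fun _ => 1) r T q ω)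
        (𝓝[ratTimes ∩ D] t) (𝓝 0) := by
      refine (h3 n).comp (f := fun q => (r + q, X q ω)) (Tendsto.prodMk_nhds ?_ hD)
      exact ((continuous_const.add continuous_id).tendsto t).mono_left nhdsWithin_le_nhds
    obtain ⟨q, ⟨hq1, hq2⟩, hq3⟩ := ((h5.eventually (gt_mem_nhds hε)).and
      ((mem_nhdsWithin_of_mem_nhds (Iio_mem_nhds htT1) : Iio T ∈ 𝓝[ratTimes ∩ D] t))|>.and
      self_mem_nhdsWithin).exists
    obtain ⟨i, rfl⟩ : q ∈ range e := he ▸ hq3.1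
    exact ⟨i, by rw [min_eq_left (le_of_lt hq2)]; exact le_of_lt hq1⟩
  exact hX.absorbing ω T T' (hT1.trans_le (min_le_right _ _)) h4

/-- Almost surely, the process `X̄` coincides with the regularization `X̃` at all times. -/
theorem IsMarkovProcess.ae_barX_eq_tildeX (r : ℝ≥0) (x : OnePoint S) :
    ∀ᵐ ω ∂(Pr r x), ∀ t, barX X t ω = tildeX X t ω := by
  filter_upwards [hX.ae_eq_infty_of_explosionTime_lt hD hK hKU hV r x,
    hX.ae_mem_regularSet hD r x] with ω hω hreg t
  rcases lt_or_ge (t : ℝ≥0∞) (explosionTime X ω) with h | h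
  · exact barX_of_lt h
  rw [barX_of_le h]
  refine tendsto_nhds_unique (tendsto_const_nhds.congr' ?_) (tendsto_tildeX hreg t)
  filter_upwards [self_mem_nhdsWithin] with q hq
  exact (hω q (h.trans_lt (ENNReal.coe_lt_coe.2 hq.2))).symm

theorem IsMarkovProcess.ae_barX_eq (r : ℝ≥0) (x : OnePoint S) (t : ℝ≥0) :
    ∀ᵐ ω ∂(Pr r x), barX X t ω = X t ω := by
  filter_upwards [hX.ae_barX_eq_tildeX hD hK hKU hV r x, hX.ae_tildeX_eq hD r x t] with ω h1 h2
  rw [h1, h2]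

theorem IsMarkovProcess.ae_barX_absorbing (r : ℝ≥0) (x : OnePoint S) :
    ∀ᵐ ω ∂(Pr r x), ∀ s t, s < t → barX X s ω = OnePoint.infty →
      barX X t ω = OnePoint.infty := by
  filter_upwards [hX.ae_barX_eq hD hK hKU hV r x 0, hX.ae_mem_regularSet hD r x] with ω h0 hreg
    s t hst hs
  rcases le_or_gt (explosionTime X ω) t with h | h
  · exact barX_of_le h
  exfalso
  have hs' : (s : ℝ≥0∞) < explosionTime X ω := (ENNReal.coe_lt_coe.2 hst).trans h
  rw [barX_of_lt hs'] at hs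
  -- The explosion time disregards time 0. A start in Δ is instead excluded through X_0 itself: its
  -- absorption gives X̃_t = Δ, so that the explosion time is at most t.
  rcases eq_zero_or_pos s with rfl | hs0
  · have hX0 : X 0 ω = OnePoint.infty := by rw [← h0, barX_of_lt hs', hs]
    have : tildeX X t ω = OnePoint.infty := by
      refine (tendsto_nhds_unique (tendsto_const_nhds.congr' ?_) (tendsto_tildeX hreg t)).symm
      filter_upwards [self_mem_nhdsWithin] with q hq
      exact (hX.absorbing ω 0 q (hst.trans hq.2) hX0).symm
    exact h.not_ge (sInf_le ⟨t, rfl, hst, Or.inr this⟩)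
  · exact hs'.not_ge (sInf_le ⟨s, rfl, hs0, Or.inr hs⟩)

end Absorption

/-! ### Dyadic approximation of times from above -/

section Dyadic

/-- The smallest multiple of `2⁻ⁿ` which is strictly larger than `t`. -/
def dyadicUp (n : ℕ) (t : ℝ≥0) : ℝ≥0 := ((⌊t * 2 ^ n⌋₊ : ℝ≥0) + 1) / 2 ^ n

/-- Strictness matters: the strong Markov property is first proved at fixed times strictly after σ,
and here s = 0 has to be allowed in the passage to σ + s. -/
theorem lt_dyadicUp (n : ℕ) (t : ℝ≥0) : t < dyadicUp n t := by
  rw [dyadicUp, lt_div_iff₀ (by positivity)]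
  exact Nat.lt_floor_add_one _

theorem dyadicUp_le (n : ℕ) (t : ℝ≥0) : dyadicUp n t ≤ t + (1 / 2) ^ n := by
  rw [dyadicUp, div_le_iff₀ (by positivity), add_mul, ← mul_pow]
  norm_num
  exact Nat.floor_le (by positivity)

theorem tendsto_dyadicUp (t : ℝ≥0) : Tendsto (fun n => dyadicUp n t) atTop (𝓝[>] t) := by
  refine tendsto_nhdsWithin_iff.2 ⟨?_, Eventually.of_forall fun n => lt_dyadicUp n t⟩
  refine tendsto_of_tendsto_of_tendsto_of_le_of_le tendsto_const_nhds ?_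
    (fun n => (lt_dyadicUp n t).le) (fun n => dyadicUp_le n t)
  have : Tendsto (fun n => t + (1 / 2 : ℝ≥0) ^ n) atTop (𝓝 (t + 0)) :=
    tendsto_const_nhds.add (tendsto_pow_atTop_nhds_zero_of_lt_one (by positivity)
      (by rw [div_lt_one (by positivity)]; norm_num))
  simpa using this

theorem measurable_dyadicUp (n : ℕ) : Measurable (dyadicUp n) := by
  unfold dyadicUp
  fun_prop

end Dyadic

/-! ### Measurability of right continuous processes at random times -/

section RightContinuous

variable {Ω Z : Type*} [TopologicalSpace Z] [MeasurableSpace Z] [BorelSpace Z]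
  [TopologicalSpace.PseudoMetrizableSpace Z] {Y : ℝ≥0 → Ω → Z}
  (hYr : ∀ ω t, ContinuousWithinAt (fun t => Y t ω) (Ici t) t)
include hYr

/-- A right continuous process evaluated at a bounded random time is measurable. -/
theorem measurable_eval_of_le {m : MeasurableSpace Ω} {c : ℝ≥0} {σ : Ω → ℝ≥0}
    (hY : ∀ t ≤ c, Measurable[m] (Y t)) (hσ : Measurable[m] σ) (hσc : ∀ ω, σ ω ≤ c) :
    Measurable[m] fun ω => Y (σ ω) ω := by
  refine measurable_of_tendsto_metrizable (f := fun n ω => Y (min (dyadicUp n (σ ω)) c) ω)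
    (fun n => ?_) (tendsto_pi_nhds.2 fun ω => ?_)
  · have h1 : Measurable (Function.uncurry fun (k : ℕ) ω =>
        Y (min (((k : ℝ≥0) + 1) / 2 ^ n) c) ω) :=
      measurable_from_prod_countable_right fun k =>
        (hY (min (((k : ℝ≥0) + 1) / 2 ^ n) c) (min_le_right _ _) :)
    have h2 : Measurable fun ω => (⌊σ ω * 2 ^ n⌋₊, ω) :=
      (Nat.measurable_floor.comp (hσ.mul_const _)).prodMk measurable_id
    have h3 := h1.comp h2
    simpa only [Function.comp_def, Function.uncurry_apply_pair, dyadicUp] using h3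
  · have h1 : Tendsto (fun n => min (dyadicUp n (σ ω)) c) atTop (𝓝 (min (σ ω) c)) :=
      ((tendsto_nhdsWithin_iff.1 (tendsto_dyadicUp (σ ω))).1).min tendsto_const_nhds
    rw [min_eq_left (hσc ω)] at h1
    have h2 : Tendsto (fun n => min (dyadicUp n (σ ω)) c) atTop (𝓝[≥] (σ ω)) :=
      tendsto_nhdsWithin_iff.2 ⟨h1, Eventually.of_forall fun n =>
        mem_Ici.2 (le_min (lt_dyadicUp n _).le (hσc ω))⟩
    exact (hYr ω (σ ω)).tendsto.comp h2

/-- A right continuous process evaluated at a random time is measurable. -/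
theorem measurable_eval {m : MeasurableSpace Ω} {σ : Ω → ℝ≥0}
    (hY : ∀ t, Measurable[m] (Y t)) (hσ : Measurable[m] σ) :
    Measurable[m] fun ω => Y (σ ω) ω := by
  refine measurable_of_tendsto_metrizable (f := fun (n : ℕ) ω => Y (min (σ ω) n) ω)
    (fun n => measurable_eval_of_le hYr (c := n) (fun t _ => hY t) (hσ.min measurable_const)
      fun ω => min_le_right _ _) (tendsto_pi_nhds.2 fun ω => ?_)
  obtain ⟨N, hN⟩ := exists_nat_ge (σ ω)
  refine tendsto_const_nhds.congr' ?_
  filter_upwards [eventually_ge_atTop N] with n hn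
  rw [min_eq_left]
  exact hN.trans (by exact_mod_cast hn)

end RightContinuous

/-! ### Decomposition along countable fibers, and mixtures of probability measures -/

section Auxiliary

theorem setIntegral_eq_of_fibers {Ω E : Type*} {m : MeasurableSpace Ω} {μ : Measure Ω}
    [NormedAddCommGroup E] [NormedSpace ℝ E] {φ₁ φ₂ : Ω → E} {A : Set Ω} (hA : MeasurableSet A)
    {κ : Ω → ℕ} (hκ : Measurable κ) (h₁ : IntegrableOn φ₁ A μ) (h₂ : IntegrableOn φ₂ A μ)
    (h : ∀ k, ∫ ω in A ∩ κ ⁻¹' {k}, φ₁ ω ∂μ = ∫ ω in A ∩ κ ⁻¹' {k}, φ₂ ω ∂μ) :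
    ∫ ω in A, φ₁ ω ∂μ = ∫ ω in A, φ₂ ω ∂μ := by
  have hU : A = ⋃ k, A ∩ κ ⁻¹' {k} := by ext ω; simp
  have hm : ∀ k, MeasurableSet (A ∩ κ ⁻¹' {k}) := fun k => hA.inter (hκ (measurableSet_singleton k))
  have hd : Pairwise (Function.onFun Disjoint fun k => A ∩ κ ⁻¹' {k}) := by
    intro i j hij
    refine disjoint_left.2 fun ω h1 h2 => hij ?_
    rw [← mem_singleton_iff.1 h1.2, ← mem_singleton_iff.1 h2.2]
  rw [hU] at h₁ h₂ ⊢
  rw [integral_iUnion hm hd h₁, integral_iUnion hm hd h₂]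
  exact tsum_congr h

theorem integral_bind_of_bounded {Ω Z E : Type*} {m : MeasurableSpace Ω} [MeasurableSpace Z]
    [NormedAddCommGroup E] [NormedSpace ℝ E] [MeasurableSpace E] [BorelSpace E]
    [SecondCountableTopology E] {μ : Measure Ω}
    [IsFiniteMeasure μ] {κ : Ω → Measure Z} (hκ : Measurable κ) [∀ ω, IsProbabilityMeasure (κ ω)]
    {f : Z → E} (hf : Measurable f) {C : ℝ} (hC : ∀ z, ‖f z‖ ≤ C) :
    ∫ z, f z ∂(μ.bind κ) = ∫ ω, ∫ z, f z ∂(κ ω) ∂μ := by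
  let η : Kernel Ω Z := ⟨κ, hκ⟩
  have : IsMarkovKernel η := ⟨fun ω => inferInstanceAs (IsProbabilityMeasure (κ ω))⟩
  have h : (η ∘ₖ Kernel.const Unit μ) () = μ.bind κ := rfl
  rw [← h, Kernel.integral_comp]
  · rfl
  · exact .of_bound hf.aestronglyMeasurable C (ae_of_all _ hC)

theorem bind_univ_of_isProbabilityMeasure {Ω Z : Type*} {m : MeasurableSpace Ω} [MeasurableSpace Z]
    {μ : Measure Ω} [IsFiniteMeasure μ] {κ : Ω → Measure Z} (hκ : Measurable κ)
    [∀ ω, IsProbabilityMeasure (κ ω)] : μ.bind κ univ = μ univ := by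
  rw [Measure.bind_apply MeasurableSet.univ hκ.aemeasurable]
  simp

end Auxiliary

/-! ### Events in the past of a random time -/

section Past

variable {Ω : Type*} {m : MeasurableSpace Ω}

/-- `A` is in the past of the random time `σ`. -/
def IsPast (G : Filtration ℝ≥0 m) (σ : Ω → ℝ≥0) (A : Set Ω) : Prop :=
  ∀ c, MeasurableSet[G c] (A ∩ {ω | σ ω ≤ c})

variable {G : Filtration ℝ≥0 m} {σ : Ω → ℝ≥0} {A : Set Ω}

theorem IsPast.measurableSet (h : IsPast G σ A) : MeasurableSet A := by
  have : A = ⋃ n : ℕ, A ∩ {ω | σ ω ≤ n} := by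
    ext ω
    simp only [mem_iUnion, mem_inter_iff, mem_ofPred_eq, exists_and_left]
    exact (and_iff_left (exists_nat_ge (σ ω))).symm
  rw [this]
  exact MeasurableSet.iUnion fun n => G.le _ _ (h n)

theorem IsPast.measurableSet_of_le (h : IsPast G σ A) {c : ℝ≥0} (hc : ∀ ω ∈ A, σ ω ≤ c) :
    MeasurableSet[G c] A := by
  have h1 : A ∩ {ω | σ ω ≤ c} = A := inter_eq_left.2 fun ω hω => hc ω hω
  exact h1 ▸ h c

/-- On D = A ∩ {σ ≤ c} the value of σ is known at time c: the function equal to σ on D and to 0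
elsewhere is `G c`-measurable, because A ∩ {σ ≤ min a c} is in `G c` for all a. -/
theorem IsPast.inter_preimage (h : IsPast G σ A) {B : Set ℝ≥0} (hB : MeasurableSet B) :
    IsPast G σ (A ∩ σ ⁻¹' B) := by
  intro c
  set D := A ∩ {ω | σ ω ≤ c} with hD
  have h1 : Measurable[G c] (D.indicator σ) := by
    have h0 : ∀ {m' : MeasurableSpace Ω} {f : Ω → ℝ≥0}, (∀ a, MeasurableSet (f ⁻¹' Iic a)) →
      Measurable f := fun h => measurable_of_Iic h
    refine h0 (m' := G c) fun a => ?_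
    have h2 : D.indicator σ ⁻¹' Iic a = Dᶜ ∪ A ∩ {ω | σ ω ≤ min a c} := by
      ext ω
      by_cases hω : ω ∈ D
      · simp only [mem_preimage, indicator_of_mem hω, mem_Iic, mem_union, mem_compl_iff, hω,
          not_true, false_or, mem_inter_iff, hω.1, true_and, mem_ofPred_eq, le_min_iff]
        exact (and_iff_left hω.2).symm
      · simp [hω]
    rw [h2]
    exact (h c).compl.union (G.mono (min_le_right a c) _ (h _))
  have h3 : A ∩ σ ⁻¹' B ∩ {ω | σ ω ≤ c} = D ∩ D.indicator σ ⁻¹' B := by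
    ext ω
    by_cases hω : ω ∈ D
    · simp only [mem_inter_iff, mem_preimage, indicator_of_mem hω, hω, hω.1, true_and]
      exact and_iff_left hω.2
    · have : ¬ (ω ∈ A ∧ σ ω ≤ c) := hω
      simp only [mem_inter_iff, mem_preimage, mem_ofPred_eq, hω, false_and, iff_false]
      tauto
  rw [h3]
  exact (h c).inter (h1 hB)

end Past

/-! ### The strong Markov property for abstract right continuous processes -/

section StrongMarkov

variable {Ω Z : Type*} [TopologicalSpace Z] [MeasurableSpace Z] [BorelSpace Z]
  [TopologicalSpace.PseudoMetrizableSpace Z] {Δ : Z}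
  {m : MeasurableSpace Ω} {G : Filtration ℝ≥0 m} {μ : Measure Ω} [IsProbabilityMeasure μ]
  {Y : ℝ≥0 → Ω → Z} {κ : ℝ≥0 → ℝ≥0 → Z → Measure Z}
  {ι : Type*} {g : ι → Z → ℂ} {σ : Ω → ℝ≥0} {A : Set Ω}
  (hYr : ∀ ω t, ContinuousWithinAt (fun t => Y t ω) (Ici t) t)
  (hYa : ∀ t, Measurable[G t] (Y t))
  (hYΔ : ∀ᵐ ω ∂μ, ∀ s t, s < t → Y s ω = Δ → Y t ω = Δ)
  (hκm : Measurable fun p : ℝ≥0 × ℝ≥0 × Z => κ p.1 p.2.1 p.2.2)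
  (hκp : ∀ s t z, IsProbabilityMeasure (κ s t z))
  (hκΔ : ∀ s t, κ s t Δ = Measure.dirac Δ)
  (hM : ∀ s t, s ≤ t → ∀ A, MeasurableSet[G s] A → ∀ f : Z → ℂ, Measurable f →
    (∃ C, ∀ z, ‖f z‖ ≤ C) →
    ∫ ω in A, f (Y t ω) ∂μ = ∫ ω in A, ∫ z, f z ∂(κ s t (Y s ω)) ∂μ)
  (hgm : ∀ i, Measurable (g i)) (hg1 : ∀ i z, ‖g i z‖ ≤ 1)
  (hg : ∀ i d, ∃ t₀, ∀ t < d, t ≠ t₀ → ∀ z, z ≠ Δ →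
    Tendsto (fun p : ℝ≥0 × Z => ∫ y, g i y ∂(κ p.1 d p.2)) (𝓝 (t, z))
      (𝓝 (∫ y, g i y ∂(κ t d z))))
  (hσ : Measurable σ)

omit [TopologicalSpace Z] [BorelSpace Z] [TopologicalSpace.PseudoMetrizableSpace Z] in
theorem norm_integral_le_of_isProbabilityMeasure {E : Type*} [NormedAddCommGroup E]
    [NormedSpace ℝ E] {ν : Measure Z} [IsProbabilityMeasure ν] {f : Z → E} {C : ℝ}
    (hC : ∀ z, ‖f z‖ ≤ C) : ‖∫ z, f z ∂ν‖ ≤ C := by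
  simpa using norm_integral_le_of_norm_le_const (μ := ν) (ae_of_all _ hC)

omit [TopologicalSpace Z] [BorelSpace Z] [TopologicalSpace.PseudoMetrizableSpace Z] in
include hκm hκp in
theorem measurable_integral_of_measurable_kernel {E : Type*} [NormedAddCommGroup E]
    [NormedSpace ℝ E] [MeasurableSpace E] [BorelSpace E] [SecondCountableTopology E]
    {f : Z → E} (hf : Measurable f) :
    Measurable fun p : ℝ≥0 × ℝ≥0 × Z => ∫ y, f y ∂(κ p.1 p.2.1 p.2.2) := by
  let η : Kernel (ℝ≥0 × ℝ≥0 × Z) Z := ⟨_, hκm⟩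
  have : IsMarkovKernel η := ⟨fun p => hκp _ _ _⟩
  exact (StronglyMeasurable.integral_kernel (κ := η) hf.stronglyMeasurable).measurable

include hYr hYa hYΔ hκm hκp hκΔ hM hgm hg1 hσ in
/-- The strong Markov property at a fixed later time, off the exceptional time of the test
function. -/
theorem setIntegral_strongMarkov_of_ne (i : ι) {d t₀ : ℝ≥0}
    (hg : ∀ t < d, t ≠ t₀ → ∀ z, z ≠ Δ →
      Tendsto (fun p : ℝ≥0 × Z => ∫ y, g i y ∂(κ p.1 d p.2)) (𝓝 (t, z))
        (𝓝 (∫ y, g i y ∂(κ t d z))))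
    (hA : IsPast G σ A) (hAd : ∀ ω ∈ A, σ ω < d) (hAt : ∀ ω ∈ A, σ ω ≠ t₀) :
    ∫ ω in A, g i (Y d ω) ∂μ = ∫ ω in A, ∫ z, g i z ∂(κ (σ ω) d (Y (σ ω) ω)) ∂μ := by
  have hYm : ∀ t, Measurable (Y t) := fun t => (hYa t).mono (G.le t) le_rfl
  -- On a fiber of the discretization `ρ n` equals a constant e > σ, so the fiber belongs to the
  -- past at time e. If e < d the simple Markov property applies there; otherwise both indicators
  -- vanish.
  set ρ : ℕ → Ω → ℝ≥0 := fun n ω => dyadicUp n (σ ω) with hρ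
  have hρm : ∀ n, Measurable (ρ n) := fun n => (measurable_dyadicUp n).comp hσ
  have hBm : ∀ n, MeasurableSet {ω | ρ n ω < d} := fun n => measurableSet_lt (hρm n) measurable_const
  set φ : ℕ → Ω → ℂ := fun n ω => ∫ z, g i z ∂(κ (ρ n ω) d (Y (ρ n ω) ω)) with hφ
  have hφm : ∀ n, Measurable (φ n) := fun n =>
    (measurable_integral_of_measurable_kernel hκm hκp (hgm i)).comp
      ((hρm n).prodMk (measurable_const.prodMk (measurable_eval hYr hYm (hρm n))))
  have hgY : Measurable fun ω => g i (Y d ω) := (hgm i).comp (hYm d)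
  have hφ1 : ∀ n ω, ‖φ n ω‖ ≤ 1 := fun n ω =>
    have := hκp (ρ n ω) d (Y (ρ n ω) ω)
    norm_integral_le_of_isProbabilityMeasure (hg1 i)
  have hind : ∀ n (f : Ω → ℂ), (∀ ω, ‖f ω‖ ≤ 1) →
      ∀ ω, ‖({ω | ρ n ω < d}.indicator f) ω‖ ≤ 1 := fun n f hf ω => by
    refine (norm_indicator_le_norm_self f ω).trans (hf ω)
  have hev : ∀ ω ∈ A, ∀ᶠ n in atTop, ρ n ω < d := fun ω hω =>
    (tendsto_nhdsWithin_iff.1 (tendsto_dyadicUp (σ ω))).1.eventually (gt_mem_nhds (hAd ω hω))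
  -- the identity at the discretized times
  have key : ∀ n, ∫ ω in A, {ω | ρ n ω < d}.indicator (fun ω => g i (Y d ω)) ω ∂μ =
      ∫ ω in A, {ω | ρ n ω < d}.indicator (φ n) ω ∂μ := by
    intro n
    refine setIntegral_eq_of_fibers hA.measurableSet
      (κ := fun ω => ⌊σ ω * 2 ^ n⌋₊) (Nat.measurable_floor.comp (hσ.mul_const _))
      (Integrable.of_bound (hgY.indicator (hBm n)).aestronglyMeasurable 1
        (ae_of_all _ (hind n _ fun ω => hg1 i _)))
      (Integrable.of_bound ((hφm n).indicator (hBm n)).aestronglyMeasurable 1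
        (ae_of_all _ (hind n _ (hφ1 n)))) fun k => ?_
    set e : ℝ≥0 := ((k : ℝ≥0) + 1) / 2 ^ n with he
    set A' := A ∩ (fun ω => ⌊σ ω * 2 ^ n⌋₊) ⁻¹' {k} with hA'
    have hρe : ∀ ω ∈ A', ρ n ω = e := by
      rintro ω ⟨_, hω⟩
      have : ⌊σ ω * 2 ^ n⌋₊ = k := hω
      simp only [hρ, dyadicUp, this, he]
    have hA'm : IsPast G σ A' := hA.inter_preimage (B := (fun t => ⌊t * 2 ^ n⌋₊) ⁻¹' {k})
      ((Nat.measurable_floor.comp (measurable_id.mul_const _)) (measurableSet_singleton k))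
    have hA'e : MeasurableSet[G e] A' := hA'm.measurableSet_of_le fun ω hω =>
      (lt_dyadicUp n (σ ω)).le.trans (hρe ω hω).le
    by_cases hed : e < d
    · have h1 := hM e d hed.le A' hA'e (g i) (hgm i) ⟨1, hg1 i⟩
      refine Eq.trans (setIntegral_congr_fun (G.le e _ hA'e) fun ω hω => ?_) (h1.trans
        (setIntegral_congr_fun (G.le e _ hA'e) fun ω hω => ?_))
      · exact indicator_of_mem (s := {ω | ρ n ω < d}) (f := fun ω => g i (Y d ω))
          (show ρ n ω < d from (hρe ω hω).trans_lt hed)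
      · rw [indicator_of_mem (show ω ∈ {ω | ρ n ω < d} from (hρe ω hω).trans_lt hed)]
        simp only [hφ, hρe ω hω]
    · refine setIntegral_congr_fun (G.le e _ hA'e) fun ω hω => ?_
      have : ω ∉ {ω | ρ n ω < d} := fun h => hed ((hρe ω hω).symm.trans_lt h)
      rw [indicator_of_notMem this, indicator_of_notMem this]
  have lim1 : Tendsto (fun n => ∫ ω in A, {ω | ρ n ω < d}.indicator (fun ω => g i (Y d ω)) ω ∂μ)
      atTop (𝓝 (∫ ω in A, g i (Y d ω) ∂μ)) := by
    refine tendsto_integral_of_dominated_convergence (fun _ => 1)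
      (fun n => (hgY.indicator (hBm n)).aestronglyMeasurable) (integrable_const _)
      (fun n => ae_of_all _ (hind n _ fun ω => hg1 i _)) ?_
    refine (ae_restrict_iff' hA.measurableSet).2 (ae_of_all _ fun ω hω => ?_)
    refine tendsto_const_nhds.congr' ?_
    filter_upwards [hev ω hω] with n hn
    exact (indicator_of_mem (s := {ω | ρ n ω < d}) (f := fun ω => g i (Y d ω)) hn).symm
  have lim2 : Tendsto (fun n => ∫ ω in A, {ω | ρ n ω < d}.indicator (φ n) ω ∂μ)
      atTop (𝓝 (∫ ω in A, ∫ z, g i z ∂(κ (σ ω) d (Y (σ ω) ω)) ∂μ)) := by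
    refine tendsto_integral_of_dominated_convergence (fun _ => 1)
      (fun n => ((hφm n).indicator (hBm n)).aestronglyMeasurable) (integrable_const _)
      (fun n => ae_of_all _ (hind n _ (hφ1 n))) ?_
    refine (ae_restrict_iff' hA.measurableSet).2 ?_
    filter_upwards [hYΔ] with ω hωΔ hω
    have hρt := tendsto_nhdsWithin_iff.1 (tendsto_dyadicUp (σ ω))
    have h2 : Tendsto (fun n => φ n ω) atTop (𝓝 (∫ z, g i z ∂(κ (σ ω) d (Y (σ ω) ω)))) := by
      -- Continuity of the kernels is only available away from Δ. From Δ the path does not move, and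
      -- all kernels there are the Dirac measure, so the sequence is constant.
      by_cases hΔ : Y (σ ω) ω = Δ
      · have : ∀ n, φ n ω = ∫ z, g i z ∂(κ (σ ω) d (Y (σ ω) ω)) := fun n => by
          simp only [hφ]
          rw [hωΔ _ _ (lt_dyadicUp n (σ ω)) hΔ, hΔ, hκΔ, hκΔ]
        simp only [this]
        exact tendsto_const_nhds
      · refine (hg (σ ω) (hAd ω hω) (hAt ω hω) _ hΔ).comp (f := fun n => (ρ n ω, Y (ρ n ω) ω))
          (hρt.1.prodMk_nhds ?_)
        exact (hYr ω (σ ω)).tendsto.comp (tendsto_nhdsWithin_iff.2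
          ⟨hρt.1, hρt.2.mono fun n hn => Ioi_subset_Ici_self hn⟩)
    refine h2.congr' ?_
    filter_upwards [hev ω hω] with n hn
    exact (indicator_of_mem (s := {ω | ρ n ω < d}) (f := φ n) hn).symm
  exact tendsto_nhds_unique lim1 (lim2.congr fun n => (key n).symm)

include hYr hYa hYΔ hκm hκp hκΔ hM hgm hg1 hg hσ in
-- The exceptional time `t₀` is deterministic: on {σ = t₀} the claim is the simple Markov property
-- at time `t₀`, and off this event the kernels are continuous at σ.
theorem setIntegral_strongMarkov_of_lt (i : ι) {d : ℝ≥0}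
    (hA : IsPast G σ A) (hAd : ∀ ω ∈ A, σ ω < d) :
    ∫ ω in A, g i (Y d ω) ∂μ = ∫ ω in A, ∫ z, g i z ∂(κ (σ ω) d (Y (σ ω) ω)) ∂μ := by
  have hYm : ∀ t, Measurable (Y t) := fun t => (hYa t).mono (G.le t) le_rfl
  obtain ⟨t₀, ht₀⟩ := hg i d
  have hp1 := hA.inter_preimage (B := {t₀}ᶜ) (measurableSet_singleton t₀).compl
  have hp2 := hA.inter_preimage (B := {t₀}) (measurableSet_singleton t₀)
  have h1 := setIntegral_strongMarkov_of_ne hYr hYa hYΔ hκm hκp hκΔ hM hgm hg1 hσ i ht₀ hp1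
    (fun ω hω => hAd ω hω.1) (fun ω hω => hω.2)
  have h2 : ∫ ω in A ∩ σ ⁻¹' {t₀}, g i (Y d ω) ∂μ =
      ∫ ω in A ∩ σ ⁻¹' {t₀}, ∫ z, g i z ∂(κ (σ ω) d (Y (σ ω) ω)) ∂μ := by
    have hσt : ∀ ω ∈ A ∩ σ ⁻¹' {t₀}, σ ω = t₀ := fun ω hω => hω.2
    rcases lt_or_ge t₀ d with h | h
    · rw [hM t₀ d h.le _ (hp2.measurableSet_of_le fun ω hω => (hσt ω hω).le) (g i) (hgm i)
        ⟨1, hg1 i⟩]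
      refine setIntegral_congr_fun hp2.measurableSet fun ω hω => ?_
      rw [hσt ω hω]
    · have : A ∩ σ ⁻¹' {t₀} = ∅ := by
        refine eq_empty_of_forall_notMem fun ω hω => ?_
        exact absurd (hAd ω hω.1) (not_lt.2 (h.trans (hσt ω hω).ge))
      simp [this]
  have hU : A = (A ∩ σ ⁻¹' {t₀}) ∪ (A ∩ σ ⁻¹' {t₀}ᶜ) := by
    rw [← inter_union_distrib_left, preimage_compl, union_compl_self, inter_univ]
  have hdisj : Disjoint (A ∩ σ ⁻¹' {t₀}) (A ∩ σ ⁻¹' {t₀}ᶜ) :=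
    disjoint_left.2 fun ω h1 h2 => h2.2 h1.2
  have hi1 : Integrable (fun ω => g i (Y d ω)) μ :=
    .of_bound ((hgm i).comp (hYm d)).aestronglyMeasurable 1 (ae_of_all _ fun ω => hg1 i _)
  have hi2 : Integrable (fun ω => ∫ z, g i z ∂(κ (σ ω) d (Y (σ ω) ω))) μ :=
    .of_bound ((measurable_integral_of_measurable_kernel hκm hκp (hgm i)).comp
      (hσ.prodMk (measurable_const.prodMk (measurable_eval hYr hYm hσ)))).aestronglyMeasurable 1
      (ae_of_all _ fun ω => have := hκp (σ ω) d (Y (σ ω) ω)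
        norm_integral_le_of_isProbabilityMeasure (hg1 i))
  rw [hU, setIntegral_union hdisj hp1.measurableSet hi1.integrableOn hi1.integrableOn,
    setIntegral_union hdisj hp1.measurableSet hi2.integrableOn hi2.integrableOn, h1, h2]

variable (hdet : ∀ ν₁ ν₂ : Measure Z, IsFiniteMeasure ν₁ → IsFiniteMeasure ν₂ →
    ν₁ univ = ν₂ univ → (∀ i, ∫ z, g i z ∂ν₁ = ∫ z, g i z ∂ν₂) → ν₁ = ν₂)

include hYr hYa hYΔ hκm hκp hκΔ hM hgm hg1 hg hσ hdet in
-- The test functions `g i` and the total mass determine the measure, so the identity of integrals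
-- becomes one of measures and can then be applied to all bounded continuous functions.
theorem map_strongMarkov_of_lt {d : ℝ≥0} (hA : IsPast G σ A) (hAd : ∀ ω ∈ A, σ ω < d) :
    (μ.restrict A).map (Y d) = (μ.restrict A).bind fun ω => κ (σ ω) d (Y (σ ω) ω) := by
  have hYm : ∀ t, Measurable (Y t) := fun t => (hYa t).mono (G.le t) le_rfl
  have hκ' : Measurable fun ω => κ (σ ω) d (Y (σ ω) ω) :=
    hκm.comp (hσ.prodMk (measurable_const.prodMk (measurable_eval hYr hYm hσ)))
  have : ∀ ω, IsProbabilityMeasure (κ (σ ω) d (Y (σ ω) ω)) := fun ω => hκp _ _ _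
  refine hdet _ _ inferInstance ⟨?_⟩ ?_ fun i => ?_
  · rw [bind_univ_of_isProbabilityMeasure hκ']; exact measure_lt_top _ _
  · rw [bind_univ_of_isProbabilityMeasure hκ', Measure.map_apply (hYm d) MeasurableSet.univ, preimage_univ]
  · rw [integral_map (hYm d).aemeasurable (hgm i).aestronglyMeasurable,
      integral_bind_of_bounded hκ' (hgm i) (hg1 i)]
    exact setIntegral_strongMarkov_of_lt hYr hYa hYΔ hκm hκp hκΔ hM hgm hg1 hg hσ i hA hAd

variable (hκr : ∀ (f : C(Z, ℝ)) s t z, s ≤ t →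
    Tendsto (fun t' => ∫ y, f y ∂(κ s t' z)) (𝓝[>] t) (𝓝 (∫ y, f y ∂(κ s t z))))

include hYr hYa hYΔ hκm hκp hκΔ hM hgm hg1 hg hσ hdet hκr in
/-- The strong Markov property of a right continuous process. -/
theorem map_strongMarkov (hA : IsPast G σ A) (s : ℝ≥0) :
    (μ.restrict A).map (fun ω => Y (σ ω + s) ω) =
      (μ.restrict A).bind fun ω => κ (σ ω) (σ ω + s) (Y (σ ω) ω) := by
  have hYm : ∀ t, Measurable (Y t) := fun t => (hYa t).mono (G.le t) le_rfl
  have hκ' : ∀ {ρ : Ω → ℝ≥0}, Measurable ρ → Measurable fun ω => κ (σ ω) (ρ ω) (Y (σ ω) ω) :=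
    fun h => hκm.comp (hσ.prodMk (h.prodMk (measurable_eval hYr hYm hσ)))
  have hσs : Measurable fun ω => σ ω + s := hσ.add_const s
  have hYs : Measurable fun ω => Y (σ ω + s) ω := measurable_eval hYr hYm hσs
  have hpr : ∀ (t : ℝ≥0) ω, IsProbabilityMeasure (κ (σ ω) t (Y (σ ω) ω)) := fun t ω => hκp _ _ _
  have hpr' : ∀ ω, IsProbabilityMeasure (κ (σ ω) (σ ω + s) (Y (σ ω) ω)) := fun ω => hκp _ _ _
  have : IsFiniteMeasure ((μ.restrict A).bind fun ω => κ (σ ω) (σ ω + s) (Y (σ ω) ω)) :=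
    ⟨by rw [bind_univ_of_isProbabilityMeasure (hκ' hσs)]; exact measure_lt_top _ _⟩
  refine ext_of_forall_integral_eq_of_IsFiniteMeasure fun f => ?_
  have hfm : Measurable f := f.continuous.measurable
  have hfC : ∀ z, ‖f z‖ ≤ ‖f‖ := f.norm_coe_le_norm
  rw [integral_map hYs.aemeasurable hfm.aestronglyMeasurable,
    integral_bind_of_bounded (hκ' hσs) hfm hfC]
  -- Now the later time is discretized while σ is kept. On each fiber it is a fixed time e > σ,
  -- covered by `map_strongMarkov_of_lt`; the limit uses right continuity of the paths and of t' ↦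
  -- P_{s,t'}f.
  set ρ : ℕ → Ω → ℝ≥0 := fun n ω => dyadicUp n (σ ω + s) with hρ
  have hρm : ∀ n, Measurable (ρ n) := fun n => (measurable_dyadicUp n).comp hσs
  set φ : ℕ → Ω → ℝ := fun n ω => ∫ z, f z ∂(κ (σ ω) (ρ n ω) (Y (σ ω) ω)) with hφ
  have hφm : ∀ n, Measurable (φ n) := fun n =>
    (measurable_integral_of_measurable_kernel hκm hκp hfm).comp
      (hσ.prodMk ((hρm n).prodMk (measurable_eval hYr hYm hσ)))
  have hφC : ∀ n ω, ‖φ n ω‖ ≤ ‖f‖ := fun n ω =>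
    have := hpr (ρ n ω) ω
    norm_integral_le_of_isProbabilityMeasure hfC
  have hfY : ∀ n, Measurable fun ω => f (Y (ρ n ω) ω) := fun n =>
    hfm.comp (measurable_eval hYr hYm (hρm n))
  have key : ∀ n, ∫ ω in A, f (Y (ρ n ω) ω) ∂μ = ∫ ω in A, φ n ω ∂μ := by
    intro n
    refine setIntegral_eq_of_fibers hA.measurableSet
      (κ := fun ω => ⌊(σ ω + s) * 2 ^ n⌋₊) (Nat.measurable_floor.comp (hσs.mul_const _))
      (Integrable.of_bound (hfY n).aestronglyMeasurable ‖f‖ (ae_of_all _ fun ω => hfC _))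
      (Integrable.of_bound (hφm n).aestronglyMeasurable ‖f‖ (ae_of_all _ (hφC n))) fun k => ?_
    set e : ℝ≥0 := ((k : ℝ≥0) + 1) / 2 ^ n with he
    set A' := A ∩ (fun ω => ⌊(σ ω + s) * 2 ^ n⌋₊) ⁻¹' {k} with hA'
    have hρe : ∀ ω ∈ A', ρ n ω = e := by
      rintro ω ⟨_, hω⟩
      have : ⌊(σ ω + s) * 2 ^ n⌋₊ = k := hω
      simp only [hρ, dyadicUp, this, he]
    have hA'm : IsPast G σ A' := hA.inter_preimage (B := (fun t => ⌊(t + s) * 2 ^ n⌋₊) ⁻¹' {k})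
      ((Nat.measurable_floor.comp ((measurable_id.add_const s).mul_const _))
        (measurableSet_singleton k))
    have h1 := map_strongMarkov_of_lt (d := e) hYr hYa hYΔ hκm hκp hκΔ hM hgm hg1 hg hσ hdet hA'm
      fun ω hω => le_self_add.trans_lt ((lt_dyadicUp n (σ ω + s)).trans_eq (hρe ω hω))
    have h2 := congrArg (fun ν => ∫ z, f z ∂ν) h1
    have := hpr e
    rw [integral_map (hYm e).aemeasurable hfm.aestronglyMeasurable,
      integral_bind_of_bounded (hκ' measurable_const) hfm hfC] at h2
    refine Eq.trans (setIntegral_congr_fun hA'm.measurableSet fun ω hω => ?_) (h2.trans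
      (setIntegral_congr_fun hA'm.measurableSet fun ω hω => ?_))
    · simp only [hρe ω hω]
    · simp only [hφ, hρe ω hω]
  have lim1 : Tendsto (fun n => ∫ ω in A, f (Y (ρ n ω) ω) ∂μ)
      atTop (𝓝 (∫ ω in A, f (Y (σ ω + s) ω) ∂μ)) := by
    refine tendsto_integral_of_dominated_convergence (fun _ => ‖f‖)
      (fun n => (hfY n).aestronglyMeasurable) (integrable_const _)
      (fun n => ae_of_all _ fun ω => hfC _) (ae_of_all _ fun ω => ?_)
    refine (f.continuous.tendsto _).comp ((hYr ω (σ ω + s)).tendsto.comp ?_)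
    exact (tendsto_dyadicUp (σ ω + s)).mono_right (nhdsWithin_mono _ Ioi_subset_Ici_self)
  have lim2 : Tendsto (fun n => ∫ ω in A, φ n ω ∂μ) atTop
      (𝓝 (∫ ω in A, ∫ z, f z ∂(κ (σ ω) (σ ω + s) (Y (σ ω) ω)) ∂μ)) := by
    refine tendsto_integral_of_dominated_convergence (fun _ => ‖f‖)
      (fun n => (hφm n).aestronglyMeasurable) (integrable_const _)
      (fun n => ae_of_all _ (hφC n)) (ae_of_all _ fun ω => ?_)
    exact (hκr f.toContinuousMap (σ ω) (σ ω + s) _ le_self_add).comp (tendsto_dyadicUp (σ ω + s))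
  exact tendsto_nhds_unique lim1 (lim2.congr fun n => (key n).symm)

end StrongMarkov

/-! ### Passing to the completed σ-algebras -/

section Completions

variable {S Ω : Type*} {mΩ : MeasurableSpace Ω} {F : Filtration ℝ≥0 mΩ}
  {Pr : ℝ≥0 → OnePoint S → Measure Ω}

theorem le_barA : mΩ ≤ barA Pr :=
  le_iInf fun _ => le_iInf fun _ => le_eventuallyMeasurableSpace

theorem barF_le (t : ℝ≥0) : barF F Pr t ≤ barA Pr := @Filtration.le _ _ (barA Pr) _ (barF F Pr) t

theorem exists_ae_eq_of_measurableSet_barF {t : ℝ≥0} {A : Set Ω}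
    (hA : MeasurableSet[barF F Pr t] A) (r : ℝ≥0) (x : OnePoint S) :
    ∃ B, MeasurableSet[F t] B ∧ A =ᵐ[Pr r x] B :=
  (iInf_le_of_le r (iInf_le _ x) :
    barF F Pr t ≤ eventuallyMeasurableSpace (F t) (ae (Pr r x))) A hA

theorem measurable_barF_of_ae_eq {Z : Type*} [MeasurableSpace Z] {t : ℝ≥0} {f g : Ω → Z}
    (hf : Measurable[F t] f) (h : ∀ r x, g =ᵐ[Pr r x] f) : Measurable[barF F Pr t] g := by
  intro B hB
  have : barF F Pr t = ⨅ (r : ℝ≥0) (x : OnePoint S),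
    eventuallyMeasurableSpace (F t) (ae (Pr r x)) := rfl
  rw [this]
  simp only [MeasurableSpace.measurableSet_iInf]
  exact fun r x => ⟨f ⁻¹' B, hf hB, (h r x).preimage B⟩

theorem ae_barPr {r : ℝ≥0} {x : OnePoint S} {p : Ω → Prop} (h : ∀ᵐ ω ∂(Pr r x), p ω) :
    ∀ᵐ ω ∂(barPr Pr r x), p ω := by
  refine measure_mono_null (subset_toMeasurable (Pr r x) {ω | ¬ p ω}) ?_
  rw [barPr_apply Pr r x (le_barA _ (measurableSet_toMeasurable _ _)), measure_toMeasurable]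
  exact h

theorem isProbabilityMeasure_barPr {r : ℝ≥0} {x : OnePoint S} (h : IsProbabilityMeasure (Pr r x)) :
    IsProbabilityMeasure (barPr Pr r x) :=
  ⟨by rw [barPr_apply Pr r x MeasurableSet.univ, measure_univ]⟩

theorem trim_barPr (r : ℝ≥0) (x : OnePoint S) : (barPr Pr r x).trim le_barA = Pr r x := by
  refine Measure.ext fun A hA => ?_
  rw [trim_measurableSet_eq _ hA, barPr_apply Pr r x (le_barA _ hA)]

/-- Every identity for the extended measure is brought back to the original one in this form: both
the set and the integrand may be changed on null sets of ℙ^(r,x). -/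
theorem setIntegral_barPr {G : Type*} [NormedAddCommGroup G] [NormedSpace ℝ G] {r : ℝ≥0}
    {x : OnePoint S} {A B : Set Ω} (hB : MeasurableSet B) (hAB : A =ᵐ[Pr r x] B) {f g : Ω → G}
    (hg : StronglyMeasurable g) (hfg : f =ᵐ[Pr r x] g) :
    ∫ ω in A, f ω ∂(barPr Pr r x) = ∫ ω in B, g ω ∂(Pr r x) := by
  rw [setIntegral_congr_set (ae_barPr hAB), integral_congr_ae (ae_restrict_of_ae (ae_barPr hfg)),
    setIntegral_trim le_barA hg hB, trim_barPr]

theorem map_barPr {Z : Type*} [MeasurableSpace Z] {r : ℝ≥0} {x : OnePoint S} {f g : Ω → Z}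
    (hf : Measurable[barA Pr] f) (hg : Measurable g) (hfg : f =ᵐ[Pr r x] g) :
    @Measure.map _ _ (barA Pr) _ f (barPr Pr r x) = (Pr r x).map g := by
  refine Measure.ext fun B hB => ?_
  rw [Measure.map_apply hf hB, Measure.map_apply hg hB, barPr_apply Pr r x (hf hB)]
  exact measure_congr (hfg.preimage B)

end Completions

/-! ### The simple Markov property of the càdlàg version -/

section Glue

variable {S Ω : Type*} [TopologicalSpace S] [T2Space (OnePoint S)] {mΩ : MeasurableSpace Ω}
  {F : Filtration ℝ≥0 mΩ}
  {X : ℝ≥0 → Ω → OnePoint S} {Pr : ℝ≥0 → OnePoint S → Measure Ω}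
  (hX : IsMarkovProcess F X Pr) (hbar : ∀ r x t, ∀ᵐ ω ∂(Pr r x), barX X t ω = X t ω)
include hX

/-- Started in Δ, the process stays there by absorption. -/
theorem IsMarkovProcess.transition_infty (s t : ℝ≥0) :
    transition X Pr s t OnePoint.infty = Measure.dirac OnePoint.infty := by
  have := hX.isProbabilityMeasure s OnePoint.infty
  have h : X (t - s) =ᵐ[Pr s OnePoint.infty] fun _ => OnePoint.infty := by
    filter_upwards [hX.ae_start s OnePoint.infty] with ω hω
    rcases eq_zero_or_pos (t - s) with h0 | h0
    · rw [h0, hω]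
    · exact hX.absorbing ω 0 _ h0 hω
  rw [transition, Measure.map_congr h, Measure.map_const, measure_univ, one_smul]

omit [T2Space (OnePoint S)] in
theorem IsMarkovProcess.integrable_comp {G : Type*} [NormedAddCommGroup G] [MeasurableSpace G]
    [BorelSpace G] [SecondCountableTopology G]
    {f : OnePoint S → G} (hf : Measurable f) {C : ℝ}
    (hC : ∀ y, ‖f y‖ ≤ C) (r t : ℝ≥0) (x : OnePoint S) :
    Integrable (fun ω => f (X t ω)) (Pr r x) :=
  have := hX.isProbabilityMeasure r x
  .of_bound (hf.comp (hX.measurable t)).aestronglyMeasurable C (ae_of_all _ fun _ => hC _)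

omit [T2Space (OnePoint S)] in
theorem IsMarkovProcess.setIntegral_markov {f : OnePoint S → ℂ} (hf : Measurable f) {C : ℝ}
    (hC : ∀ y, ‖f y‖ ≤ C) (r : ℝ≥0) (x : OnePoint S) {s t : ℝ≥0} (hst : s ≤ t) {A : Set Ω}
    (hA : MeasurableSet[F s] A) :
    ∫ ω in A, f (X t ω) ∂(Pr r x) =
      ∫ ω in A, ∫ y, f y ∂(transition X Pr (r + s) (r + t) (X s ω)) ∂(Pr r x) := by
  have := hX.isProbabilityMeasure r x
  have hp := hX.isProbabilityMeasure_transition (r + s) (r + t)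
  have hi : ∀ z, Integrable f (transition X Pr (r + s) (r + t) z) := fun z =>
    .of_bound hf.aestronglyMeasurable C (ae_of_all _ hC)
  let η : Kernel (OnePoint S) (OnePoint S) := ⟨_, hX.measurable_transition (r + s) (r + t)⟩
  have hη : IsMarkovKernel η := ⟨fun z => hp z⟩
  have hm : Measurable fun z => ∫ y, f y ∂(transition X Pr (r + s) (r + t) z) :=
    (StronglyMeasurable.integral_kernel (κ := η) hf.stronglyMeasurable).measurable
  have hI := hX.integrable_comp hm (fun z => hX.norm_integral_transition_le hC _ _ z) r s x
  have hJ := hX.integrable_comp hf hC r t x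
  have hre := hX.setIntegral_transitionMartingale (f := fun z => (f z).re)
    (Complex.measurable_re.comp hf) (C := C) (fun z => (Complex.abs_re_le_norm _).trans (hC z))
    r x hst hA
  have him := hX.setIntegral_transitionMartingale (f := fun z => (f z).im)
    (Complex.measurable_im.comp hf) (C := C) (fun z => (Complex.abs_im_le_norm _).trans (hC z))
    r x hst hA
  have e1 : ∀ z, ∫ y, (f y).re ∂(transition X Pr (r + s) (r + t) z) =
      (∫ y, f y ∂(transition X Pr (r + s) (r + t) z)).re := fun z => integral_re (hi z)
  have e2 : ∀ z, ∫ y, (f y).im ∂(transition X Pr (r + s) (r + t) z) =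
      (∫ y, f y ∂(transition X Pr (r + s) (r + t) z)).im := fun z => integral_im (hi z)
  simp only [transitionMartingale, e1, e2] at hre him
  refine Complex.ext ?_ ?_
  · exact ((integral_re hJ.integrableOn).symm.trans hre.symm).trans (integral_re hI.integrableOn)
  · exact ((integral_im hJ.integrableOn).symm.trans him.symm).trans (integral_im hI.integrableOn)

include hbar

omit [T2Space (OnePoint S)] in
theorem IsMarkovProcess.measurable_barX (t : ℝ≥0) : Measurable[barF F Pr t] (barX X t) :=
  measurable_barF_of_ae_eq (hX.adapted t) fun r x => hbar r x t

omit [T2Space (OnePoint S)] in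
theorem IsMarkovProcess.measurable_barX' (t : ℝ≥0) : Measurable[barA Pr] (barX X t) :=
  (hX.measurable_barX hbar t).mono (barF_le t) le_rfl

omit [T2Space (OnePoint S)] in
theorem IsMarkovProcess.transition_eq_map_barX (s t : ℝ≥0) (x : OnePoint S) :
    transition X Pr s t x = @Measure.map _ _ (barA Pr) _ (barX X (t - s)) (barPr Pr s x) :=
  (map_barPr (hX.measurable_barX' hbar _) (hX.measurable _) (hbar s x _)).symm

omit [T2Space (OnePoint S)] in
theorem IsMarkovProcess.setIntegral_markov_barX {f : OnePoint S → ℂ} (hf : Measurable f) {C : ℝ}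
    (hC : ∀ y, ‖f y‖ ≤ C) (r : ℝ≥0) (x : OnePoint S) {s t : ℝ≥0} (hst : s ≤ t) {A : Set Ω}
    (hA : MeasurableSet[barF F Pr s] A) :
    ∫ ω in A, f (barX X t ω) ∂(barPr Pr r x) =
      ∫ ω in A, ∫ y, f y ∂(transition X Pr (r + s) (r + t) (barX X s ω)) ∂(barPr Pr r x) := by
  obtain ⟨B, hB, hAB⟩ := exists_ae_eq_of_measurableSet_barF hA r x
  let η : Kernel (OnePoint S) (OnePoint S) := ⟨_, hX.measurable_transition (r + s) (r + t)⟩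
  have hη : IsMarkovKernel η := ⟨fun z => hX.isProbabilityMeasure_transition (r + s) (r + t) z⟩
  have hm : Measurable fun z => ∫ y, f y ∂(transition X Pr (r + s) (r + t) z) :=
    (StronglyMeasurable.integral_kernel (κ := η) hf.stronglyMeasurable).measurable
  rw [setIntegral_barPr (F.le s B hB) hAB (g := fun ω => f (X t ω))
      (hf.comp (hX.measurable t)).stronglyMeasurable ((hbar r x t).mono fun ω h => by simp only [h]),
    setIntegral_barPr (F.le s B hB) hAB
      (g := fun ω => ∫ y, f y ∂(transition X Pr (r + s) (r + t) (X s ω)))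
      (hm.comp (hX.measurable s)).stronglyMeasurable ((hbar r x s).mono fun ω h => by simp only [h]),
    hX.setIntegral_markov hf hC r x hst hB]

/-- P_{s,t'}f(x) is the expectation of f(X̄_{t'-s}) under ℙ^(s,x), and the paths of X̄ are right
continuous. -/
theorem IsMarkovProcess.tendsto_integral_transition_right (f : C(OnePoint S, ℝ)) (s t : ℝ≥0)
    (x : OnePoint S) :
    Tendsto (fun t' => ∫ y, f y ∂(transition X Pr s t' x)) (𝓝[>] t)
      (𝓝 (∫ y, f y ∂(transition X Pr s t x))) := by
  have hp := isProbabilityMeasure_barPr (hX.isProbabilityMeasure s x)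
  obtain ⟨C, hC⟩ := exists_bound_continuousMap f
  have h : ∀ t', ∫ y, f y ∂(transition X Pr s t' x) =
      ∫ ω, f (barX X (t' - s) ω) ∂(barPr Pr s x) := fun t' => by
    rw [hX.transition_eq_map_barX hbar, integral_map (hX.measurable_barX' hbar _).aemeasurable
      f.continuous.measurable.aestronglyMeasurable]
  simp only [h]
  refine tendsto_integral_filter_of_dominated_convergence (fun _ => C)
    (Eventually.of_forall fun t' =>
      (f.continuous.measurable.comp (hX.measurable_barX' hbar _)).aestronglyMeasurable)
    (Eventually.of_forall fun t' => ae_of_all _ fun ω => hC _) (integrable_const _)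
    (ae_of_all _ fun ω => (f.continuous.tendsto _).comp ?_)
  have h1 : Tendsto (fun t' => t' - s) (𝓝[>] t) (𝓝[≥] (t - s)) := by
    refine tendsto_nhdsWithin_iff.2 ⟨?_, ?_⟩
    · exact (tendsto_id.mono_left nhdsWithin_le_nhds).sub tendsto_const_nhds
    · filter_upwards [self_mem_nhdsWithin] with t' ht'
      exact tsub_le_tsub_right (le_of_lt ht') s
  exact (isCadlag_barX ω (t - s)).1.tendsto.comp h1

end Glue

/-! ### Stopping times with the value ∞ -/

section StoppingTimes

variable {Ω : Type*} {m : MeasurableSpace Ω} {G : Filtration ℝ≥0 m} {τ : Ω → WithTop ℝ≥0}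

theorem eq_top_or_exists_coe (a : WithTop ℝ≥0) : a = ⊤ ∨ ∃ t : ℝ≥0, a = t := by
  induction a with
  | top => exact .inl rfl
  | coe t => exact .inr ⟨t, rfl⟩

theorem measurableSet_eq_top (hτ : ∀ c : ℝ≥0, MeasurableSet {ω | τ ω ≤ c}) : MeasurableSet {ω | τ ω = ⊤} := by
  have h : {ω | τ ω = ⊤} = ⋂ n : ℕ, {ω | τ ω ≤ ((n : ℝ≥0) : WithTop ℝ≥0)}ᶜ := by
    ext ω
    simp only [mem_ofPred_eq, mem_iInter, mem_compl_iff, not_le]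
    refine ⟨fun h n => h ▸ WithTop.coe_lt_top _, fun h => ?_⟩
    by_contra hω
    obtain ⟨t, ht⟩ := WithTop.ne_top_iff_exists.1 hω
    obtain ⟨n, hn⟩ := exists_nat_ge t
    have := h n
    rw [← ht, WithTop.coe_lt_coe] at this
    exact absurd hn (not_le.2 this)
  rw [h]
  exact MeasurableSet.iInter fun n => (hτ n).compl

theorem measurable_untopD (hτ : ∀ c : ℝ≥0, MeasurableSet {ω | τ ω ≤ c}) :
    Measurable fun ω => (τ ω).untopD 0 := by
  refine measurable_of_Iic fun c => ?_
  have h : (fun ω => (τ ω).untopD 0) ⁻¹' Iic c = {ω | τ ω ≤ c} ∪ {ω | τ ω = ⊤} := by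
    ext ω
    rcases eq_top_or_exists_coe (τ ω) with h | ⟨t, h⟩
    · simp [h, -ENNReal.some_eq_coe']
    · simp [h, -ENNReal.some_eq_coe']
  rw [h]
  exact (hτ c).union (measurableSet_eq_top hτ)

theorem measurableSet_le_of_isStoppingTime (hτ : IsStoppingTime G τ) (c : ℝ≥0) :
    MeasurableSet {ω | τ ω ≤ c} := G.le _ _ (hτ c)

variable (hτ : IsStoppingTime G τ)
include hτ

/-- The finite time obtained by replacing ∞ by 0 need not be a stopping time. Being in the past is
therefore a condition on the event alone, and {τ = ∞} is cut out of it. -/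
theorem isPast_untopD {A : Set Ω} (hA : MeasurableSet[hτ.measurableSpace] A) :
    IsPast G (fun ω => (τ ω).untopD 0) (A ∩ {ω | τ ω = ⊤}ᶜ) := by
  intro c
  have h : A ∩ {ω | τ ω = ⊤}ᶜ ∩ {ω | (τ ω).untopD 0 ≤ c} = A ∩ {ω | τ ω ≤ c} := by
    ext ω
    rcases eq_top_or_exists_coe (τ ω) with h | ⟨t, h⟩
    · simp [h, -ENNReal.some_eq_coe']
    · simp [h, -ENNReal.some_eq_coe']
  rw [h]
  exact ((hτ.measurableSet A).1 hA).2 c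

/-- A function of a stopping time and of a right continuous adapted process at this time is
measurable with respect to the `σ`-algebra of the stopping time. -/
theorem measurable_stopped {Z : Type*} [TopologicalSpace Z] [MeasurableSpace Z] [BorelSpace Z]
    [TopologicalSpace.PseudoMetrizableSpace Z] {Y : ℝ≥0 → Ω → Z}
    (hYr : ∀ ω t, ContinuousWithinAt (fun t => Y t ω) (Ici t) t)
    (hYa : ∀ t, Measurable[G t] (Y t)) {h : ℝ≥0 × Z → ℝ} (hh : Measurable h) :
    Measurable[hτ.measurableSpace] ({ω | τ ω = ⊤}ᶜ.indicator
      fun ω => h ((τ ω).untopD 0, Y ((τ ω).untopD 0) ω)) := by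
  have hle : ∀ c : ℝ≥0, MeasurableSet[⨆ t, G t] {ω | τ ω ≤ c} := fun c =>
    le_iSup (fun t => G t) c _ (hτ c)
  have hYm : ∀ t, Measurable[⨆ t, G t] (Y t) := fun t =>
    (hYa t).mono (le_iSup (fun t => G t) t) le_rfl
  have hσ := measurable_untopD hle
  intro B hB
  refine ⟨((hh.comp (hσ.prodMk (measurable_eval hYr hYm hσ))).indicator
    (measurableSet_eq_top hle).compl) hB, fun c => ?_⟩
  -- On {τ ≤ c} only min(τ, c) matters; it is `G c`-measurable and at most c, so the process at this
  -- time is `G c`-measurable too.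
  set σ : Ω → ℝ≥0 := fun ω => (min (τ ω) c).untopD 0 with hσd
  have hσc : ∀ ω, σ ω ≤ c := fun ω => by
    rcases eq_top_or_exists_coe (τ ω) with h | ⟨t, h⟩
    · simp [hσd, h, -ENNReal.some_eq_coe']
    · simp only [hσd, h]
      exact min_le_right t c
  have hσm : Measurable[G c] σ := by
    have h0 : ∀ {m' : MeasurableSpace Ω} {f : Ω → ℝ≥0}, (∀ a, MeasurableSet (f ⁻¹' Iic a)) →
      Measurable f := fun h => measurable_of_Iic h
    refine h0 (m' := G c) fun a => ?_
    rcases lt_or_ge a c with hac | hac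
    · have h : σ ⁻¹' Iic a = {ω | τ ω ≤ a} := by
        ext ω
        rcases eq_top_or_exists_coe (τ ω) with h | ⟨t, h⟩
        · simp [hσd, h, hac, -ENNReal.some_eq_coe']
        · simp only [hσd, mem_preimage, mem_Iic, mem_ofPred_eq, h]
          have : (min (t : WithTop ℝ≥0) (c : WithTop ℝ≥0)).untopD 0 = min t c := rfl
          rw [this, min_le_iff]
          refine ⟨fun h => ?_, fun h => .inl (WithTop.coe_le_coe.1 h)⟩
          exact WithTop.coe_le_coe.2 (h.resolve_right (not_le.2 hac))
      rw [h]
      exact G.mono hac.le _ (hτ a)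
    · have h : σ ⁻¹' Iic a = univ := eq_univ_of_forall fun ω => (hσc ω).trans hac
      rw [h]
      exact MeasurableSet.univ
  have hm : Measurable[G c] fun ω => h (σ ω, Y (σ ω) ω) :=
    hh.comp (hσm.prodMk (measurable_eval_of_le hYr
      (fun t ht => (hYa t).mono (G.mono ht) le_rfl) hσm hσc))
  have h : {ω | τ ω = ⊤}ᶜ.indicator (fun ω => h ((τ ω).untopD 0, Y ((τ ω).untopD 0) ω)) ⁻¹' B ∩
      {ω | τ ω ≤ c} = (fun ω => h (σ ω, Y (σ ω) ω)) ⁻¹' B ∩ {ω | τ ω ≤ c} := by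
    ext ω
    refine and_congr_left fun hω => ?_
    have hω' : τ ω ≤ c := hω
    have h1 : ω ∈ {ω | τ ω = ⊤}ᶜ := (hω'.trans_lt (WithTop.coe_lt_top c)).ne
    rw [mem_preimage, indicator_of_mem h1, mem_preimage]
    simp only [hσd, min_eq_left hω']
  rw [h]
  exact (hm hB).inter (hτ c)

end StoppingTimes

/-! ### The strong Markov property of the càdlàg version -/

section StrongMarkovProperty

variable {S Ω : Type*} [TopologicalSpace S] [T2Space (OnePoint S)]
  [SecondCountableTopology (OnePoint S)] {mΩ : MeasurableSpace Ω}
  {F : Filtration ℝ≥0 mΩ} {X : ℝ≥0 → Ω → OnePoint S} {Pr : ℝ≥0 → OnePoint S → Measure Ω}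

omit [T2Space (OnePoint S)] [SecondCountableTopology (OnePoint S)] in
theorem expectationAt_eq_transitionAt (hX : IsMarkovProcess F X Pr)
    (hbar : ∀ r x t, ∀ᵐ ω ∂(Pr r x), barX X t ω = X t ω) {f : OnePoint S → ℝ} (hf : Measurable f)
    (r s : ℝ≥0) (y : OnePoint S) (t : WithTop ℝ≥0) :
    expectationAt (barPr Pr) (barX X) f r s y t = transitionAt (transition X Pr) f r s y t := by
  rcases t with _ | t
  · rfl
  · change ∫ ω, f (barX X s ω) ∂(barPr Pr (r + t) y) =
      ∫ z, f z ∂(transition X Pr (r + t) (r + t + s) y)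
    rw [hX.transition_eq_map_barX hbar, add_tsub_cancel_left,
      integral_map (hX.measurable_barX' hbar _).aemeasurable hf.aestronglyMeasurable]

theorem strongMarkov_barX {ι : Type*} {g : ι → OnePoint S → ℂ} (hX : IsMarkovProcess F X Pr)
    (hbar : ∀ r x t, ∀ᵐ ω ∂(Pr r x), barX X t ω = X t ω)
    (habs : ∀ r x, ∀ᵐ ω ∂(Pr r x), ∀ s t, s < t → barX X s ω = OnePoint.infty →
      barX X t ω = OnePoint.infty)
    (hm : Measurable fun p : ℝ≥0 × ℝ≥0 × OnePoint S => transition X Pr p.1 p.2.1 p.2.2)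
    (hgm : ∀ i, Measurable (g i)) (hg1 : ∀ i z, ‖g i z‖ ≤ 1)
    (hg : ∀ i d, ∃ t₀, ∀ t < d, t ≠ t₀ → ∀ z, z ≠ OnePoint.infty →
      Tendsto (fun p : ℝ≥0 × OnePoint S => ∫ y, g i y ∂(transition X Pr p.1 d p.2)) (𝓝 (t, z))
        (𝓝 (∫ y, g i y ∂(transition X Pr t d z))))
    (hdet : ∀ ν₁ ν₂ : Measure (OnePoint S), IsFiniteMeasure ν₁ → IsFiniteMeasure ν₂ →
      ν₁ univ = ν₂ univ → (∀ i, ∫ z, g i z ∂ν₁ = ∫ z, g i z ∂ν₂) → ν₁ = ν₂)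
    {τ : Ω → WithTop ℝ≥0} (hτ : IsStoppingTime (barF F Pr) τ) {f : OnePoint S → ℝ}
    (hf : Measurable f) (hfC : ∃ C : ℝ, ∀ y, |f y| ≤ C) (hf0 : f OnePoint.infty = 0)
    (r : ℝ≥0) (x : OnePoint S) (s : ℝ≥0) :
    Integrable (fun ω => f (valueAt (barX X) ω (τ ω + s))) (barPr Pr r x) ∧
    Measurable[hτ.measurableSpace] (fun ω =>
      transitionAt (transition X Pr) f r s (valueAt (barX X) ω (τ ω)) (τ ω)) ∧
    (barPr Pr r x)[fun ω => f (valueAt (barX X) ω (τ ω + s)) | hτ.measurableSpace]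
      =ᵐ[barPr Pr r x] fun ω =>
        transitionAt (transition X Pr) f r s (valueAt (barX X) ω (τ ω)) (τ ω) := by
  obtain ⟨C, hC⟩ := hfC
  have hC' : ∀ y, ‖f y‖ ≤ C := hC
  have hp := isProbabilityMeasure_barPr (hX.isProbabilityMeasure r x)
  have hYr : ∀ ω t, ContinuousWithinAt (fun t => barX X t ω) (Ici t) t := fun ω t =>
    (isCadlag_barX ω t).1
  have hYa := hX.measurable_barX hbar
  have hYm := hX.measurable_barX' hbar
  let mA : MeasurableSpace Ω := barA Pr
  set σ : Ω → ℝ≥0 := fun ω => (τ ω).untopD 0 with hσd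
  have hσ : Measurable[barA Pr] σ := measurable_untopD (measurableSet_le_of_isStoppingTime hτ)
  have htop : MeasurableSet[barA Pr] {ω | τ ω = ⊤} := 
    measurableSet_eq_top (measurableSet_le_of_isStoppingTime hτ)
  -- Under ℙ^(r,x), time s of the process corresponds to time r + s of the transition function.
  set κ : ℝ≥0 → ℝ≥0 → OnePoint S → Measure (OnePoint S) :=
    fun s t => transition X Pr (r + s) (r + t) with hκ
  have hκp : ∀ s t z, IsProbabilityMeasure (κ s t z) := fun s t z =>
    hX.isProbabilityMeasure_transition _ _ _
  have hκm : Measurable fun p : ℝ≥0 × ℝ≥0 × OnePoint S => κ p.1 p.2.1 p.2.2 :=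
    hm.comp ((measurable_const.add measurable_fst).prodMk
      ((measurable_const.add (measurable_fst.comp measurable_snd)).prodMk
        (measurable_snd.comp measurable_snd)))
  -- Both sides vanish on {τ = ∞}, the left one because f(Δ) = 0. It remains to treat {τ < ∞}, where
  -- τ agrees with the finite time `σ`.
  have hval : (fun ω => f (valueAt (barX X) ω (τ ω + s))) =
      {ω | τ ω = ⊤}ᶜ.indicator fun ω => f (barX X (σ ω + s) ω) := by
    funext ω
    rcases eq_top_or_exists_coe (τ ω) with h | ⟨t, h⟩
    · rw [indicator_of_notMem (by simpa using h)]
      rw [h]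
      exact hf0
    · rw [indicator_of_mem (by simp [h, -ENNReal.some_eq_coe'])]
      simp only [hσd, h]
      rfl
  have htr : (fun ω => transitionAt (transition X Pr) f r s (valueAt (barX X) ω (τ ω)) (τ ω)) =
      {ω | τ ω = ⊤}ᶜ.indicator fun ω => ∫ z, f z ∂(κ (σ ω) (σ ω + s) (barX X (σ ω) ω)) := by
    funext ω
    rcases eq_top_or_exists_coe (τ ω) with h | ⟨t, h⟩
    · rw [indicator_of_notMem (by simpa using h), h]
      rfl
    · rw [indicator_of_mem (by simp [h, -ENNReal.some_eq_coe'])]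
      simp only [hσd, h, hκ, ← add_assoc]
      rfl
  have hhm : Measurable fun p : ℝ≥0 × OnePoint S => ∫ z, f z ∂(κ p.1 (p.1 + s) p.2) :=
    (measurable_integral_of_measurable_kernel hκm hκp hf).comp
      (measurable_fst.prodMk ((measurable_fst.add_const s).prodMk measurable_snd))
  have hmeas := measurable_stopped hτ hYr hYa hhm
  rw [hval, htr]
  have hfY : Measurable[barA Pr] fun ω => f (barX X (σ ω + s) ω) :=
    hf.comp (measurable_eval hYr hYm (hσ.add_const s))
  have hint : Integrable ({ω | τ ω = ⊤}ᶜ.indicator fun ω => f (barX X (σ ω + s) ω))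
      (barPr Pr r x) :=
    (Integrable.of_bound hfY.aestronglyMeasurable C (ae_of_all _ fun _ => hC' _)).indicator
      htop.compl
  have hκ' : Measurable[barA Pr] fun ω => κ (σ ω) (σ ω + s) (barX X (σ ω) ω) :=
    hκm.comp (hσ.prodMk ((hσ.add_const s).prodMk (measurable_eval hYr hYm hσ)))
  have hκp' : ∀ ω, IsProbabilityMeasure (κ (σ ω) (σ ω + s) (barX X (σ ω) ω)) := fun ω => hκp _ _ _
  have hint' : Integrable ({ω | τ ω = ⊤}ᶜ.indicator fun ω =>
      ∫ z, f z ∂(κ (σ ω) (σ ω + s) (barX X (σ ω) ω))) (barPr Pr r x) :=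
    (Integrable.of_bound (hhm.comp (hσ.prodMk (measurable_eval hYr hYm hσ))).aestronglyMeasurable C
      (ae_of_all _ fun ω => norm_integral_le_of_isProbabilityMeasure hC')).indicator htop.compl
  refine ⟨hint, hmeas, (ae_eq_condExp_of_forall_setIntegral_eq hτ.measurableSpace_le hint
    (fun _ _ _ => hint'.integrableOn) (fun A hA _ => ?_)
    hmeas.stronglyMeasurable.aestronglyMeasurable).symm⟩
  have hA' := isPast_untopD hτ hA
  rw [setIntegral_indicator htop.compl, setIntegral_indicator htop.compl]
  have key := map_strongMarkov (μ := barPr Pr r x) (Δ := OnePoint.infty) hYr hYa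
    (ae_barPr (habs r x)) hκm hκp (fun s t => hX.transition_infty _ _)
    (fun s t hst A hA f hf ⟨C, hC⟩ => hX.setIntegral_markov_barX hbar hf hC r x hst hA)
    hgm hg1 (fun i d => ?_) hσ hdet
    (fun f s t z _ => ?_) hA' s
  · have := congrArg (fun ν => ∫ z, f z ∂ν) key
    rw [integral_map (measurable_eval hYr hYm (hσ.add_const s)).aemeasurable
      hf.aestronglyMeasurable, integral_bind_of_bounded hκ' hf hC'] at this
    exact this.symm
  · obtain ⟨t₀, ht₀⟩ := hg i (r + d)
    -- Truncated subtraction is harmless: r + t = t₀ forces t = t₀ - r.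
    refine ⟨t₀ - r, fun t htd ht z hz => ?_⟩
    have h1 := ht₀ (r + t) (by gcongr) (fun h => ht (by rw [← h, add_tsub_cancel_left])) z hz
    refine h1.comp (f := fun p : ℝ≥0 × OnePoint S => (r + p.1, p.2)) ?_
    exact (by fun_prop : Continuous fun p : ℝ≥0 × OnePoint S => (r + p.1, p.2)).tendsto (t, z)
  · refine (hX.tendsto_integral_transition_right hbar f (r + s) (r + t) z).comp
      (f := fun t' => r + t') (tendsto_nhdsWithin_iff.2 ⟨?_, ?_⟩)
    · exact ((continuous_const.add continuous_id).tendsto t).mono_left nhdsWithin_le_nhds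
    · filter_upwards [self_mem_nhdsWithin] with t' ht'
      exact add_lt_add_right ht' r

end StrongMarkovProperty

/-! ### Topology of the Alexandrov extension and measurability of kernels -/

section OnePointTopology

/-- The Alexandrov extension of a locally compact, second countable space is second countable. -/
theorem secondCountableTopology_onePoint (S : Type*) [TopologicalSpace S] [T2Space S]
    [LocallyCompactSpace S] [SecondCountableTopology S] :
    SecondCountableTopology (OnePoint S) := by
  obtain ⟨b, hbc, -, hb⟩ := TopologicalSpace.exists_countable_basis S
  let K : CompactExhaustion S := default
  have hB : TopologicalSpace.IsTopologicalBasis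
      ((fun s : Set S => ((↑) '' s : Set (OnePoint S))) '' b ∪
        range fun n => ((↑) '' (K n) : Set (OnePoint S))ᶜ) := by
    refine TopologicalSpace.isTopologicalBasis_of_isOpen_of_nhds ?_ ?_
    · rintro u (⟨s, hs, rfl⟩ | ⟨n, rfl⟩)
      · exact OnePoint.isOpenEmbedding_coe.isOpenMap _ (hb.isOpen hs)
      · exact ((K.isCompact n).image OnePoint.continuous_coe).isClosed.isOpen_compl
    · intro a u ha hu
      induction a with
      | infty =>
        obtain ⟨n, hn⟩ := K.exists_superset_of_isCompact ((OnePoint.isOpen_iff_of_mem ha).1 hu).2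
        refine ⟨_, .inr ⟨n, rfl⟩, by simp, fun z hz => ?_⟩
        induction z with
        | infty => exact ha
        | coe x =>
          by_contra hx
          exact hz ⟨x, hn hx, rfl⟩
      | coe x =>
        obtain ⟨s, hs, hxs, hsu⟩ := hb.exists_subset_of_mem_open
          (show x ∈ ((↑) : S → OnePoint S) ⁻¹' u from ha) (hu.preimage OnePoint.continuous_coe)
        exact ⟨_, .inl ⟨s, hs, rfl⟩, ⟨x, hxs, rfl⟩, by rintro _ ⟨y, hy, rfl⟩; exact hsu hy⟩
  exact hB.secondCountableTopology ((hbc.image _).union (countable_range _))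

/-- The closed sets form a generating π-system, and their indicators are limits of continuous
functions. -/
theorem measurable_measure_of_measurable_integral {α Z : Type*} {mα : MeasurableSpace α}
    [TopologicalSpace Z] [CompactSpace Z] [HasOuterApproxClosed Z] [MeasurableSpace Z]
    [BorelSpace Z] {κ : α → Measure Z} [∀ a, IsProbabilityMeasure (κ a)]
    (h : ∀ f : C(Z, ℝ), Measurable fun a => ∫ z, f z ∂(κ a)) : Measurable κ := by
  refine Measurable.measure_of_isPiSystem_of_isProbabilityMeasure
    ((BorelSpace.measurable_eq (α := Z)).trans borel_eq_generateFrom_isClosed) isPiSystem_isClosed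
    fun s hs => ?_
  have hs' : IsClosed s := hs
  refine measurable_of_tendsto_metrizable (f := fun n a => ∫⁻ z, (hs'.apprSeq n z : ℝ≥0∞) ∂(κ a))
    (fun n => ?_) (tendsto_pi_nhds.2 fun a =>
      HasOuterApproxClosed.tendsto_lintegral_apprSeq hs' (κ a))
  let f : C(Z, ℝ) := ⟨fun z => (hs'.apprSeq n z : ℝ), by fun_prop⟩
  have hf : ∀ a, ∫⁻ z, (hs'.apprSeq n z : ℝ≥0∞) ∂(κ a) = ENNReal.ofReal (∫ z, f z ∂(κ a)) := by
    intro a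
    rw [ofReal_integral_eq_lintegral_ofReal]
    · refine lintegral_congr fun z => ?_
      exact (ENNReal.ofReal_coe_nnreal).symm
    · exact .of_bound f.continuous.measurable.aestronglyMeasurable ‖f‖
        (ae_of_all _ f.norm_coe_le_norm)
    · exact ae_of_all _ fun z => NNReal.coe_nonneg _
  simp only [hf]
  exact (h f).ennreal_ofReal

end OnePointTopology

/-! ### The exponentials f_{iy} and measures on E_Δ -/

section Exponentials

variable {V : Type*} [NormedAddCommGroup V] [InnerProductSpace ℝ V]

theorem norm_exp_pairing (u : V × V) (x : V) :
    ‖Complex.exp (pairing u x)‖ = Real.exp (inner ℝ u.1 x) := by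
  rw [Complex.norm_exp]
  simp [pairing]

theorem continuous_pairing : Continuous fun p : (V × V) × V => pairing p.1 p.2 := by
  unfold pairing
  fun_prop

theorem pairing_add (u v : V × V) (x : V) : pairing (u + v) x = pairing u x + pairing v x := by
  simp only [pairing, Prod.fst_add, Prod.snd_add, inner_add_left]
  push_cast
  ring

theorem pairing_sub (u v : V × V) (x : V) : pairing (u - v) x = pairing u x - pairing v x := by
  simp only [pairing, Prod.fst_sub, Prod.snd_sub, inner_sub_left]
  push_cast
  ring

theorem pairing_sub_right (u : V × V) (x x' : V) :
    pairing u (x - x') = pairing u x - pairing u x' := by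
  simp only [pairing, inner_sub_right]
  push_cast
  ring

variable {E : Set V}

@[simp] theorem expFun_infty (u : V × V) : expFun E u OnePoint.infty = 0 := rfl

@[simp] theorem expFun_coe (u : V × V) (x : E) :
    expFun E u (x : OnePoint E) = Complex.exp (pairing u (x : V)) := rfl

theorem imag_mem_setUk (y : V) : ((0 : V), y) ∈ setUk E 1 := fun x _ => by
  simp [norm_exp_pairing]

theorem setUk_subset_setU (k : ℕ) : setUk E k ⊆ setU E := fun _ h => ⟨k, h⟩

theorem setUk_mono {k l : ℕ} (h : k ≤ l) : setUk E k ⊆ setUk E l := fun _ hu x hx =>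
  (hu x hx).trans (by exact_mod_cast h)

theorem exists_mem_setUk {u : V × V} (hu : u ∈ setU E) : ∃ k, u ∈ setUk E k := by
  obtain ⟨C, hC⟩ := hu
  obtain ⟨k, hk⟩ := exists_nat_ge C
  exact ⟨k, fun x hx => (hC x hx).trans hk⟩

theorem continuousOn_expFun (u : V × V) : ContinuousOn (expFun E u) {OnePoint.infty}ᶜ := by
  intro z hz
  induction z with
  | infty => exact absurd rfl hz
  | coe x =>
    refine (OnePoint.continuousAt_coe.2 ?_).continuousWithinAt
    have : expFun E u ∘ OnePoint.some = fun x : E => Complex.exp (pairing u (x : V)) := rfl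
    rw [this]
    exact (Complex.continuous_exp.comp (continuous_pairing.comp
      (continuous_const.prodMk continuous_subtype_val))).continuousAt

theorem measurable_expFun (u : V × V) : Measurable (expFun E u) :=
  measurable_of_continuousOn_compl_singleton OnePoint.infty (continuousOn_expFun u)

theorem norm_expFun_le {k : ℕ} {u : V × V} (hu : u ∈ setUk E k) (z : OnePoint E) :
    ‖expFun E u z‖ ≤ k := by
  induction z with
  | infty => simp
  | coe x => exact hu x x.2

theorem norm_expFun_imag_le (y : V) (z : OnePoint E) : ‖expFun E (0, y) z‖ ≤ 1 := by
  simpa using norm_expFun_le (imag_mem_setUk y) z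

theorem expFun_zero_coe (x : E) : expFun E ((0 : V), (0 : V)) (x : OnePoint E) = 1 := by
  simp [pairing]

/-- The map from `E_Δ` to `V` which sends `Δ` to `0`. -/
def toSpace (E : Set V) : OnePoint E → V
  | OnePoint.infty => 0
  | OnePoint.some x => x

omit [InnerProductSpace ℝ V] in
theorem measurable_toSpace [MeasurableSpace V] [BorelSpace V] : Measurable (toSpace E) := by
  refine measurable_of_continuousOn_compl_singleton OnePoint.infty fun z hz => ?_
  induction z with
  | infty => exact absurd rfl hz
  | coe x =>
    refine (OnePoint.continuousAt_coe.2 ?_).continuousWithinAt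
    have : toSpace E ∘ OnePoint.some = fun x : E => (x : V) := rfl
    rw [this]
    exact continuous_subtype_val.continuousAt

/-- Since f_0 is the indicator of E, the total mass minus ∫ f_0 is the mass of Δ, which the map
sends to 0, where the character takes the value 1. -/
theorem charFun_map_toSpace [MeasurableSpace V] [BorelSpace V] (μ : Measure (OnePoint E))
    [IsFiniteMeasure μ] (y : V) :
    charFun (μ.map (toSpace E)) y = ∫ z, expFun E (0, y) z ∂μ + μ.real univ -
      ∫ z, expFun E (0, 0) z ∂μ := by
  have hi : ∀ y, Integrable (expFun E (0, y)) μ := fun y =>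
    .of_bound (measurable_expFun _).aestronglyMeasurable 1 (ae_of_all _ (norm_expFun_imag_le y))
  have h1 : (μ.real univ : ℂ) = ∫ _z : OnePoint E, (1 : ℂ) ∂μ := by simp
  have h2 : Integrable (fun z => expFun E (0, y) z + 1) μ := (hi y).add (integrable_const _)
  rw [charFun_apply, integral_map measurable_toSpace.aemeasurable
    (by fun_prop), h1, ← integral_add (hi y) (integrable_const _), ← integral_sub h2 (hi 0)]
  refine integral_congr_ae (ae_of_all _ fun z => ?_)
  induction z with
  | infty => simp [toSpace]
  | coe x => simp [toSpace, pairing, real_inner_comm]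

/-- `h` is a Tietze extension of f from the closed set E to V. As Δ is sent to 0, which may lie in
E, the value at Δ is corrected by a multiple of the indicator of E and a constant. -/
theorem exists_continuousMap_eq (hE : IsClosed E) (f : C(OnePoint E, ℝ)) :
    ∃ (h : BoundedContinuousFunction V ℝ) (a b : ℝ), ∀ z,
      f z = h (toSpace E z) + a * (expFun E (0, 0) z).re + b := by
  let g : BoundedContinuousFunction E ℝ := BoundedContinuousFunction.ofNormedAddCommGroup
    (fun x : E => f (x : OnePoint E)) (f.continuous.comp OnePoint.continuous_coe) ‖f‖
    fun x => f.norm_coe_le_norm _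
  obtain ⟨h, -, hh⟩ := BoundedContinuousFunction.exists_extension_norm_eq_of_isClosedEmbedding g
    hE.isClosedEmbedding_subtypeVal
  have hh' : ∀ x : E, h x = f (x : OnePoint E) := fun x => congrFun hh x
  refine ⟨h, h 0 - f OnePoint.infty, f OnePoint.infty - h 0, fun z => ?_⟩
  induction z with
  | infty => simp [toSpace]
  | coe x => simp [toSpace, hh', pairing, add_assoc]

theorem integral_eq_of_decomposition [MeasurableSpace V] [BorelSpace V] {f : C(OnePoint E, ℝ)}
    {h : BoundedContinuousFunction V ℝ} {a b : ℝ}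
    (hf : ∀ z, f z = h (toSpace E z) + a * (expFun E (0, 0) z).re + b)
    (μ : Measure (OnePoint E)) [IsFiniteMeasure μ] :
    ∫ z, f z ∂μ = ∫ v, h v ∂(μ.map (toSpace E)) + a * (∫ z, expFun E (0, 0) z ∂μ).re +
      b * μ.real univ := by
  have hi : Integrable (expFun E (0, 0)) μ :=
    .of_bound (measurable_expFun _).aestronglyMeasurable 1 (ae_of_all _ (norm_expFun_imag_le 0))
  have h1 : Integrable (fun z => h (toSpace E z)) μ :=
    .of_bound (h.continuous.measurable.comp measurable_toSpace).aestronglyMeasurable ‖h‖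
      (ae_of_all _ fun z => h.norm_coe_le_norm _)
  have h2 : ∫ z, (expFun E (0, 0) z).re ∂μ = (∫ z, expFun E (0, 0) z ∂μ).re := integral_re hi
  have h3 : Integrable (fun z => (expFun E (0, 0) z).re) μ := hi.re
  have h4 : Integrable (fun z => h (toSpace E z) + a * (expFun E (0, 0) z).re) μ :=
    h1.add (h3.const_mul a)
  simp only [hf]
  rw [integral_add h4 (integrable_const _), integral_add h1 (h3.const_mul a),
    integral_map measurable_toSpace.aemeasurable h.continuous.measurable.aestronglyMeasurable,
    integral_const_mul, h2]
  simp [mul_comm]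

variable [FiniteDimensional ℝ V]

/-- The exponentials `f_{iy}` determine convergence in law on `E_Δ`. -/
theorem tendsto_integral_of_tendsto_expFun (hE : IsClosed E) {ι : Type*} {L : Filter ι}
    [L.IsCountablyGenerated] {μ : ι → Measure (OnePoint E)} {ν : Measure (OnePoint E)}
    (hμ : ∀ i, IsProbabilityMeasure (μ i)) (hν : IsProbabilityMeasure ν)
    (h : ∀ y, Tendsto (fun i => ∫ z, expFun E (0, y) z ∂(μ i)) L
      (𝓝 (∫ z, expFun E (0, y) z ∂ν))) (f : C(OnePoint E, ℝ)) :
    Tendsto (fun i => ∫ z, f z ∂(μ i)) L (𝓝 (∫ z, f z ∂ν)) := by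
  borelize V
  -- Along sequences, Lévy's continuity theorem applies to the images on V. The integrals of f_0,
  -- which measure the mass of E, converge as well and account for Δ.
  refine tendsto_of_seq_tendsto fun x hx => ?_
  obtain ⟨g, a, b, hg⟩ := exists_continuousMap_eq hE f
  let μ' : ℕ → ProbabilityMeasure V := fun n =>
    ⟨(μ (x n)).map (toSpace E), Measure.isProbabilityMeasure_map (measurable_toSpace.aemeasurable)⟩
  let ν' : ProbabilityMeasure V :=
    ⟨ν.map (toSpace E), Measure.isProbabilityMeasure_map measurable_toSpace.aemeasurable⟩
  have hμν : Tendsto μ' atTop (𝓝 ν') := by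
    refine ProbabilityMeasure.tendsto_iff_tendsto_charFun.2 fun y => ?_
    change Tendsto (fun n => charFun ((μ (x n)).map (toSpace E)) y) atTop
      (𝓝 (charFun (ν.map (toSpace E)) y))
    simp only [charFun_map_toSpace, probReal_univ]
    exact (((h y).comp hx).add tendsto_const_nhds).sub ((h 0).comp hx)
  have h1 := (ProbabilityMeasure.tendsto_iff_forall_integral_tendsto.1 hμν) g
  simp only [Function.comp_def, integral_eq_of_decomposition hg, probReal_univ]
  exact (h1.add (tendsto_const_nhds.mul
    ((Complex.continuous_re.tendsto _).comp ((h 0).comp hx)))).add tendsto_const_nhds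

/-- The exponentials `f_{iy}` and the total mass determine a finite measure on `E_Δ`. -/
theorem measure_ext_of_expFun [HasOuterApproxClosed (OnePoint E)] (hE : IsClosed E)
    (ν₁ ν₂ : Measure (OnePoint E)) [IsFiniteMeasure ν₁]
    [IsFiniteMeasure ν₂] (hu : ν₁ univ = ν₂ univ)
    (h : ∀ y, ∫ z, expFun E (0, y) z ∂ν₁ = ∫ z, expFun E (0, y) z ∂ν₂) : ν₁ = ν₂ := by
  borelize V
  have hu' : ν₁.real univ = ν₂.real univ := by rw [Measure.real, Measure.real, hu]
  have hmap : ν₁.map (toSpace E) = ν₂.map (toSpace E) := by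
    refine Measure.ext_of_charFun (funext fun y => ?_)
    rw [charFun_map_toSpace, charFun_map_toSpace, h, h, hu']
  refine ext_of_forall_integral_eq_of_IsFiniteMeasure fun f => ?_
  obtain ⟨g, a, b, hg⟩ := exists_continuousMap_eq hE f.toContinuousMap
  have h1 := integral_eq_of_decomposition hg ν₁
  have h2 := integral_eq_of_decomposition hg ν₂
  rw [hmap, h, hu'] at h1
  exact h1.trans h2.symm

end Exponentials

/-! ### Continuous logarithms of 1, and affine spanning -/

section Generalities

/-- The values of `g` lie in 2πiℤ. If g(1) ≠ 0, the modulus of `g` would by continuity take the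
value π, which is not a multiple of 2π. -/
theorem eq_zero_of_exp_eq_one {g : ℝ → ℂ} (hg : ContinuousOn g (Icc 0 1)) (h0 : g 0 = 0)
    (h1 : ∀ s ∈ Icc (0 : ℝ) 1, Complex.exp (g s) = 1) : g 1 = 0 := by
  have hn : ∀ s ∈ Icc (0 : ℝ) 1, ∃ n : ℤ, ‖g s‖ = |(n : ℝ)| * (2 * Real.pi) ∧
      (n = 0 → g s = 0) := by
    intro s hs
    obtain ⟨n, hn⟩ := Complex.exp_eq_one_iff.1 (h1 s hs)
    refine ⟨n, ?_, fun h => by simp [hn, h]⟩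
    rw [hn]
    simp [abs_of_pos Real.pi_pos]
  obtain ⟨n, hn1, hn0⟩ := hn 1 (by simp)
  by_contra hne
  have hn' : n ≠ 0 := fun h => hne (hn0 h)
  have h1n : (1 : ℝ) ≤ |(n : ℝ)| := by exact_mod_cast Int.one_le_abs hn'
  have hpi : Real.pi ∈ Icc ‖g 0‖ ‖g 1‖ := by
    rw [h0, hn1, norm_zero]
    exact ⟨Real.pi_pos.le, by nlinarith [Real.pi_pos]⟩
  obtain ⟨s, hs, hsπ⟩ := intermediate_value_Icc zero_le_one hg.norm hpi
  obtain ⟨m, hm, -⟩ := hn s hs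
  have h2 : |(m : ℝ)| * 2 = 1 := by
    have : ‖g s‖ = Real.pi := hsπ
    rw [this] at hm
    have := Real.pi_pos
    field_simp at hm
    linarith
  have h3 : |m| * 2 = 1 := by exact_mod_cast h2
  omega

theorem IsMarkovProcess.transition_self {S Ω : Type*} [TopologicalSpace S] {mΩ : MeasurableSpace Ω}
    {F : Filtration ℝ≥0 mΩ} {X : ℝ≥0 → Ω → OnePoint S} {Pr : ℝ≥0 → OnePoint S → Measure Ω}
    (hX : IsMarkovProcess F X Pr) [T2Space (OnePoint S)] (t : ℝ≥0) (x : OnePoint S) :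
    transition X Pr t t x = Measure.dirac x := by
  have := hX.isProbabilityMeasure t x
  have h : X 0 =ᵐ[Pr t x] fun _ => x := hX.ae_start t x
  rw [transition_of_le le_rfl, Measure.map_congr h, Measure.map_const, measure_univ, one_smul]

variable {V : Type*} [NormedAddCommGroup V] [InnerProductSpace ℝ V]

/-- The differences of d + 1 affinely independent points span V, so `a` is orthogonal to itself. -/
theorem eq_zero_of_inner_sub_eq_zero [FiniteDimensional ℝ V] {E : Set V}
    (hEbasis : ∃ e : Fin (Module.finrank ℝ V + 1) → V, (∀ i, e i ∈ E) ∧ AffineIndependent ℝ e)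
    {a : V} (ha : ∀ x ∈ E, ∀ x' ∈ E, inner ℝ a (x - x') = 0) : a = 0 := by
  obtain ⟨e, heE, he⟩ := hEbasis
  have h1 : affineSpan ℝ (range e) = ⊤ :=
    he.affineSpan_eq_top_iff_card_eq_finrank_add_one.2 (by simp)
  have h2 : vectorSpan ℝ (range e) = ⊤ := by
    rw [← direction_affineSpan, h1, AffineSubspace.direction_top]
  have h3 : ∀ v ∈ vectorSpan ℝ (range e), inner ℝ a v = 0 := by
    intro v hv
    refine Submodule.span_induction ?_ (by simp) (fun v w _ _ hv hw => by
      rw [inner_add_right, hv, hw, add_zero]) (fun c v _ hv => by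
      rw [inner_smul_right, hv, mul_zero]) hv
    rintro _ ⟨_, ⟨i, rfl⟩, _, ⟨j, rfl⟩, rfl⟩
    exact ha _ (heE i) _ (heE j)
  exact inner_self_eq_zero.1 (h3 a (h2 ▸ Submodule.mem_top))

theorem pairing_eq_zero_iff {u : V × V} {x : V} :
    pairing u x = 0 ↔ inner ℝ u.1 x = 0 ∧ inner ℝ u.2 x = 0 := by
  rw [Complex.ext_iff]
  simp [pairing]

theorem expFun_eq_mul {E : Set V} (u : V × V) (z : OnePoint E) :
    expFun E u z = expFun E (0, 0) z * Complex.exp (pairing u (toSpace E z)) := by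
  induction z with
  | infty => simp
  | coe x => simp [pairing, toSpace]

theorem continuousOn_expFun_uncurry {E : Set V} :
    ContinuousOn (fun p : (V × V) × OnePoint E => expFun E p.1 p.2) (univ ×ˢ {OnePoint.infty}ᶜ) := by
  have h1 : ContinuousOn (toSpace E) {OnePoint.infty}ᶜ := by
    intro z hz
    induction z with
    | infty => exact absurd rfl hz
    | coe x =>
      refine (OnePoint.continuousAt_coe.2 ?_).continuousWithinAt
      have : toSpace E ∘ OnePoint.some = fun x : E => (x : V) := rfl
      rw [this]
      exact continuous_subtype_val.continuousAt
  have hmaps : MapsTo (Prod.snd : (V × V) × OnePoint E → OnePoint E) (univ ×ˢ {OnePoint.infty}ᶜ)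
    {OnePoint.infty}ᶜ := fun p hp => hp.2
  refine (((continuousOn_expFun (0, 0)).comp continuousOn_snd hmaps).mul
    (Complex.continuous_exp.comp_continuousOn (continuous_pairing.comp_continuousOn
      (continuousOn_fst.prodMk (h1.comp continuousOn_snd hmaps))))).congr fun p _ => ?_
  exact expFun_eq_mul p.1 p.2

end Generalities

/-! ### Behaviour of Φ and ψ on and near the diagonal -/

section Affine

variable {V : Type*} [NormedAddCommGroup V] [InnerProductSpace ℝ V]
  [FiniteDimensional ℝ V] {E : Set V} (hE : IsClosed E)
  (hEbasis : ∃ e : Fin (Module.finrank ℝ V + 1) → V, (∀ i, e i ∈ E) ∧ AffineIndependent ℝ e)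
  {Ω : Type*} {mΩ : MeasurableSpace Ω} {F : Filtration ℝ≥0 mΩ}
  {X : ℝ≥0 → Ω → OnePoint E} {Pr : ℝ≥0 → OnePoint E → Measure Ω}
  (hX : IsMarkovProcess F X Pr)
  {Φ : ℝ≥0 → ℝ≥0 → V × V → ℂ} {ψ : ℝ≥0 → ℝ≥0 → V × V → V × V}
  (hA : IsAffineWith E (transition X Pr) Φ ψ)

include hE in
theorem t2Space_onePoint : T2Space (OnePoint E) :=
  have := FiniteDimensional.proper_real V
  have := hE.locallyCompactSpace
  inferInstance

include hE in
theorem secondCountableTopology_onePoint_subtype : SecondCountableTopology (OnePoint E) :=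
  have := FiniteDimensional.proper_real V
  have := hE.locallyCompactSpace
  secondCountableTopology_onePoint E

omit [FiniteDimensional ℝ V] in
include hX hA in
-- Both sides vanish at Δ, so the affine formula extends to all of E_Δ.
theorem integral_expFun [T2Space (OnePoint E)] {t T : ℝ≥0} (h : t ≤ T) {u : V × V}
    (hu : u ∈ setU E) (x : OnePoint E) :
    ∫ z, expFun E u z ∂(transition X Pr t T x) = Φ t T u * expFun E (ψ t T u) x := by
  induction x with
  | infty => rw [hX.transition_infty, integral_dirac]; simp
  | coe x => exact hA t T h u hu x

omit [FiniteDimensional ℝ V] in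
include hX hA in
theorem mul_exp_self [T2Space (OnePoint E)] (T : ℝ≥0) {u : V × V} (hu : u ∈ setU E) {x : V}
    (hx : x ∈ E) :
    Φ T T u * Complex.exp (pairing (ψ T T u) x) = Complex.exp (pairing u x) := by
  have := hA T T le_rfl u hu ⟨x, hx⟩
  rw [hX.transition_self, integral_dirac] at this
  exact this.symm

omit [FiniteDimensional ℝ V] in
include hX hA in
theorem mem_setQk_self [T2Space (OnePoint E)] (hne : E.Nonempty) (T : ℝ≥0) {k : ℕ} {u : V × V}
    (hu : u ∈ setUk E k) : (T, T, u) ∈ setQk E Φ k := by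
  obtain ⟨x, hx⟩ := hne
  refine ⟨⟨le_rfl, hu⟩, fun v hv hv' h => ?_⟩
  obtain rfl : T = v := le_antisymm hv hv'
  have := mul_exp_self hX hA T (setUk_subset_setU k hu) hx
  rw [show Φ T T u = 0 from h, zero_mul] at this
  exact Complex.exp_ne_zero _ this.symm

variable (hψ0 : ψ 0 0 0 = 0)
  (hψc : ∀ k, ContinuousOn (fun p : ℝ≥0 × ℝ≥0 × V × V => ψ p.1 p.2.1 p.2.2) (setQk E Φ k))

include hEbasis in
omit [FiniteDimensional ℝ V] in
theorem nonempty_of_affineIndependent : E.Nonempty :=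
  let ⟨e, he, _⟩ := hEbasis
  ⟨e 0, he 0⟩

include hEbasis hX hA hψ0 hψc in
-- P_{T,T} is the identity, which determines ψ_{T,T}(u) - u on differences of points of E only
-- modulo 2πiℤ. Along the path s ↦ (sT, sT, su) this ambiguity is constant by continuity, and it is
-- 0 at s = 0; the differences of points of E span V.
theorem psi_self [T2Space (OnePoint E)] (T : ℝ≥0) {u : V × V} (hu : u ∈ setU E) :
    ψ T T u = u := by
  obtain ⟨k, hk⟩ := exists_mem_setUk hu
  -- A bound l ≥ 1 survives the scaling of u by s ∈ [0,1], since l^s ≤ l.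
  have hk := setUk_mono (le_max_left k 1) hk
  set l := max k 1
  have hl1 : (1 : ℝ) ≤ l := by exact_mod_cast le_max_right k 1
  have hne := nonempty_of_affineIndependent hEbasis
  have hsu : ∀ s ∈ Icc (0 : ℝ) 1, s • u ∈ setUk E l := by
    intro s hs x hx
    have h1 := hk x hx
    rw [norm_exp_pairing] at h1 ⊢
    rw [Prod.smul_fst, real_inner_smul_left, mul_comm, Real.exp_mul]
    calc Real.exp (inner ℝ u.1 x) ^ s ≤ (l : ℝ) ^ s :=
          Real.rpow_le_rpow (Real.exp_pos _).le h1 hs.1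
      _ ≤ (l : ℝ) ^ (1 : ℝ) := Real.rpow_le_rpow_of_exponent_le hl1 hs.2
      _ = l := Real.rpow_one _
  let γ : ℝ → ℝ≥0 × ℝ≥0 × V × V := fun s => (s.toNNReal * T, s.toNNReal * T, s • u)
  have hγ : Continuous γ := by
    have := continuous_real_toNNReal
    fun_prop
  have hγQ : MapsTo γ (Icc 0 1) (setQk E Φ l) := fun s hs =>
    mem_setQk_self hX hA hne _ (hsu s hs)
  have key : ∀ x ∈ E, ∀ x' ∈ E, pairing (ψ T T u - u) (x - x') = 0 := by
    intro x hx x' hx'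
    have := eq_zero_of_exp_eq_one (g := fun s => pairing
      (ψ (s.toNNReal * T) (s.toNNReal * T) (s • u) - s • u) (x - x')) ?_ ?_ ?_
    · simpa using this
    · have h1 : ContinuousOn (fun s => ψ (γ s).1 (γ s).2.1 (γ s).2.2) (Icc 0 1) :=
        (hψc l).comp hγ.continuousOn hγQ
      have h2 : ContinuousOn (fun s : ℝ => s • u) (Icc 0 1) := by fun_prop
      exact continuous_pairing.comp_continuousOn ((h1.sub h2).prodMk continuousOn_const)
    · simp [hψ0, pairing]
    · intro s hs
      have h1 := mul_exp_self hX hA (s.toNNReal * T) (setUk_subset_setU l (hsu s hs)) hx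
      have h2 := mul_exp_self hX hA (s.toNNReal * T) (setUk_subset_setU l (hsu s hs)) hx'
      set w := ψ (s.toNNReal * T) (s.toNNReal * T) (s • u)
      set c := Φ (s.toNNReal * T) (s.toNNReal * T) (s • u)
      have hc : c ≠ 0 := fun h => by
        rw [h, zero_mul] at h1
        exact Complex.exp_ne_zero _ h1.symm
      rw [pairing_sub_right, pairing_sub, pairing_sub, Complex.exp_sub, Complex.exp_sub,
        Complex.exp_sub, ← h1, ← h2]
      field_simp [Complex.exp_ne_zero]
  have h1 := eq_zero_of_inner_sub_eq_zero hEbasis (a := (ψ T T u - u).1) fun x hx x' hx' =>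
    (pairing_eq_zero_iff.1 (key x hx x' hx')).1
  have h2 := eq_zero_of_inner_sub_eq_zero hEbasis (a := (ψ T T u - u).2) fun x hx x' hx' =>
    (pairing_eq_zero_iff.1 (key x hx x' hx')).2
  exact sub_eq_zero.1 (Prod.ext h1 h2)

variable
  (hΦc : ∀ k, ContinuousOn (fun p : ℝ≥0 × ℝ≥0 × V × V => Φ p.1 p.2.1 p.2.2) (setDk E k))

include hEbasis hX hA hψ0 hψc hΦc in
-- On the diagonal Φ is nonzero and ψ is the identity; compactness of `K` makes the neighbourhood
-- uniform in u. A ball of times is an interval, so it contains all the intermediate times which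
-- enter the definition of 𝓠_k.
theorem exists_forall_mem_setQk [T2Space (OnePoint E)] (t₀ : ℝ≥0) {k : ℕ} {K : Set (V × V)}
    (hK : IsCompact K) (hKU : K ⊆ setUk E k) {ε : ℝ} (hε : 0 < ε) :
    ∃ δ > 0, ∀ t ∈ Metric.closedBall t₀ δ, ∀ T ∈ Metric.closedBall t₀ δ, t ≤ T → ∀ u ∈ K,
      (t, T, u) ∈ setQk E Φ k ∧ ‖ψ t T u - u‖ ≤ ε := by
  have hne := nonempty_of_affineIndependent hEbasis
  let m : (ℝ≥0 × ℝ≥0) × V × V → ℝ≥0 × ℝ≥0 × V × V := fun z => (z.1.1, z.1.2, z.2)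
  have hm : Continuous m := by fun_prop
  have hQ0 : ∀ u ∈ K, (t₀, t₀, u) ∈ setQk E Φ k := fun u hu =>
    mem_setQk_self hX hA hne t₀ (hKU hu)
  have h1 : ∀ᶠ q : ℝ≥0 × ℝ≥0 in 𝓝 (t₀, t₀), ∀ u ∈ K, q.1 ≤ q.2 → u ∈ setUk E k →
      Φ q.1 q.2 u ≠ 0 := by
    refine hK.eventually_forall_of_forall_eventually fun u hu => ?_
    have hc := ((hΦc k) (t₀, t₀, u) (hQ0 u hu).1).eventually_ne ((hQ0 u hu).2 t₀ le_rfl le_rfl)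
    rw [eventually_nhdsWithin_iff] at hc
    filter_upwards [(hm.tendsto ((t₀, t₀), u)).eventually hc] with z hz hle hzu
    exact hz ⟨hle, hzu⟩
  obtain ⟨δ₁, hδ₁, hb1⟩ := Metric.nhds_basis_closedBall.eventually_iff.1 h1
  have hQ : ∀ t ∈ Metric.closedBall t₀ δ₁, ∀ T ∈ Metric.closedBall t₀ δ₁, t ≤ T → ∀ u ∈ K,
      (t, T, u) ∈ setQk E Φ k := by
    intro t ht T hT htT u hu
    refine ⟨⟨htT, hKU hu⟩, fun v hv hv' => hb1 (x := (v, T)) ?_ u hu hv' (hKU hu)⟩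
    rw [← closedBall_prod_same]
    refine ⟨?_, hT⟩
    rw [Metric.mem_closedBall, NNReal.dist_eq] at ht hT ⊢
    have h1 : (t : ℝ) ≤ v := hv
    have h2 : (v : ℝ) ≤ T := hv'
    rw [abs_le] at ht hT ⊢
    constructor <;> linarith [ht.1, hT.2]
  have h2 : ∀ᶠ q : ℝ≥0 × ℝ≥0 in 𝓝 (t₀, t₀), ∀ u ∈ K, (q.1, q.2, u) ∈ setQk E Φ k →
      ‖ψ q.1 q.2 u - u‖ < ε := by
    refine hK.eventually_forall_of_forall_eventually fun u hu => ?_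
    have hc : ContinuousWithinAt (fun p : ℝ≥0 × ℝ≥0 × V × V => ‖ψ p.1 p.2.1 p.2.2 - p.2.2‖)
        (setQk E Φ k) (t₀, t₀, u) :=
      (((hψc k) (t₀, t₀, u) (hQ0 u hu)).sub (by fun_prop)).norm
    have h0 : ‖ψ t₀ t₀ u - u‖ < ε := by
      rw [psi_self hEbasis hX hA hψ0 hψc t₀ (setUk_subset_setU k (hKU hu)), sub_self, norm_zero]
      exact hε
    have hc := hc.tendsto.eventually (gt_mem_nhds h0)
    rw [eventually_nhdsWithin_iff] at hc
    filter_upwards [(hm.tendsto ((t₀, t₀), u)).eventually hc] with z hz hzQ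
    exact hz hzQ
  obtain ⟨δ₂, hδ₂, hb2⟩ := Metric.nhds_basis_closedBall.eventually_iff.1 h2
  refine ⟨min δ₁ δ₂, lt_min hδ₁ hδ₂, fun t ht T hT htT u hu => ?_⟩
  have hq := hQ t (Metric.closedBall_subset_closedBall (min_le_left _ _) ht) T
    (Metric.closedBall_subset_closedBall (min_le_left _ _) hT) htT u hu
  refine ⟨hq, (hb2 (x := (t, T)) ?_ u hu hq).le⟩
  rw [← closedBall_prod_same]
  exact ⟨Metric.closedBall_subset_closedBall (min_le_right _ _) ht,
    Metric.closedBall_subset_closedBall (min_le_right _ _) hT⟩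

end Affine

/-! ### Measurability and continuity of the affine transition function -/

section AffineRegularity

variable {V : Type*} [NormedAddCommGroup V] [InnerProductSpace ℝ V]
  [FiniteDimensional ℝ V] {E : Set V} (hE : IsClosed E)
  (hEbasis : ∃ e : Fin (Module.finrank ℝ V + 1) → V, (∀ i, e i ∈ E) ∧ AffineIndependent ℝ e)
  {Ω : Type*} {mΩ : MeasurableSpace Ω} {F : Filtration ℝ≥0 mΩ}
  {X : ℝ≥0 → Ω → OnePoint E} {Pr : ℝ≥0 → OnePoint E → Measure Ω}
  (hX : IsMarkovProcess F X Pr)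
  {Φ : ℝ≥0 → ℝ≥0 → V × V → ℂ} {ψ : ℝ≥0 → ℝ≥0 → V × V → V × V}
  (hA : IsAffineWith E (transition X Pr) Φ ψ)
  (hψc : ∀ k, ContinuousOn (fun p : ℝ≥0 × ℝ≥0 × V × V => ψ p.1 p.2.1 p.2.2) (setQk E Φ k))
  (hΦc : ∀ k, ContinuousOn (fun p : ℝ≥0 × ℝ≥0 × V × V => Φ p.1 p.2.1 p.2.2) (setDk E k))
  (hPc : ∀ (x : E) k, ContinuousOn
      (fun p : ℝ≥0 × ℝ≥0 × V × V =>
        ∫ y, expFun E p.2.2 y ∂(transition X Pr p.1 p.2.1 (x : OnePoint E))) (setDk E k))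

include hE hX hPc in
-- A Carathéodory argument: P_{s,t}f(x) is continuous in (s,t) by convergence of the characteristic
-- functions, and measurable in x.
theorem measurable_uncurry_transition :
    Measurable fun p : ℝ≥0 × ℝ≥0 × OnePoint E => transition X Pr p.1 p.2.1 p.2.2 := by
  have := t2Space_onePoint hE
  have := secondCountableTopology_onePoint_subtype hE
  have hp : ∀ p : ℝ≥0 × ℝ≥0 × OnePoint E, IsProbabilityMeasure (transition X Pr p.1 p.2.1 p.2.2) :=
    fun p => hX.isProbabilityMeasure_transition _ _ _
  -- Truncated subtraction gives P_{s,t} = P_{s,s} for t < s, which extends the transition function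
  -- continuously to all pairs of times.
  have hmax : ∀ s t x, transition X Pr s t x = transition X Pr s (max s t) x := fun s t x => by
    rw [transition, transition]
    congr 2
    rcases le_total s t with h | h
    · rw [max_eq_right h]
    · rw [max_eq_left h, tsub_self, tsub_eq_zero_of_le h]
  refine measurable_measure_of_measurable_integral fun f => ?_
  have h := measurable_uncurry_of_continuous_of_measurable
    (u := fun (q : ℝ≥0 × ℝ≥0) x => ∫ z, f z ∂(transition X Pr q.1 q.2 x)) (fun x => ?_)
    (fun q => hX.measurable_integral_transition f.continuous.measurable q.1 q.2)
  · exact h.comp (g := Function.uncurry _) (f := fun p : ℝ≥0 × ℝ≥0 × OnePoint E =>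
      ((p.1, p.2.1), p.2.2)) (by fun_prop)
  · induction x with
    | infty =>
      simp only [hX.transition_infty]
      exact continuous_const
    | coe x =>
      refine continuous_iff_continuousAt.2 fun q => ?_
      refine tendsto_integral_of_tendsto_expFun hE
        (fun q => hX.isProbabilityMeasure_transition _ _ _)
        (hX.isProbabilityMeasure_transition _ _ _) (fun y => ?_) f
      have hc : Continuous fun q : ℝ≥0 × ℝ≥0 =>
          ∫ z, expFun E (0, y) z ∂(transition X Pr q.1 q.2 (x : OnePoint E)) := by
        simp only [fun q : ℝ≥0 × ℝ≥0 => hmax q.1 q.2]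
        exact (hPc x 1).comp_continuous
          (f := fun q : ℝ≥0 × ℝ≥0 => (q.1, max q.1 q.2, (0 : V), y)) (by fun_prop)
          fun q => ⟨le_max_left _ _, imag_mem_setUk y⟩
      exact hc.tendsto q

variable (hψ0 : ψ 0 0 0 = 0)

include hE hEbasis hX hA hψ0 hψc hΦc in
-- For x in E, the integrals of f_{iy} are given by the affine formula, whose ingredients are
-- continuous at the diagonal since ψ_{t,t} is the identity. This determines convergence in law.
theorem tendsto_integral_diagonal_coe (f : C(OnePoint E, ℝ)) (t : ℝ≥0) (x : E) :
    Tendsto (fun p : ℝ≥0 × ℝ≥0 × OnePoint E => ∫ y, f y ∂(transition X Pr p.1 p.2.1 p.2.2))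
      (𝓝[{p | p.1 ≤ p.2.1}] (t, t, (x : OnePoint E))) (𝓝 (f x)) := by
  have := t2Space_onePoint hE
  have := secondCountableTopology_onePoint_subtype hE
  have h := tendsto_integral_of_tendsto_expFun hE (ν := Measure.dirac (x : OnePoint E))
    (L := 𝓝[{p : ℝ≥0 × ℝ≥0 × OnePoint E | p.1 ≤ p.2.1}] (t, t, (x : OnePoint E)))
    (μ := fun p => transition X Pr p.1 p.2.1 p.2.2)
    (fun q => hX.isProbabilityMeasure_transition _ _ _) inferInstance (fun y => ?_) f
  · simpa using h
  have hu := imag_mem_setUk (E := E) y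
  have hU := setUk_subset_setU 1 hu
  set L := 𝓝[{p : ℝ≥0 × ℝ≥0 × OnePoint E | p.1 ≤ p.2.1}] (t, t, (x : OnePoint E))
  have hle : ∀ᶠ p in L, p.1 ≤ p.2.1 := self_mem_nhdsWithin
  have h1 : Tendsto (fun p : ℝ≥0 × ℝ≥0 × OnePoint E => p.1) L (𝓝 t) :=
    (continuous_fst.tendsto _).mono_left nhdsWithin_le_nhds
  have h2 : Tendsto (fun p : ℝ≥0 × ℝ≥0 × OnePoint E => p.2.1) L (𝓝 t) :=
    ((continuous_fst.comp continuous_snd).tendsto _).mono_left nhdsWithin_le_nhds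
  have h3 : Tendsto (fun p : ℝ≥0 × ℝ≥0 × OnePoint E => p.2.2) L (𝓝 (x : OnePoint E)) :=
    ((continuous_snd.comp continuous_snd).tendsto _).mono_left nhdsWithin_le_nhds
  have hψ : Tendsto (fun p : ℝ≥0 × ℝ≥0 × OnePoint E => ψ p.1 p.2.1 (0, y)) L (𝓝 (0, y)) := by
    rw [Metric.nhds_basis_closedBall.tendsto_right_iff]
    intro ε hε
    obtain ⟨δ, hδ, h⟩ := exists_forall_mem_setQk hEbasis hX hA hψ0 hψc hΦc t
      (isCompact_singleton (x := ((0 : V), y))) (by simpa using hu) hε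
    filter_upwards [hle, h1.eventually (Metric.closedBall_mem_nhds t hδ),
      h2.eventually (Metric.closedBall_mem_nhds t hδ)] with p hp hp1 hp2
    rw [Metric.mem_closedBall, dist_eq_norm]
    exact (h _ hp1 _ hp2 hp _ rfl).2
  have hΦ : Tendsto (fun p : ℝ≥0 × ℝ≥0 × OnePoint E => Φ p.1 p.2.1 (0, y)) L
      (𝓝 (Φ t t (0, y))) := by
    refine ((hΦc 1) (t, t, (0, y)) ⟨le_rfl, hu⟩).tendsto.comp
      (f := fun p : ℝ≥0 × ℝ≥0 × OnePoint E => (p.1, p.2.1, (0, y)))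
      (tendsto_nhdsWithin_iff.2 ⟨h1.prodMk_nhds (h2.prodMk_nhds tendsto_const_nhds), ?_⟩)
    filter_upwards [hle] with p hp using ⟨hp, hu⟩
  have hx : (univ : Set (V × V)) ×ˢ {OnePoint.infty}ᶜ ∈ 𝓝 (((0 : V), y), (x : OnePoint E)) :=
    (isOpen_univ.prod isOpen_compl_singleton).mem_nhds ⟨mem_univ _, OnePoint.coe_ne_infty x⟩
  have hf := ((continuousOn_expFun_uncurry (E := E)).continuousAt hx).tendsto.comp
    (hψ.prodMk_nhds h3)
  have hlim := hΦ.mul hf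
  rw [← hX.transition_self t, integral_expFun hX hA le_rfl hU,
    psi_self hEbasis hX hA hψ0 hψc t hU]
  refine hlim.congr' ?_
  filter_upwards [hle] with p hp
  exact (integral_expFun hX hA hp hU p.2.2).symm

omit [FiniteDimensional ℝ V] in
include hX hA hψc hΦc in
/-- For every `y` and `d`, there is at most one time at which `(t, x) ↦ P_{t,d} f_{iy}(x)` fails to
be continuous. -/
theorem exists_tendsto_integral_expFun [T2Space (OnePoint E)] (y : V) (d : ℝ≥0) :
    ∃ t₀, ∀ t < d, t ≠ t₀ → ∀ z, z ≠ OnePoint.infty →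
      Tendsto (fun p : ℝ≥0 × OnePoint E => ∫ w, expFun E (0, y) w ∂(transition X Pr p.1 d p.2))
        (𝓝 (t, z)) (𝓝 (∫ w, expFun E (0, y) w ∂(transition X Pr t d z))) := by
  have hu := imag_mem_setUk (E := E) y
  have hU := setUk_subset_setU 1 hu
  set Z : Set ℝ≥0 := {v | v ≤ d ∧ Φ v d (0, y) = 0} with hZ
  have hcont : ContinuousOn (fun v => Φ v d (0, y)) (Iic d) :=
    (hΦc 1).comp (f := fun v : ℝ≥0 => (v, d, (0 : V), y)) (by fun_prop) fun v hv => ⟨hv, hu⟩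
  -- Past the last zero of v ↦ Φ_{v,d}(iy), the arguments lie in 𝓠_1, where ψ is continuous.
  have hgood : ∀ t < d, (∃ a < t, ∀ v, a < v → v ∉ Z) ∨ (∀ v, v ∉ Z) → ∀ z, z ≠ OnePoint.infty →
      Tendsto (fun p : ℝ≥0 × OnePoint E => ∫ w, expFun E (0, y) w ∂(transition X Pr p.1 d p.2))
        (𝓝 (t, z)) (𝓝 (∫ w, expFun E (0, y) w ∂(transition X Pr t d z))) := by
    intro t htd h z hz
    have hO : ∃ O : Set ℝ≥0, IsOpen O ∧ t ∈ O ∧ ∀ s ∈ O, s ≤ d ∧ (s, d, (0 : V), y) ∈ setQk E Φ 1 := by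
      rcases h with ⟨a, hat, ha⟩ | h
      · exact ⟨Ioo a d, isOpen_Ioo, ⟨hat, htd⟩, fun s hs => ⟨hs.2.le, ⟨hs.2.le, hu⟩,
          fun v hv hv' h0 => ha v (hs.1.trans_le hv) ⟨hv', h0⟩⟩⟩
      · exact ⟨Iio d, isOpen_Iio, htd, fun s hs => ⟨hs.le, ⟨hs.le, hu⟩,
          fun v hv hv' h0 => h v ⟨hv', h0⟩⟩⟩
    obtain ⟨O, hO, htO, hOs⟩ := hO
    have hψ : ContinuousOn (fun s => ψ s d (0, y)) O :=
      (hψc 1).comp (f := fun v : ℝ≥0 => (v, d, (0 : V), y)) (by fun_prop) fun v hv => (hOs v hv).2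
    have hW : O ×ˢ {OnePoint.infty}ᶜ ∈ 𝓝 (t, z) :=
      (hO.prod isOpen_compl_singleton).mem_nhds ⟨htO, hz⟩
    have hC : ContinuousOn (fun p : ℝ≥0 × OnePoint E => Φ p.1 d (0, y) *
        expFun E (ψ p.1 d (0, y)) p.2) (O ×ˢ {OnePoint.infty}ᶜ) := by
      refine (hcont.comp continuousOn_fst fun p hp => (hOs p.1 hp.1).1).mul
        (continuousOn_expFun_uncurry.comp (f := fun p : ℝ≥0 × OnePoint E =>
          (ψ p.1 d (0, y), p.2)) ?_ fun p hp => ⟨mem_univ _, hp.2⟩)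
      exact (hψ.comp continuousOn_fst fun p hp => hp.1).prodMk continuousOn_snd
    have hC' := (hC.continuousAt hW).tendsto
    dsimp only at hC'
    rw [integral_expFun hX hA htd.le hU]
    refine hC'.congr' ?_
    filter_upwards [hW] with p hp
    rw [integral_expFun hX hA (hOs p.1 hp.1).1 hU]
  rcases Z.eq_empty_or_nonempty with hZe | hZne
  · exact ⟨0, fun t htd _ => hgood t htd (.inr fun v => by simp [hZe])⟩
  have hZc : IsCompact Z := by
    have : Z = Icc 0 d ∩ (fun v => Φ v d (0, y)) ⁻¹' {0} := by
      ext v; simp [hZ]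
    rw [this]
    exact isCompact_Icc.of_isClosed_subset
      ((hcont.mono Icc_subset_Iic_self).preimage_isClosed_of_isClosed isClosed_Icc
        isClosed_singleton) inter_subset_left
  obtain ⟨ts, hts, hmax⟩ := hZc.exists_isGreatest hZne
  refine ⟨ts, fun t htd ht z hz => ?_⟩
  rcases lt_or_gt_of_ne ht with h | h
  -- Before the last zero `ts` the function is identically 0: P_{s,d}f_{iy} = P_{s,ts}P_{ts,d}f_{iy}
  -- and the inner factor vanishes.
  · have h0 : ∀ s < ts, ∀ x, ∫ w, expFun E (0, y) w ∂(transition X Pr s d x) = 0 := by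
      intro s hs x
      have h1 := hX.setIntegral_markov (measurable_expFun (0, y)) (norm_expFun_imag_le y) s x
        (s := ts - s) (t := d - s) (tsub_le_tsub_right hts.1 s) (A := univ) MeasurableSet.univ
      rw [add_tsub_cancel_of_le hs.le, add_tsub_cancel_of_le (hs.le.trans hts.1)] at h1
      simp only [integral_expFun hX hA hts.1 hU, hts.2, zero_mul, integral_zero,
        Measure.restrict_univ] at h1
      rw [transition, integral_map (hX.measurable _).aemeasurable
        (measurable_expFun _).aestronglyMeasurable, h1]
    rw [h0 t h]
    refine tendsto_const_nhds.congr' ?_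
    filter_upwards [(isOpen_Iio.prod isOpen_univ).mem_nhds
      (show (t, z) ∈ Iio ts ×ˢ univ from ⟨h, mem_univ _⟩)] with p hp
    exact (h0 p.1 hp.1 p.2).symm
  · exact hgood t htd (.inl ⟨ts, h, fun v hv hvZ => not_le.2 hv (hmax hvZ)⟩) z hz

end AffineRegularity

/-! ### Growth directions, characteristic functions of almost constant modulus, and arguments of
curves -/

section Escape

variable {V : Type*} [NormedAddCommGroup V] [InnerProductSpace ℝ V] {E : Set V}

/-- `p` is the orthogonal projection to the span of the real vectors in 𝓤, and a₀ is the sum of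
finitely many such vectors b_i which span. Each ⟨b_i,x⟩ is bounded above on E, so a large projection
forces some ⟨b_i,x⟩, and with it the sum, to be very negative. -/
theorem exists_growth_direction [FiniteDimensional ℝ V] (E : Set V) :
    ∃ (p : V → V) (a₀ : V) (C c : ℝ), 0 < c ∧ (a₀, (0 : V)) ∈ setU E ∧
      (∀ x ∈ E, inner ℝ a₀ x ≤ C - c * ‖p x‖) ∧
      ∀ a, (a, (0 : V)) ∈ setU E → ∀ x, inner ℝ a x = inner ℝ a (p x) := by
  set S : Set V := {a | (a, (0 : V)) ∈ setU E} with hS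
  obtain ⟨n, b, hbS, hb⟩ : ∃ (n : ℕ) (b : Fin n → V), (∀ i, b i ∈ S) ∧
      Submodule.span ℝ (range b) = Submodule.span ℝ S :=
    let ⟨b, hbS, hb, _⟩ := Submodule.exists_fun_fin_finrank_span_eq ℝ S
    ⟨_, b, hbS, hb⟩
  set W := Submodule.span ℝ S with hW
  have hpW : ∀ a ∈ W, ∀ x, inner ℝ a x = inner ℝ a (W.starProjection x) := fun a ha x => by
    rw [← Submodule.inner_starProjection_left_eq_right, Submodule.starProjection_eq_self_iff.2 ha]
  have hbW : ∀ i, b i ∈ W := fun i => Submodule.subset_span (hbS i)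
  have hbound : ∀ i, ∃ C : ℝ, 0 ≤ C ∧ ∀ x ∈ E, inner ℝ (b i) x ≤ C := by
    intro i
    obtain ⟨C, hC⟩ := hbS i
    refine ⟨|Real.log C|, abs_nonneg _, fun x hx => ?_⟩
    have h1 := hC x hx
    rw [norm_exp_pairing] at h1
    exact ((Real.le_log_iff_exp_le ((Real.exp_pos _).trans_le h1)).2 h1).trans (le_abs_self _)
  choose C hC0 hC using hbound
  let L : W →ₗ[ℝ] (Fin n → ℝ) :=
    LinearMap.pi fun i => (innerₛₗ ℝ (b i)) ∘ₗ W.subtype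
  have hLi : ∀ w i, L w i = inner ℝ (b i) (w : V) := fun w i => rfl
  have hker : L.ker = ⊥ := by
    refine LinearMap.ker_eq_bot'.2 fun w hw => ?_
    have h1 : ∀ v ∈ Submodule.span ℝ (range b), inner ℝ v (w : V) = 0 := by
      intro v hv
      refine Submodule.span_induction ?_ (by simp) (fun v w' _ _ hv hw => by
        rw [inner_add_left, hv, hw, add_zero]) (fun c v _ hv => by
        rw [inner_smul_left, hv, mul_zero]) hv
      rintro _ ⟨i, rfl⟩
      rw [← hLi, hw]
      rfl
    rw [hb] at h1
    exact Subtype.ext (inner_self_eq_zero.1 (h1 w w.2))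
  obtain ⟨K, hK0, hK⟩ := L.exists_antilipschitzWith hker
  have hK0' : (0 : ℝ) < K := hK0
  have hnorm : ∀ x, ‖W.starProjection x‖ ≤ K * ∑ i, |inner ℝ (b i) x| := by
    intro x
    have h1 := hK.le_mul_dist ⟨W.starProjection x, W.starProjection_apply_mem x⟩ 0
    rw [map_zero, dist_zero_right, dist_zero_right] at h1
    refine h1.trans (mul_le_mul_of_nonneg_left ?_ hK0'.le)
    refine (pi_norm_le_iff_of_nonneg (Finset.sum_nonneg fun _ _ => abs_nonneg _)).2 fun i => ?_
    rw [hLi, Real.norm_eq_abs]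
    change |inner ℝ (b i) (W.starProjection x)| ≤ _
    rw [← hpW _ (hbW i)]
    exact Finset.single_le_sum (f := fun i => |inner ℝ (b i) x|) (fun _ _ => abs_nonneg _)
      (Finset.mem_univ i)
  have hmain : ∀ x ∈ E, inner ℝ (∑ i, b i) x ≤ 2 * ∑ i, C i - (K : ℝ)⁻¹ * ‖W.starProjection x‖ := by
    intro x hx
    -- From v ≤ C and C ≥ 0 follows |v| ≤ 2C - v.
    have h1 : ∑ i, |inner ℝ (b i) x| ≤ ∑ i, (2 * C i - inner ℝ (b i) x) := by
      refine Finset.sum_le_sum fun i _ => abs_le.2 ⟨?_, ?_⟩ <;> linarith [hC i x hx, hC0 i]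
    rw [Finset.sum_sub_distrib, ← Finset.mul_sum, ← sum_inner] at h1
    have h2 : (K : ℝ)⁻¹ * ‖W.starProjection x‖ ≤ ∑ i, |inner ℝ (b i) x| := by
      rw [inv_mul_le_iff₀ hK0']
      exact hnorm x
    linarith
  refine ⟨W.starProjection, ∑ i, b i, 2 * ∑ i, C i, (K : ℝ)⁻¹, inv_pos.2 hK0', ?_, hmain,
    fun a ha x => hpW a (Submodule.subset_span ha) x⟩
  refine ⟨Real.exp (2 * ∑ i, C i), fun x hx => ?_⟩
  rw [norm_exp_pairing]
  refine Real.exp_le_exp.2 ((hmain x hx).trans (sub_le_self _ ?_))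
  positivity

/-- The points of `E` of norm at most `R`. -/
def ballSet (E : Set V) (R : ℝ) : Set (OnePoint E) := (↑) '' {x : E | ‖(x : V)‖ ≤ R}

theorem isCompact_ballSet [FiniteDimensional ℝ V] (hE : IsClosed E) (R : ℝ) :
    IsCompact (ballSet E R) := by
  have := FiniteDimensional.proper_real V
  have h : {x : E | ‖(x : V)‖ ≤ R} = (↑) ⁻¹' Metric.closedBall (0 : V) R := by
    ext x; simp
  rw [ballSet, h]
  exact (hE.isClosedEmbedding_subtypeVal.isCompact_preimage (isCompact_closedBall 0 R)).image
    OnePoint.continuous_coe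

theorem measurableSet_ballSet (R : ℝ) [FiniteDimensional ℝ V] (hE : IsClosed E) :
    MeasurableSet (ballSet E R) :=
  have := t2Space_onePoint hE
  (isCompact_ballSet hE R).isClosed.measurableSet

theorem integrable_expFun (y : V) (μ : Measure (OnePoint E)) [IsFiniteMeasure μ] :
    Integrable (expFun E (0, y)) μ :=
  .of_bound (measurable_expFun _).aestronglyMeasurable 1 (ae_of_all _ (norm_expFun_imag_le y))

theorem norm_expFun_coe_imag (y : V) (x : E) : ‖expFun E (0, y) (x : OnePoint E)‖ = 1 := by
  simp [norm_exp_pairing]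

theorem norm_expFun_sub_le (y y' : V) (z : OnePoint E) :
    ‖expFun E (0, y) z - expFun E (0, y') z‖ = ‖expFun E (0, y - y') z - expFun E (0, 0) z‖ := by
  induction z with
  | infty => simp
  | coe x =>
    have h : expFun E (0, y) (x : OnePoint E) - expFun E (0, y') (x : OnePoint E) =
        expFun E (0, y') (x : OnePoint E) *
          (expFun E (0, y - y') (x : OnePoint E) - expFun E (0, 0) (x : OnePoint E)) := by
      rw [expFun_zero_coe, mul_sub, mul_one]
      simp only [expFun_coe, ← Complex.exp_add, ← pairing_add, Prod.mk_add_mk, add_zero,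
        add_sub_cancel]
    rw [h, norm_mul, norm_expFun_coe_imag, one_mul]

theorem exists_norm_eq_one_conj_mul (I : ℂ) :
    ∃ c : ℂ, ‖c‖ = 1 ∧ starRingEnd ℂ c * I = ‖I‖ := by
  rcases eq_or_ne I 0 with rfl | hI
  · exact ⟨1, by simp, by simp⟩
  · have h0 : (‖I‖ : ℂ) ≠ 0 := by exact_mod_cast norm_ne_zero_iff.2 hI
    refine ⟨I / ‖I‖, by simp [norm_ne_zero_iff.2 hI], ?_⟩
    rw [map_div₀, Complex.conj_ofReal, div_mul_eq_mul_div, Complex.conj_mul']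
    field_simp

/-- If a probability measure on `E_Δ` charges a bounded set and if its characteristic function is
almost of constant modulus near `0`, then its characteristic function has a small modulus of
continuity. -/
theorem norm_integral_expFun_sub_sq_le [FiniteDimensional ℝ V] (hE : IsClosed E)
    {μ : Measure (OnePoint E)} [IsProbabilityMeasure μ] {R m η r κ : ℝ} (hm0 : 0 < m)
    (hm : m ≤ μ.real (ballSet E R)) (hr : r * R ≤ κ)
    (hη : ∀ d : V, ‖d‖ ≤ r →
      (∫ z, expFun E (0, 0) z ∂μ).re - ‖∫ z, expFun E (0, d) z ∂μ‖ ≤ η)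
    {y y' : V} (hy : ‖y - y'‖ ≤ r) :
    ‖∫ z, expFun E (0, y) z ∂μ - ∫ z, expFun E (0, y') z ∂μ‖ ^ 2 ≤ 4 * κ ^ 2 + 12 * η / m := by
  set d := y - y' with hd
  have hK := measurableSet_ballSet R hE
  have hi := fun y => integrable_expFun (E := E) y μ
  -- `c` is the phase of the characteristic function at `d`. If the modulus there is almost the mass
  -- of E, then f_{id} is close to `c` in mean square on E.
  obtain ⟨c, hc1, hc⟩ := exists_norm_eq_one_conj_mul (∫ z, expFun E (0, d) z ∂μ)
  have hbd : ∀ {f : OnePoint E → ℂ}, Measurable f → (∀ z, ‖f z‖ ≤ 2) →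
      Integrable (fun z => ‖f z‖ ^ 2) μ := fun {f} hf hf2 =>
    .of_bound (hf.norm.pow_const 2).aestronglyMeasurable 4 (ae_of_all _ fun z => by
      rw [Real.norm_of_nonneg (by positivity)]
      nlinarith [hf2 z, norm_nonneg (f z)])
  have hm1 : Measurable fun z => expFun E (0, d) z - c * expFun E (0, 0) z :=
    (measurable_expFun _).sub ((measurable_expFun _).const_mul c)
  have hm2 : Measurable fun z => expFun E (0, d) z - expFun E (0, 0) z :=
    (measurable_expFun _).sub (measurable_expFun _)
  have hI1 : Integrable (fun z => ‖expFun E (0, d) z - c * expFun E (0, 0) z‖ ^ 2) μ :=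
    hbd hm1 fun z => by
      refine (norm_sub_le _ _).trans ?_
      rw [norm_mul, hc1, one_mul]
      linarith [norm_expFun_imag_le (E := E) d z, norm_expFun_imag_le (E := E) 0 z]
  have hI2 : Integrable (fun z => ‖expFun E (0, d) z - expFun E (0, 0) z‖ ^ 2) μ :=
    hbd hm2 fun z => by
      refine (norm_sub_le _ _).trans ?_
      linarith [norm_expFun_imag_le (E := E) d z, norm_expFun_imag_le (E := E) 0 z]
  have hI3 : Integrable ((ballSet E R).indicator fun _ => (1 : ℝ)) μ :=
    (integrable_const 1).indicator hK
  -- the distance to the constant `c`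
  have e1 : ∫ z, ‖expFun E (0, d) z - c * expFun E (0, 0) z‖ ^ 2 ∂μ ≤ 2 * η := by
    have hpt : ∀ z, ‖expFun E (0, d) z - c * expFun E (0, 0) z‖ ^ 2 =
        2 * (expFun E (0, 0) z).re - 2 * (starRingEnd ℂ c * expFun E (0, d) z).re := by
      intro z
      induction z with
      | infty => simp
      | coe x =>
        have h1 := norm_expFun_coe_imag d x
        rw [expFun_zero_coe, mul_one, Complex.one_re]
        rw [← Complex.normSq_eq_norm_sq, Complex.normSq_sub, Complex.normSq_eq_norm_sq,
          Complex.normSq_eq_norm_sq, h1, hc1, mul_comm (starRingEnd ℂ c)]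
        norm_num
    have i1 : Integrable (fun z => (expFun E (0, 0) z).re) μ := (hi 0).re
    have i2 : Integrable (fun z => (starRingEnd ℂ c * expFun E (0, d) z).re) μ :=
      ((hi d).const_mul _).re
    have j1 : ∫ z, (expFun E (0, 0) z).re ∂μ = (∫ z, expFun E (0, 0) z ∂μ).re := integral_re (hi 0)
    have j2 : ∫ z, (starRingEnd ℂ c * expFun E (0, d) z).re ∂μ =
        (∫ z, starRingEnd ℂ c * expFun E (0, d) z ∂μ).re := integral_re ((hi d).const_mul _)
    simp only [hpt]
    rw [integral_sub (i1.const_mul 2) (i2.const_mul 2), integral_const_mul, integral_const_mul,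
      j1, j2, integral_const_mul, hc, Complex.ofReal_re]
    linarith [hη d hy]
  -- the constant `c` is close to `1`
  have e2 : ‖1 - c‖ ^ 2 * m ≤ 2 * κ ^ 2 * m + 4 * η := by
    have hpt : ∀ z, (‖1 - c‖ ^ 2 - 2 * κ ^ 2) * (ballSet E R).indicator (fun _ => (1 : ℝ)) z ≤
        2 * ‖expFun E (0, d) z - c * expFun E (0, 0) z‖ ^ 2 := by
      intro z
      by_cases hz : z ∈ ballSet E R
      · obtain ⟨x, hx, rfl⟩ := hz
        have hx' : ‖(x : V)‖ ≤ R := hx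
        have hz : (x : OnePoint E) ∈ ballSet E R := mem_image_of_mem _ hx
        rw [indicator_of_mem hz, mul_one, expFun_zero_coe, mul_one]
        have h1 : ‖1 - expFun E (0, d) (x : OnePoint E)‖ ≤ κ := by
          have : expFun E (0, d) (x : OnePoint E) =
              Complex.exp (Complex.I * (inner ℝ d (x : V) : ℝ)) := by
            simp [pairing, mul_comm]
          rw [norm_sub_rev, this]
          refine Real.norm_exp_I_mul_ofReal_sub_one_le.trans ?_
          refine (abs_real_inner_le_norm d (x : V)).trans ?_
          refine (mul_le_mul hy hx' (norm_nonneg _) ((norm_nonneg _).trans hy)).trans hr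
        have h2 : ‖1 - c‖ ≤ κ + ‖expFun E (0, d) (x : OnePoint E) - c‖ := by
          have : 1 - c = (1 - expFun E (0, d) (x : OnePoint E)) +
            (expFun E (0, d) (x : OnePoint E) - c) := by ring
          rw [this]
          exact (norm_add_le _ _).trans (by gcongr)
        nlinarith [norm_nonneg (1 - c), sq_nonneg (κ - ‖expFun E (0, d) (x : OnePoint E) - c‖)]
      · rw [indicator_of_notMem hz, mul_zero]
        positivity
    have h1 := integral_mono (hI3.const_mul _) (hI1.const_mul 2) hpt
    rw [integral_const_mul, integral_const_mul, integral_indicator_const _ hK, smul_eq_mul,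
      mul_one] at h1
    have hη0 : 0 ≤ η := by
      have : 0 ≤ ∫ z, ‖expFun E (0, d) z - c * expFun E (0, 0) z‖ ^ 2 ∂μ :=
        integral_nonneg fun z => by positivity
      linarith
    rcases le_total (‖1 - c‖ ^ 2) (2 * κ ^ 2) with h | h
    · nlinarith
    · nlinarith
  have e3 : ∫ z, ‖expFun E (0, d) z - expFun E (0, 0) z‖ ^ 2 ∂μ ≤ 4 * η + 2 * ‖1 - c‖ ^ 2 := by
    have hpt : ∀ z, ‖expFun E (0, d) z - expFun E (0, 0) z‖ ^ 2 ≤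
        2 * ‖expFun E (0, d) z - c * expFun E (0, 0) z‖ ^ 2 + 2 * ‖1 - c‖ ^ 2 := by
      intro z
      have h2 : ‖expFun E (0, d) z - expFun E (0, 0) z‖ ≤
          ‖expFun E (0, d) z - c * expFun E (0, 0) z‖ + ‖1 - c‖ := by
        have : expFun E (0, d) z - expFun E (0, 0) z =
          (expFun E (0, d) z - c * expFun E (0, 0) z) - (1 - c) * expFun E (0, 0) z := by ring
        rw [this]
        refine (norm_sub_le _ _).trans ?_
        rw [norm_mul]
        gcongr
        exact mul_le_of_le_one_right (norm_nonneg _) (norm_expFun_imag_le 0 z)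
      nlinarith [norm_nonneg (expFun E (0, d) z - expFun E (0, 0) z),
        sq_nonneg (‖expFun E (0, d) z - c * expFun E (0, 0) z‖ - ‖1 - c‖)]
    have i1 : Integrable (fun z => 2 * ‖expFun E (0, d) z - c * expFun E (0, 0) z‖ ^ 2 +
      2 * ‖1 - c‖ ^ 2) μ := (hI1.const_mul 2).add (integrable_const _)
    have h1 := integral_mono hI2 i1 hpt
    rw [integral_add (hI1.const_mul 2) (integrable_const _), integral_const_mul] at h1
    simp only [integral_const, probReal_univ, one_smul] at h1
    linarith
  -- Since |f_{iy} - f_{iy'}| = |f_{id} - f_0|, this is the bound of a squared mean by the mean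
  -- square.
  have e4 : ‖∫ z, expFun E (0, y) z ∂μ - ∫ z, expFun E (0, y') z ∂μ‖ ^ 2 ≤
      ∫ z, ‖expFun E (0, d) z - expFun E (0, 0) z‖ ^ 2 ∂μ := by
    set g : OnePoint E → ℝ := fun z => ‖expFun E (0, d) z - expFun E (0, 0) z‖ with hg
    have hgi : Integrable g μ := ((hi d).sub (hi 0)).norm
    have h1 : ‖∫ z, expFun E (0, y) z ∂μ - ∫ z, expFun E (0, y') z ∂μ‖ ≤ ∫ z, g z ∂μ := by
      rw [← integral_sub (hi y) (hi y')]
      refine (norm_integral_le_integral_norm _).trans (le_of_eq ?_)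
      exact integral_congr_ae (ae_of_all _ fun z => norm_expFun_sub_le y y' z)
    set a := ∫ z, g z ∂μ with ha
    have h2 : 0 ≤ ∫ z, (g z - a) ^ 2 ∂μ := integral_nonneg fun z => sq_nonneg _
    have h3 : ∀ z, (g z - a) ^ 2 = g z ^ 2 - 2 * a * g z + a ^ 2 := fun z => by ring
    have i1 : Integrable (fun z => g z ^ 2 - 2 * a * g z) μ := hI2.sub (hgi.const_mul _)
    simp only [h3] at h2
    rw [integral_add i1 (integrable_const _), integral_sub hI2 (hgi.const_mul _),
      integral_const_mul, ← ha] at h2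
    simp only [integral_const, probReal_univ, one_smul] at h2
    nlinarith [norm_nonneg (∫ z, expFun E (0, y) z ∂μ - ∫ z, expFun E (0, y') z ∂μ)]
  have hm1 : m ≤ 1 := hm.trans measureReal_le_one
  have hη0 : 0 ≤ η := by
    have : 0 ≤ ∫ z, ‖expFun E (0, d) z - c * expFun E (0, 0) z‖ ^ 2 ∂μ :=
      integral_nonneg fun z => by positivity
    linarith
  have e5 : ‖1 - c‖ ^ 2 ≤ 2 * κ ^ 2 + 4 * η / m := by
    rw [← sub_le_iff_le_add', le_div_iff₀ hm0]
    linarith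
  have e6 : 4 * η ≤ 4 * η / m := by
    rw [le_div_iff₀ hm0]
    nlinarith
  have e7 : 12 * η / m = 4 * η / m + 2 * (4 * η / m) := by ring
  linarith

/-- A continuous argument of a curve changes by at most `π` along pieces on which the curve varies
by less than its smallest modulus. -/
theorem abs_arg_sub_le {h : ℝ → ℝ} {χ : ℝ → ℂ} {c r : ℝ} {M : ℕ} (hh : ContinuousOn h (Icc 0 1))
    (hχ : ∀ s ∈ Icc (0 : ℝ) 1, χ s = ‖χ s‖ * Complex.exp (h s * Complex.I))
    (hc : ∀ s ∈ Icc (0 : ℝ) 1, c ≤ ‖χ s‖)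
    (hr : ∀ s ∈ Icc (0 : ℝ) 1, ∀ s' ∈ Icc (0 : ℝ) 1, |s - s'| ≤ r → ‖χ s - χ s'‖ < c)
    (hM0 : 0 < M) (hM : 1 ≤ M * r) : |h 1 - h 0| ≤ M * Real.pi := by
  have step : ∀ s ∈ Icc (0 : ℝ) 1, ∀ s' ∈ Icc (0 : ℝ) 1, |s - s'| ≤ r → |h s' - h s| ≤ Real.pi := by
    intro s hs s' hs' hss
    by_contra! hlt
    have hsub : uIcc s s' ⊆ Icc 0 1 := (convex_Icc (0 : ℝ) 1).ordConnected.uIcc_subset hs hs'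
    have hcont : ContinuousOn (fun w => |h w - h s|) (uIcc s s') :=
      ((hh.mono hsub).sub continuousOn_const).abs
    have hmem : Real.pi ∈ uIcc |h s - h s| |h s' - h s| := by
      rw [sub_self, abs_zero, uIcc_of_le (abs_nonneg _)]
      exact ⟨Real.pi_pos.le, hlt.le⟩
    -- Where the argument has moved by exactly π, the two values of the curve point in opposite
    -- directions, so their distance is the sum of their moduli and hence at least c.
    obtain ⟨w, hw, hwπ⟩ := intermediate_value_uIcc hcont hmem
    have hw1 := hsub hw
    have hexp : Complex.exp (h w * Complex.I) = -Complex.exp (h s * Complex.I) := by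
      rcases (abs_eq Real.pi_pos.le).1 (show |h w - h s| = Real.pi from hwπ) with h1 | h1
      · have : (h w : ℂ) * Complex.I = h s * Complex.I + Real.pi * Complex.I := by
          rw [← add_mul]; congr 1; exact_mod_cast (by linarith : h w = h s + Real.pi)
        rw [this, Complex.exp_add, Complex.exp_pi_mul_I, mul_neg, mul_one]
      · have : (h s : ℂ) * Complex.I = h w * Complex.I + Real.pi * Complex.I := by
          rw [← add_mul]; congr 1; exact_mod_cast (by linarith : h s = h w + Real.pi)
        rw [this, Complex.exp_add, Complex.exp_pi_mul_I, mul_neg, mul_one, neg_neg]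
    have hdist : ‖χ s - χ w‖ = ‖χ s‖ + ‖χ w‖ := by
      have : χ s - χ w = ((‖χ s‖ + ‖χ w‖ : ℝ) : ℂ) * Complex.exp (h s * Complex.I) := by
        conv_lhs => rw [hχ s hs, hχ w hw1, hexp]
        push_cast
        ring
      rw [this, norm_mul, Complex.norm_exp_ofReal_mul_I, mul_one, Complex.norm_real,
        Real.norm_of_nonneg (by positivity)]
    have hsw : |s - w| ≤ r := by
      rw [abs_sub_comm]
      exact (abs_sub_left_of_mem_uIcc hw).trans (by rwa [abs_sub_comm])
    have := hr s hs w hw1 hsw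
    linarith [hc s hs, norm_nonneg (χ w)]
  have hM0' : (0 : ℝ) < M := by exact_mod_cast hM0
  have hind : ∀ k : ℕ, k ≤ M → |h ((k : ℝ) / M) - h 0| ≤ k * Real.pi := by
    intro k
    induction k with
    | zero => simp
    | succ k ih =>
      intro hk
      have hk1 : ((k : ℝ) + 1) ≤ M := by exact_mod_cast hk
      have h1 := ih (Nat.le_of_succ_le hk)
      have h2 := step ((k : ℝ) / M) ⟨by positivity, (div_le_one hM0').2 (by linarith)⟩
        (((k + 1 : ℕ) : ℝ) / M) ⟨by positivity, (div_le_one hM0').2 (by push_cast; linarith)⟩ ?_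
      · have := abs_sub_le (h (((k + 1 : ℕ) : ℝ) / M)) (h ((k : ℝ) / M)) (h 0)
        push_cast at this h2 ⊢
        linarith
      · have : (k : ℝ) / M - ((k + 1 : ℕ) : ℝ) / M = -(1 / M) := by
          push_cast; field_simp; ring
        rw [this, abs_neg, abs_of_pos (by positivity), div_le_iff₀ hM0']
        linarith
  have := hind M le_rfl
  rwa [div_self hM0'.ne'] at this

end Escape

/-! ### The escape estimate -/

section EscapeToInfinity

variable {V : Type*} [NormedAddCommGroup V] [InnerProductSpace ℝ V]
  [FiniteDimensional ℝ V] {E : Set V} (hE : IsClosed E)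
  (hEbasis : ∃ e : Fin (Module.finrank ℝ V + 1) → V, (∀ i, e i ∈ E) ∧ AffineIndependent ℝ e)
  {Ω : Type*} {mΩ : MeasurableSpace Ω} {F : Filtration ℝ≥0 mΩ}
  {X : ℝ≥0 → Ω → OnePoint E} {Pr : ℝ≥0 → OnePoint E → Measure Ω}
  (hX : IsMarkovProcess F X Pr)
  {Φ : ℝ≥0 → ℝ≥0 → V × V → ℂ} {ψ : ℝ≥0 → ℝ≥0 → V × V → V × V} {φ : ℝ≥0 → ℝ≥0 → V × V → ℂ}
  (hA : IsAffineWith E (transition X Pr) Φ ψ)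
  (hψ0 : ψ 0 0 0 = 0)
  (hφ : ∀ k, ∀ p ∈ setQk E Φ k, Complex.exp (φ p.1 p.2.1 p.2.2) = Φ p.1 p.2.1 p.2.2)
  (hψc : ∀ k, ContinuousOn (fun p : ℝ≥0 × ℝ≥0 × V × V => ψ p.1 p.2.1 p.2.2) (setQk E Φ k))
  (hφc : ∀ k, ContinuousOn (fun p : ℝ≥0 × ℝ≥0 × V × V => φ p.1 p.2.1 p.2.2) (setQk E Φ k))
  (hΦc : ∀ k, ContinuousOn (fun p : ℝ≥0 × ℝ≥0 × V × V => Φ p.1 p.2.1 p.2.2) (setDk E k))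

omit [FiniteDimensional ℝ V] in
include hX hA in
-- |Φ| exp⟨Re ψ, x⟩ is the modulus of P f_u(x), hence at most k on E, and Φ ≠ 0 on 𝓠_k. Through
-- this, moduli see x only via the projection of `exists_growth_direction`.
theorem re_psi_mem_setU {k : ℕ} {t T : ℝ≥0} {u : V × V} (h : (t, T, u) ∈ setQk E Φ k) :
    ((ψ t T u).1, (0 : V)) ∈ setU E := by
  have h0 : 0 < ‖Φ t T u‖ := norm_pos_iff.2 (h.2 t le_rfl h.1.1)
  refine ⟨k / ‖Φ t T u‖, fun x hx => ?_⟩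
  have h1 := hA t T h.1.1 u (setUk_subset_setU k h.1.2) ⟨x, hx⟩
  have h2 := hX.norm_integral_transition_le (norm_expFun_le h.1.2) t T ((⟨x, hx⟩ : E) : OnePoint E)
  rw [h1, norm_mul, norm_exp_pairing] at h2
  rw [norm_exp_pairing, le_div_iff₀ h0, mul_comm]
  exact h2

omit [FiniteDimensional ℝ V] in
theorem expFun_real_eq_norm (a : V) (z : OnePoint E) :
    expFun E (a, 0) z = (‖expFun E (a, 0) z‖ : ℂ) := by
  induction z with
  | infty => simp
  | coe x =>
    rw [expFun_coe, norm_exp_pairing, Complex.ofReal_exp]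
    simp [pairing]

include hE in
theorem mul_exp_le_norm_integral_expFun {a : V} {k : ℕ} (ha : (a, (0 : V)) ∈ setUk E k)
    (μ : Measure (OnePoint E)) [IsFiniteMeasure μ] (R : ℝ) :
    μ.real (ballSet E R) * Real.exp (-(‖a‖ * R)) ≤ ‖∫ z, expFun E (a, 0) z ∂μ‖ := by
  have hK := measurableSet_ballSet R hE
  have hpt : ∀ z, (ballSet E R).indicator (fun _ => Real.exp (-(‖a‖ * R))) z ≤
      ‖expFun E (a, 0) z‖ := by
    intro z
    by_cases hz : z ∈ ballSet E R
    · rw [indicator_of_mem hz]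
      obtain ⟨x, hx, rfl⟩ := hz
      rw [expFun_coe, norm_exp_pairing, Real.exp_le_exp]
      have h1 := neg_le_of_abs_le (abs_real_inner_le_norm a (x : V))
      have h2 : ‖a‖ * ‖(x : V)‖ ≤ ‖a‖ * R := mul_le_mul_of_nonneg_left hx (norm_nonneg _)
      simpa using (neg_le_neg h2).trans h1
    · rw [indicator_of_notMem hz]
      exact norm_nonneg _
  have hi : Integrable (fun z => ‖expFun E (a, 0) z‖) μ :=
    .of_bound (measurable_expFun _).norm.aestronglyMeasurable k (ae_of_all _ fun z => by
      rw [norm_norm]; exact norm_expFun_le ha z)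
  have h1 := integral_mono ((integrable_const _).indicator hK) hi hpt
  rw [integral_indicator_const _ hK, smul_eq_mul] at h1
  have h2 : ∫ z, expFun E (a, 0) z ∂μ = ((∫ z, ‖expFun E (a, 0) z‖ ∂μ : ℝ) : ℂ) :=
    (integral_congr_ae (ae_of_all _ (expFun_real_eq_norm a))).trans (integral_ofReal (𝕜 := ℂ))
  rw [h2, Complex.norm_real]
  exact h1.trans (le_abs_self _)

include hE hEbasis hX hA hψ0 hφ hψc hφc hΦc in
/-- Starting points from which a given bounded set is reached within a short time with a
probability bounded away from `0` are themselves bounded. -/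
theorem exists_bound_of_measureReal_ballSet (t₀ : ℝ≥0) :
    ∃ δ > 0, ∀ R m : ℝ, 0 < m → ∃ R' : ℝ, ∀ t ∈ Metric.closedBall t₀ δ,
      ∀ T ∈ Metric.closedBall t₀ δ, t ≤ T → ∀ x : E,
        m ≤ (transition X Pr t T (x : OnePoint E)).real (ballSet E R) → ‖(x : V)‖ ≤ R' := by
  have := FiniteDimensional.proper_real V
  have := t2Space_onePoint hE
  obtain ⟨p, a₀, C, c, hc, ha₀, hgrow, hp⟩ := exists_growth_direction E
  obtain ⟨k₀, hk₀⟩ := exists_mem_setUk ha₀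
  set k := max k₀ 1 with hk
  have ha₀k : (a₀, (0 : V)) ∈ setUk E k := setUk_mono (le_max_left _ _) hk₀
  have hyk : ∀ y : V, ((0 : V), y) ∈ setUk E k := fun y =>
    setUk_mono (le_max_right _ _) (imag_mem_setUk y)
  have hyU : ∀ y : V, ((0 : V), y) ∈ setU E := fun y => setUk_subset_setU _ (hyk y)
  set K : Set (V × V) := insert (a₀, 0) ((fun y => ((0 : V), y)) '' Metric.closedBall 0 1) with hKd
  have hKc : IsCompact K := ((isCompact_closedBall (0 : V) 1).image (by fun_prop)).insert _
  have hKU : K ⊆ setUk E k := by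
    rintro u (rfl | ⟨y, -, rfl⟩)
    exacts [ha₀k, hyk y]
  -- The bound c/2 keeps half of the decay rate of f_{a₀}; the bound 1/4, used at both ends of the
  -- segment from 0 to x/‖x‖, leaves half of the growth of the phase.
  obtain ⟨δ, hδ, hloc⟩ := exists_forall_mem_setQk hEbasis hX hA hψ0 hψc hΦc t₀ hKc hKU
    (lt_min (by norm_num : (0 : ℝ) < 1 / 4) (half_pos hc))
  refine ⟨δ, hδ, fun R m hm => ?_⟩
  set D : Set (ℝ≥0 × ℝ≥0) :=
    (Metric.closedBall t₀ δ ×ˢ Metric.closedBall t₀ δ) ∩ {q | q.1 ≤ q.2} with hD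
  have hDc : IsCompact D := ((isCompact_closedBall t₀ δ).prod (isCompact_closedBall t₀ δ)).inter_right
    (isClosed_le continuous_fst continuous_snd)
  have hQa : ∀ q ∈ D, (q.1, q.2, (a₀, (0 : V))) ∈ setQk E Φ k := fun q hq =>
    (hloc _ hq.1.1 _ hq.1.2 hq.2 _ (mem_insert _ _)).1
  have hψa : ∀ q ∈ D, ‖(ψ q.1 q.2 (a₀, 0)).1 - a₀‖ ≤ c / 2 := fun q hq =>
    (norm_fst_le (ψ q.1 q.2 (a₀, 0) - (a₀, 0))).trans
      ((hloc _ hq.1.1 _ hq.1.2 hq.2 _ (mem_insert _ _)).2.trans (min_le_right _ _))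
  have hQy : ∀ q ∈ D, ∀ y ∈ Metric.closedBall (0 : V) 1, (q.1, q.2, ((0 : V), y)) ∈ setQk E Φ k :=
    fun q hq y hy => (hloc _ hq.1.1 _ hq.1.2 hq.2 _ (mem_insert_of_mem _ ⟨y, hy, rfl⟩)).1
  have hψy : ∀ q ∈ D, ∀ y ∈ Metric.closedBall (0 : V) 1, ‖(ψ q.1 q.2 (0, y)).2 - y‖ ≤ 1 / 4 :=
    fun q hq y hy => (norm_snd_le (ψ q.1 q.2 (0, y) - (0, y))).trans
      ((hloc _ hq.1.1 _ hq.1.2 hq.2 _ (mem_insert_of_mem _ ⟨y, hy, rfl⟩)).2.trans (min_le_left _ _))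
  -- the component of the starting point in the directions of growth is bounded
  obtain ⟨M₀, hM₀⟩ := hDc.exists_bound_of_continuousOn (f := fun q => Φ q.1 q.2 (a₀, 0))
    ((hΦc k).comp (f := fun q : ℝ≥0 × ℝ≥0 => (q.1, q.2, (a₀, (0 : V)))) (by fun_prop)
      fun q hq => (hQa q hq).1)
  -- Solved for ‖px‖ from m exp(-‖a₀‖R) ≤ max(M₀,1) exp(C - (c/2)‖px‖): the left side bounds P
  -- f_{a₀}(x) below, the right side bounds it above.
  set B : ℝ := 2 / c * (C + Real.log (max M₀ 1) - Real.log m + ‖a₀‖ * R) with hB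
  have hpB : ∀ q ∈ D, ∀ x : E, m ≤ (transition X Pr q.1 q.2 (x : OnePoint E)).real (ballSet E R) →
      ‖p x‖ ≤ B := by
    intro q hq x hmx
    have := hX.isProbabilityMeasure_transition q.1 q.2 (x : OnePoint E)
    have h1 := mul_exp_le_norm_integral_expFun hE ha₀k (transition X Pr q.1 q.2 (x : OnePoint E)) R
    rw [integral_expFun hX hA hq.2 ha₀, norm_mul, expFun_coe, norm_exp_pairing] at h1
    have h2 : inner ℝ (ψ q.1 q.2 (a₀, 0)).1 (x : V) ≤ C - c / 2 * ‖p x‖ := by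
      have e1 : inner ℝ (ψ q.1 q.2 (a₀, 0)).1 (x : V) =
          inner ℝ a₀ (x : V) + inner ℝ ((ψ q.1 q.2 (a₀, 0)).1 - a₀) (p x) := by
        rw [hp _ (re_psi_mem_setU hX hA (hQa q hq)), hp a₀ ha₀, inner_sub_left]
        ring
      have e2 := (real_inner_le_norm ((ψ q.1 q.2 (a₀, 0)).1 - a₀) (p x)).trans
        (mul_le_mul_of_nonneg_right (hψa q hq) (norm_nonneg _))
      linarith [hgrow x x.2]
    have h3 : m * Real.exp (-(‖a₀‖ * R)) ≤ max M₀ 1 * Real.exp (C - c / 2 * ‖p x‖) :=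
      calc m * Real.exp (-(‖a₀‖ * R))
          ≤ _ := mul_le_mul_of_nonneg_right hmx (Real.exp_pos _).le
        _ ≤ _ := h1
        _ ≤ _ := mul_le_mul ((hM₀ q hq).trans (le_max_left _ _)) (Real.exp_le_exp.2 h2)
          (Real.exp_pos _).le (zero_le_one.trans (le_max_right _ _))
    have hM1 : (0 : ℝ) < max M₀ 1 := zero_lt_one.trans_le (le_max_right _ _)
    have h4 := Real.log_le_log (by positivity) h3
    rw [Real.log_mul hm.ne' (Real.exp_pos _).ne', Real.log_mul hM1.ne' (Real.exp_pos _).ne',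
      Real.log_exp, Real.log_exp] at h4
    rw [hB, div_mul_eq_mul_div, le_div_iff₀ hc]
    linarith
  -- continuity of the data
  have hcQ : ContinuousOn (fun z : (ℝ≥0 × ℝ≥0) × V => (z.1.1, z.1.2, ((0 : V), z.2)))
    (D ×ˢ Metric.closedBall 0 1) := by fun_prop
  have hmQ : MapsTo (fun z : (ℝ≥0 × ℝ≥0) × V => (z.1.1, z.1.2, ((0 : V), z.2)))
    (D ×ˢ Metric.closedBall 0 1) (setQk E Φ k) := fun z hz => hQy _ hz.1 _ hz.2
  have hcΦ := ((hΦc k).mono fun p (hp : p ∈ setQk E Φ k) => hp.1).comp hcQ hmQ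
  have hcψ := (hψc k).comp hcQ hmQ
  have hcφ := (hφc k).comp hcQ hmQ
  obtain ⟨Cφ, hCφ⟩ := (hDc.prod (isCompact_closedBall (0 : V) 1)).exists_bound_of_continuousOn hcφ
  set S := D ×ˢ (Metric.closedBall (0 : V) 1 ×ˢ Metric.closedBall (0 : V) B) with hS
  have hSc : IsCompact S := hDc.prod ((isCompact_closedBall _ _).prod (isCompact_closedBall _ _))
  -- The modulus of P f_{iy}(x) as a function of times, y and the projection px. On the compact set
  -- `S` it is bounded away from 0 and uniformly continuous, although x itself is not yet bounded.
  set G : (ℝ≥0 × ℝ≥0) × V × V → ℝ := fun z => ‖Φ z.1.1 z.1.2 (0, z.2.1)‖ *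
    Real.exp (inner ℝ (ψ z.1.1 z.1.2 (0, z.2.1)).1 z.2.2) with hG
  have hGc : ContinuousOn G S := by
    have hmaps : MapsTo (fun z : (ℝ≥0 × ℝ≥0) × V × V => (z.1, z.2.1)) S
      (D ×ˢ Metric.closedBall 0 1) := fun z hz => ⟨hz.1, hz.2.1⟩
    have hcont : ContinuousOn (fun z : (ℝ≥0 × ℝ≥0) × V × V => (z.1, z.2.1)) S := by fun_prop
    have h1 := (hcΦ.comp hcont hmaps).norm
    have h2 := (hcψ.comp hcont hmaps).fst
    exact h1.mul (Real.continuous_exp.comp_continuousOn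
      (h2.inner (continuousOn_snd.comp continuousOn_snd fun _ _ => mem_univ _)))
  have hGpos : ∀ z ∈ S, 0 < G z := fun z hz =>
    mul_pos (norm_pos_iff.2 ((hQy _ hz.1 _ hz.2.1).2 _ le_rfl hz.1.2)) (Real.exp_pos _)
  obtain ⟨c₁, hc₁, hGc₁⟩ : ∃ c₁ > 0, ∀ z ∈ S, c₁ ≤ G z := by
    rcases S.eq_empty_or_nonempty with h | h
    · exact ⟨1, one_pos, by simp [h]⟩
    · obtain ⟨z₀, hz₀, hmin⟩ := hSc.exists_isMinOn h hGc
      exact ⟨G z₀, hGpos z₀ hz₀, fun z hz => hmin hz⟩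
  -- With κ = c₁/4, the bound 4κ² + 12η/m equals c₁²/2. The characteristic function thus varies by
  -- less than its smallest modulus over distances at most r.
  set η := m * c₁ ^ 2 / 48 with hη
  have hη0 : 0 < η := by positivity
  obtain ⟨r₀, hr₀, hunif⟩ := Metric.uniformContinuousOn_iff.1
    (hSc.uniformContinuousOn_of_continuous hGc) η hη0
  set κ := c₁ / 4 with hκ
  set r := min (min (r₀ / 2) 1) (κ / (|R| + 1)) with hr
  have hκ0 : 0 < κ := by positivity
  have hr0 : 0 < r := by positivity
  have hrr : r < r₀ := ((min_le_left _ _).trans (min_le_left _ _)).trans_lt (half_lt_self hr₀)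
  have hr1 : r ≤ 1 := (min_le_left _ _).trans (min_le_right _ _)
  have hrR : r * R ≤ κ := by
    have h1 : r * (|R| + 1) ≤ κ := (le_div_iff₀ (by positivity)).1 (min_le_right _ _)
    nlinarith [le_abs_self R]
  set M : ℕ := ⌈1 / r⌉₊ with hM
  have hM0 : 0 < M := Nat.ceil_pos.2 (by positivity)
  have hMr : 1 ≤ M * r := by
    rw [← div_le_iff₀ hr0]
    exact Nat.le_ceil _
  -- The phase along the segment changes by at most Mπ, and by at least ‖x‖ - ‖x‖/4 - ‖x‖/4 - 2Cφ.
  refine ⟨2 * (M * Real.pi + 2 * Cφ), fun t ht T hT htT x hmx => ?_⟩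
  have hq : (t, T) ∈ D := ⟨⟨ht, hT⟩, htT⟩
  have hprob := hX.isProbabilityMeasure_transition t T (x : OnePoint E)
  set μ := transition X Pr t T (x : OnePoint E) with hμ
  have hpx := hpB (t, T) hq x hmx
  have hzS : ∀ y ∈ Metric.closedBall (0 : V) 1, ((t, T), y, p x) ∈ S := fun y hy =>
    ⟨hq, hy, by simpa using hpx⟩
  have hnorm : ∀ y ∈ Metric.closedBall (0 : V) 1,
      ‖∫ z, expFun E (0, y) z ∂μ‖ = G ((t, T), y, p x) := by
    intro y hy
    rw [hμ, integral_expFun hX hA htT (hyU y), norm_mul, expFun_coe, norm_exp_pairing,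
      hp _ (re_psi_mem_setU hX hA (hQy _ hq y hy))]
  have hosc := fun {y y' : V} => norm_integral_expFun_sub_sq_le hE (y := y) (y' := y') hm hmx hrR
    (η := η) (r := r) fun d hd => by
      have hd1 : d ∈ Metric.closedBall (0 : V) 1 := by simpa using hd.trans hr1
      have h01 : (0 : V) ∈ Metric.closedBall (0 : V) 1 := by simp
      have h1 := hunif _ (hzS 0 h01) _ (hzS d hd1) (by
        simp only [Prod.dist_eq, dist_self, dist_zero_left]
        rw [max_eq_left (norm_nonneg d), max_eq_right (norm_nonneg d)]
        exact hd.trans_lt hrr)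
      rw [Real.dist_eq] at h1
      rw [hnorm d hd1]
      have h2 := (Complex.re_le_norm (∫ z, expFun E (0, 0) z ∂μ)).trans_eq (hnorm 0 h01)
      linarith [le_abs_self (G ((t, T), 0, p x) - G ((t, T), d, p x))]
  have hCφ0 : 0 ≤ Cφ := (norm_nonneg _).trans (hCφ ((t, T), 0) ⟨hq, by simp⟩)
  rcases eq_or_ne (x : V) 0 with hx0 | hx0
  · rw [hx0, norm_zero]
    positivity
  have hxn : 0 < ‖(x : V)‖ := norm_pos_iff.2 hx0
  set y₁ : V := ‖(x : V)‖⁻¹ • (x : V) with hy₁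
  have hy₁n : ‖y₁‖ = 1 := by rw [hy₁, norm_smul, norm_inv, norm_norm, inv_mul_cancel₀ hxn.ne']
  have hsy : ∀ s ∈ Icc (0 : ℝ) 1, s • y₁ ∈ Metric.closedBall (0 : V) 1 := fun s hs => by
    rw [mem_closedBall_zero_iff, norm_smul, hy₁n, mul_one, Real.norm_of_nonneg hs.1]
    exact hs.2
  -- On 𝓠_k the affine formula reads P f_u(x) = exp(φ(u) + ⟨ψ(u), x⟩), so its imaginary exponent is
  -- a continuous argument.
  set h : ℝ → ℝ := fun s => (φ t T (0, s • y₁)).im + inner ℝ (ψ t T (0, s • y₁)).2 (x : V) with hh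
  have hcont : ContinuousOn (fun s : ℝ => ((t, T), s • y₁)) (Icc 0 1) := by fun_prop
  have hmaps : MapsTo (fun s : ℝ => ((t, T), s • y₁)) (Icc 0 1) (D ×ˢ Metric.closedBall 0 1) :=
    fun s hs => ⟨hq, hsy s hs⟩
  have hhc : ContinuousOn h (Icc 0 1) :=
    (Complex.continuous_im.comp_continuousOn (hcφ.comp hcont hmaps)).add
      ((hcψ.comp hcont hmaps).snd.inner continuousOn_const)
  have hπ := abs_arg_sub_le (h := h) (χ := fun s => ∫ z, expFun E (0, s • y₁) z ∂μ) (c := c₁)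
    (r := r) hhc (fun s hs => ?_) (fun s hs => ?_) (fun s hs s' hs' hss => ?_) hM0 hMr
  · have e1 : h 1 - h 0 = ((φ t T (0, y₁)).im - (φ t T (0, 0)).im) +
        (‖(x : V)‖ + inner ℝ ((ψ t T (0, y₁)).2 - y₁) (x : V) -
          inner ℝ ((ψ t T (0, 0)).2 - 0) (x : V)) := by
      have e0 : inner ℝ y₁ (x : V) = ‖(x : V)‖ := by
        rw [hy₁, real_inner_smul_left, real_inner_self_eq_norm_sq]
        field_simp
      simp only [hh, one_smul, zero_smul, inner_sub_left, e0, sub_zero]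
      ring
    have h1m : y₁ ∈ Metric.closedBall (0 : V) 1 := by simp [hy₁n]
    have h0m : (0 : V) ∈ Metric.closedBall (0 : V) 1 := by simp
    have b1 : |(φ t T (0, y₁)).im| ≤ Cφ := (Complex.abs_im_le_norm _).trans (hCφ ((t, T), y₁) ⟨hq, h1m⟩)
    have b0 : |(φ t T (0, 0)).im| ≤ Cφ := (Complex.abs_im_le_norm _).trans (hCφ ((t, T), 0) ⟨hq, h0m⟩)
    have d1 := (abs_real_inner_le_norm ((ψ t T (0, y₁)).2 - y₁) (x : V)).trans
      (mul_le_mul_of_nonneg_right (hψy (t, T) hq y₁ h1m) hxn.le)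
    have d0 := (abs_real_inner_le_norm ((ψ t T (0, 0)).2 - 0) (x : V)).trans
      (mul_le_mul_of_nonneg_right (hψy (t, T) hq 0 h0m) hxn.le)
    have l := (le_abs_self _).trans hπ
    rw [e1] at l
    linarith [neg_le_of_abs_le b1, le_of_abs_le b0, neg_le_of_abs_le d1, le_of_abs_le d0]
  · have hval : ∫ z, expFun E (0, s • y₁) z ∂μ = Complex.exp (φ t T (0, s • y₁) +
        pairing (ψ t T (0, s • y₁)) (x : V)) := by
      rw [hμ, integral_expFun hX hA htT (hyU _), expFun_coe,
        ← hφ k _ (hQy _ hq _ (hsy s hs)), Complex.exp_add]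
    rw [hval, Complex.norm_exp, Complex.ofReal_exp, ← Complex.exp_add]
    congr 1
    apply Complex.ext <;> simp [hh, pairing]
  · rw [hnorm _ (hsy s hs)]
    exact hGc₁ _ (hzS _ (hsy s hs))
  · refine lt_of_pow_lt_pow_left₀ 2 hc₁.le ((hosc ?_).trans_lt ?_)
    · rw [← sub_smul, norm_smul, hy₁n, mul_one]
      exact hss
    · have : 4 * κ ^ 2 + 12 * η / m = c₁ ^ 2 / 2 := by
        rw [hκ, hη]
        field_simp
        ring
      rw [this]
      exact half_lt_self (by positivity)

end EscapeToInfinity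

/-! ### Continuity on the diagonal and vanishing at the cemetery -/

section AffineInterface

variable {V : Type*} [NormedAddCommGroup V] [InnerProductSpace ℝ V]
  [FiniteDimensional ℝ V] {E : Set V} (hE : IsClosed E)
  (hEbasis : ∃ e : Fin (Module.finrank ℝ V + 1) → V, (∀ i, e i ∈ E) ∧ AffineIndependent ℝ e)
  {Ω : Type*} {mΩ : MeasurableSpace Ω} {F : Filtration ℝ≥0 mΩ}
  {X : ℝ≥0 → Ω → OnePoint E} {Pr : ℝ≥0 → OnePoint E → Measure Ω}
  (hX : IsMarkovProcess F X Pr)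
  {Φ : ℝ≥0 → ℝ≥0 → V × V → ℂ} {ψ : ℝ≥0 → ℝ≥0 → V × V → V × V} {φ : ℝ≥0 → ℝ≥0 → V × V → ℂ}
  (hA : IsAffineWith E (transition X Pr) Φ ψ)
  (hψ0 : ψ 0 0 0 = 0)
  (hφ : ∀ k, ∀ p ∈ setQk E Φ k, Complex.exp (φ p.1 p.2.1 p.2.2) = Φ p.1 p.2.1 p.2.2)
  (hψc : ∀ k, ContinuousOn (fun p : ℝ≥0 × ℝ≥0 × V × V => ψ p.1 p.2.1 p.2.2) (setQk E Φ k))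
  (hφc : ∀ k, ContinuousOn (fun p : ℝ≥0 × ℝ≥0 × V × V => φ p.1 p.2.1 p.2.2) (setQk E Φ k))
  (hΦc : ∀ k, ContinuousOn (fun p : ℝ≥0 × ℝ≥0 × V × V => Φ p.1 p.2.1 p.2.2) (setDk E k))

omit [InnerProductSpace ℝ V] [FiniteDimensional ℝ V] in
theorem exists_mem_ballSet {z : OnePoint E} (hz : z ≠ OnePoint.infty) :
    ∃ n : ℕ, z ∈ ballSet E n := by
  induction z with
  | infty => exact absurd rfl hz
  | coe x =>
    obtain ⟨n, hn⟩ := exists_nat_ge ‖(x : V)‖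
    exact ⟨n, x, hn, rfl⟩

include hE hEbasis hX hA hψ0 hφ hψc hφc hΦc in
-- The contrapositive of the escape estimate: complements of bounded sets are neighbourhoods of Δ.
theorem exists_eventually_measureReal_ballSet_lt (t₀ : ℝ≥0) :
    ∃ δ > 0, ∀ R m : ℝ, 0 < m → ∀ᶠ z in 𝓝 (OnePoint.infty : OnePoint E),
      ∀ t ∈ Metric.closedBall t₀ δ, ∀ T ∈ Metric.closedBall t₀ δ, t ≤ T →
        (transition X Pr t T z).real (ballSet E R) < m := by
  have := t2Space_onePoint hE
  obtain ⟨δ, hδ, h⟩ := exists_bound_of_measureReal_ballSet hE hEbasis hX hA hψ0 hφ hψc hφc hΦc t₀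
  refine ⟨δ, hδ, fun R m hm => ?_⟩
  obtain ⟨R', hR'⟩ := h R m hm
  have hU : (ballSet E R')ᶜ ∈ 𝓝 (OnePoint.infty : OnePoint E) :=
    (isCompact_ballSet hE R').isClosed.isOpen_compl.mem_nhds (by simp [ballSet])
  filter_upwards [hU] with z hz t ht T hT htT
  induction z with
  | infty =>
    rw [hX.transition_infty, measureReal_def, Measure.dirac_apply' _ (measurableSet_ballSet R hE),
      indicator_of_notMem (by simp [ballSet])]
    simpa using hm
  | coe x =>
    by_contra! hlt
    exact hz ⟨x, hR' t ht T hT htT x hlt, rfl⟩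

include hE hEbasis hX hA hψ0 hφ hψc hφc hΦc in
theorem vanishesAtCemetery : VanishesAtCemetery X Pr fun n : ℕ => ballSet E n := by
  intro t₀
  obtain ⟨δ, hδ, h⟩ :=
    exists_eventually_measureReal_ballSet_lt hE hEbasis hX hA hψ0 hφ hψc hφc hΦc t₀
  have hδT : ∀ᶠ T in 𝓝[>] t₀, T ∈ Metric.closedBall t₀ δ :=
    nhdsWithin_le_nhds (Metric.closedBall_mem_nhds t₀ hδ)
  filter_upwards [hδT, self_mem_nhdsWithin] with T hT htT n
  simp only [integral_indicator_const _ (measurableSet_ballSet (n : ℝ) hE), smul_eq_mul, mul_one]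
  rw [Metric.nhds_basis_ball.tendsto_right_iff]
  intro m hm
  have h0 : ∀ᶠ t in 𝓝 t₀, t ∈ Metric.closedBall t₀ δ := Metric.closedBall_mem_nhds t₀ hδ
  have h1 : ∀ᶠ t in 𝓝 t₀, t ∈ Metric.closedBall t₀ δ ∧ t ≤ T :=
    h0.and (eventually_le_nhds htT)
  rw [nhds_prod_eq]
  filter_upwards [h1.prod_mk (h n m hm)] with p hp
  rw [Metric.mem_ball, Real.dist_eq, sub_zero, abs_of_nonneg measureReal_nonneg]
  exact hp.2 _ hp.1.1 T hT hp.1.2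

include hE hEbasis hX hA hψ0 hφ hψc hφc hΦc in
theorem isContinuousOnDiagonal : IsContinuousOnDiagonal X Pr := by
  intro f t₀ x
  induction x with
  | coe x => exact tendsto_integral_diagonal_coe hE hEbasis hX hA hψc hΦc hψ0 f t₀ x
  | infty =>
    have := t2Space_onePoint hE
    obtain ⟨δ, hδ, h⟩ :=
      exists_eventually_measureReal_ballSet_lt hE hEbasis hX hA hψ0 hφ hψc hφc hΦc t₀
    rw [Metric.nhds_basis_closedBall.tendsto_right_iff]
    intro ε hε
    set a := f OnePoint.infty with ha
    -- `f` is close to `f(Δ)` outside of a bounded set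
    obtain ⟨R, hR⟩ : ∃ R : ℝ, ∀ z ∉ ballSet E R, |f z - a| ≤ ε / 2 := by
      set U : Set (OnePoint E) := {z | |f z - a| < ε / 2} with hU
      have hUo : IsOpen U := isOpen_lt (by fun_prop) continuous_const
      have hUi : OnePoint.infty ∈ U := by simp [hU, ha, hε]
      obtain ⟨-, hc⟩ := (OnePoint.isOpen_iff_of_mem hUi).1 hUo
      obtain ⟨R, hR⟩ := hc.exists_bound_of_continuousOn
        (f := fun x : E => (x : V)) continuous_subtype_val.continuousOn
      refine ⟨R, fun z hz => ?_⟩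
      by_contra hlt
      induction z with
      | infty => exact hlt (by simp [ha, (half_pos hε).le])
      | coe x => exact hz ⟨x, hR x fun hx => hlt (le_of_lt hx), rfl⟩
    -- On the bounded set f differs from f(Δ) by at most 2‖f‖, so mass less than m there contributes
    -- at most ε/2.
    set m := ε / (4 * (‖f‖ + 1)) with hm
    have hm0 : 0 < m := by positivity
    have h1 : ∀ᶠ t in 𝓝 t₀, t ∈ Metric.closedBall t₀ δ := Metric.closedBall_mem_nhds t₀ hδ
    have h2 : ∀ᶠ p : ℝ≥0 × ℝ≥0 × OnePoint E in 𝓝 (t₀, t₀, OnePoint.infty),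
        p.1 ∈ Metric.closedBall t₀ δ ∧ p.2.1 ∈ Metric.closedBall t₀ δ ∧
          ∀ t ∈ Metric.closedBall t₀ δ, ∀ T ∈ Metric.closedBall t₀ δ, t ≤ T →
            (transition X Pr t T p.2.2).real (ballSet E R) < m := by
      rw [nhds_prod_eq, nhds_prod_eq]
      exact h1.prod_mk (h1.prod_mk (h R m hm0))
    filter_upwards [nhdsWithin_le_nhds h2, self_mem_nhdsWithin] with p hp hle
    have hlt := hp.2.2 _ hp.1 _ hp.2.1 hle
    have := hX.isProbabilityMeasure_transition p.1 p.2.1 p.2.2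
    set μ := transition X Pr p.1 p.2.1 p.2.2
    have hK := measurableSet_ballSet R hE
    have hfi : Integrable f μ := .of_bound f.continuous.measurable.aestronglyMeasurable ‖f‖
      (ae_of_all _ f.norm_coe_le_norm)
    have hpt : ∀ z, ‖f z - a‖ ≤ ε / 2 + (ballSet E R).indicator (fun _ => 2 * ‖f‖) z := by
      intro z
      by_cases hz : z ∈ ballSet E R
      · rw [indicator_of_mem hz]
        refine (norm_sub_le _ _).trans ?_
        linarith [f.norm_coe_le_norm z, f.norm_coe_le_norm OnePoint.infty]
      · rw [indicator_of_notMem hz, add_zero]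
        exact hR z hz
    have hgi : Integrable (fun z => ε / 2 + (ballSet E R).indicator (fun _ => 2 * ‖f‖) z) μ :=
      (integrable_const _).add ((integrable_const _).indicator hK)
    have h3 : ‖∫ z, (f z - a) ∂μ‖ ≤ ε / 2 + μ.real (ballSet E R) * (2 * ‖f‖) := by
      refine (norm_integral_le_of_norm_le hgi (ae_of_all _ hpt)).trans (le_of_eq ?_)
      rw [integral_add (integrable_const _) ((integrable_const _).indicator hK),
        integral_indicator_const _ hK]
      simp
    rw [integral_sub hfi (integrable_const _)] at h3
    simp only [integral_const, probReal_univ, one_smul] at h3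
    rw [Metric.mem_closedBall, Real.dist_eq]
    refine h3.trans ?_
    have h4 : μ.real (ballSet E R) * (2 * ‖f‖) ≤ m * (2 * (‖f‖ + 1)) :=
      mul_le_mul hlt.le (by linarith) (by positivity) hm0.le
    have h5 : m * (2 * (‖f‖ + 1)) = ε / 2 := by
      rw [hm]
      field_simp
      ring
    linarith

end AffineInterface

end AffineProcess
end

/-! ### The theorem -/

theorem mainTheorem3 {V : Type*} [NormedAddCommGroup V] [InnerProductSpace ℝ V]
    [FiniteDimensional ℝ V] (E : Set V) (hE : IsClosed E)
    (hEbasis : ∃ e : Fin (Module.finrank ℝ V + 1) → V,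
      (∀ i, e i ∈ E) ∧ AffineIndependent ℝ e)
    {Ω : Type*} {mΩ : MeasurableSpace Ω} (F : Filtration ℝ≥0 mΩ)
    (X : ℝ≥0 → Ω → OnePoint E) (Pr : ℝ≥0 → OnePoint E → Measure Ω)
    (hX : IsMarkovProcess F X Pr)
    (hP : IsContinuouslyAffine E (transition X Pr)) :
    -- the process is càdlàg
    (∀ ω, IsCadlag fun t => barX X t ω) ∧
    -- it is adapted to the completed filtration
    (∀ t, Measurable[barF F Pr t] (barX X t)) ∧
    -- it is a modification of `X`
    (∀ r x t, ∀ᵐ ω ∂(Pr r x), barX X t ω = X t ω) ∧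
    -- it almost surely stays in the cemetery
    (∀ r x, ∀ᵐ ω ∂(Pr r x), ∀ s t, s < t →
      barX X s ω = OnePoint.infty → barX X t ω = OnePoint.infty) ∧
    -- it has the strong Markov property
    (∀ (τ : Ω → WithTop ℝ≥0) (hτ : IsStoppingTime (barF F Pr) τ) (f : OnePoint E → ℝ),
      Measurable f → (∃ C : ℝ, ∀ y, |f y| ≤ C) → f OnePoint.infty = 0 →
      ∀ (r : ℝ≥0) (x : OnePoint E) (s : ℝ≥0),
        Integrable (fun ω => f (valueAt (barX X) ω (τ ω + s))) (barPr Pr r x) ∧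
        Measurable[hτ.measurableSpace] (fun ω =>
          transitionAt (transition X Pr) f r s (valueAt (barX X) ω (τ ω)) (τ ω)) ∧
        (barPr Pr r x)[fun ω => f (valueAt (barX X) ω (τ ω + s)) | hτ.measurableSpace]
          =ᵐ[barPr Pr r x] (fun ω =>
            expectationAt (barPr Pr) (barX X) f r s (valueAt (barX X) ω (τ ω)) (τ ω)) ∧
        (∀ ω, expectationAt (barPr Pr) (barX X) f r s (valueAt (barX X) ω (τ ω)) (τ ω) =
          transitionAt (transition X Pr) f r s (valueAt (barX X) ω (τ ω)) (τ ω))) := by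
  obtain ⟨Φ, ψ, φ, hA, hψ0, -, hφ, hψc, hφc, hΦc, hPc⟩ := hP
  have := t2Space_onePoint hE
  have := secondCountableTopology_onePoint_subtype hE
  have hD := isContinuousOnDiagonal hE hEbasis hX hA hψ0 hφ hψc hφc hΦc
  have hV := vanishesAtCemetery hE hEbasis hX hA hψ0 hφ hψc hφc hΦc
  have hK : ∀ n : ℕ, MeasurableSet (ballSet E n) := fun n => measurableSet_ballSet (n : ℝ) hE
  have hKU : ∀ y : OnePoint E, y ≠ OnePoint.infty → ∃ n : ℕ, y ∈ ballSet E n :=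
    fun y hy => exists_mem_ballSet hy
  have hbar := fun r x t => hX.ae_barX_eq hD hK hKU hV r x t
  have habs := fun r x => hX.ae_barX_absorbing hD hK hKU hV r x
  refine ⟨fun ω => isCadlag_barX ω, hX.measurable_barX hbar, hbar, habs,
    fun τ hτ f hf hfC hf0 r x s => ?_⟩
  obtain ⟨h1, h2, h3⟩ := strongMarkov_barX (g := fun y : V => expFun E (0, y)) hX hbar habs
    (measurable_uncurry_transition hE hX hPc) (fun y => measurable_expFun _)
    (fun y => norm_expFun_imag_le y)
    (fun y d => exists_tendsto_integral_expFun hX hA hψc hΦc y d)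
    (fun ν₁ ν₂ _ _ hu h => measure_ext_of_expFun hE ν₁ ν₂ hu h) hτ hf hfC hf0 r x s
  have he := fun ω => expectationAt_eq_transitionAt hX hbar hf r s (valueAt (barX X) ω (τ ω)) (τ ω)
  refine ⟨h1, h2, ?_, he⟩
  simp only [he]
  exact h3
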